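/- Let $k$ be a field and let $A=\bigoplus_{n\ge 0}A_n$ be a nonnegatively graded connected $k$-algebra ($A_0=k$) with $\dim_k A_n<\infty$ for all $n$. Write $A=T(V)/(R)$, where $V$ is a positively graded vector space, $\pi\colon T(V)\to A$ is the (degree preserving) projection, and $R\subseteq T(V)^{\ge 2}=\bigoplus_{N\ge 2}V^{\otimes N}$ is a space of relations: a subspace, graded for the grading of $T(V)$ induced by that of $V$, that generates the two-sided ideal $\ker\pi$ and satisfies $R\cap\big(T(V)_{>0}\,R\,T(V)+T(V)\,R\,T(V)_{>0}\big)=0$. (Products of subspaces of $T(V)$ are taken in $T(V)$, $V^{(N)}=V^{\otimes N}$, and $R^{(i)}$ is the $i$-fold product of $R$ with itself, $R^{(0)}=k$.) Define graded subspaces $J_i\subseteq T(V)$, $i\ge 0$, recursively by $J_0=k$, $$J_{2i+1}=(V\,J_{2i})\cap(J_{2i}\,V),\qquad J_{2i+2}=\Big(\sum_{N\ge 1}\ \bigcap_{\bar n,\bar m}V^{(m_1)}J_{2n_1}\cdots V^{(m_i)}J_{2n_i}V^{(m_{i+1})}\Big)\cap R^{(i+1)},$$ where the intersection is over all $\bar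 n\in\mathbb N_0^{\,i}$ with $n_1+\dots+n_i=i$ and all $\bar m\in\mathbb N_0^{\,i+1}$ with $m_1+\dots+m_{i+1}=N$. The multi-Koszul bimodule complex of $A$ is $\cdots\to A\otimes J_1\otimes A\to A\otimes J_0\otimes A\to A$, with augmentation given by the multiplication of $A$ and with $A$-bimodule differentials $\delta^b_i\colon A\otimes J_i\otimes A\to A\otimes J_{i-1}\otimes A$ determined as follows. For $\omega\in J_{2j+1}$, written as $\omega=\sum v\,w$ and as $\omega=\sum w'\,v'$ with $v,v'\in V$ and $w,w'\in J_{2j}$, put $\delta^b_{2j+1}(1\otimes\omega\otimes 1)=\sum\pi(v)\otimes w\otimes 1-\sum 1\otimes w'\otimes\pi(v')$. Each $\omega\in J_{2j+2}$ is uniquely a finite sum $\omega=\sum_{N\ge 0}\omega^N$ with $\omega^N\in\bigcap_{l=0}^N V^{(l)}J_{2j+1}V^{(N-l)}$; writing $\omega^N=\sum\omega_{(1)}^{l}\,\omega_{(2)}^{l}\,\omega_{(3)}^{l}$ with $\omega_{(1)}^{l}\in V^{(l)}$, $\omega_{(2)}^{l}\in J_{2j+1}$, $\omega_{(3)}^{l}\in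 V^{(N-l)}$, put $\delta^b_{2j+2}(1\otimes\omega\otimes 1)=\sum_N\sum_{l=0}^N\sum\pi(\omega_{(1)}^{l})\otimes\omega_{(2)}^{l}\otimes\pi(\omega_{(3)}^{l})$. The left (resp. right) multi-Koszul complex, with terms $A\otimes J_i$ (resp. $J_i\otimes A$) and augmented to $k$, is obtained from it by applying $(-)\otimes_A k$ (resp. $k\otimes_A(-)$). The algebra $A$ is called left (resp. right) multi-Koszul if its augmented left (resp. right) multi-Koszul complex is exact, i.e. is a resolution of the trivial left (resp. right) $A$-module $k$. Then $A$ is left (resp. right) multi-Koszul if and only if for every $i\ge 0$ there is an isomorphism of graded vector spaces $$\operatorname{Tor}_i^A(k,k)\simeq J_i ,$$ where both sides carry the internal grading induced by the gradings of $A$ and $V$. -/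

import Mathlib

open scoped TensorProduct DirectSum

noncomputable section

namespace MultiKoszul

universe u v w

/-! ### Subspaces of the tensor algebra -/

section TensorAlgebraSubspaces

variable {k : Type u} [Field k] {V : Type v} [AddCommGroup V] [Module k V]

variable (k V) in
/-- `V`, regarded as a subspace of `T(V)`. The power `(gen k V) ^ N` is `V^{(N)} = V^{⊗ N}`;
these are the homogeneous components of `T(V)` for the special (tensor) grading. -/
def gen : Submodule k (TensorAlgebra k V) := LinearMap.range (TensorAlgebra.ι k)

variable (k V) in
/-- The subspace `T(V)^{≥ m} = ⨁_{N ≥ m} V^{(N)}`. For a positively graded `V`, the space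
`T(V)^{≥ 1}` is also the irrelevant ideal `T(V)_{>0}` of the usual grading. -/
def tensorGE (m : ℕ) : Submodule k (TensorAlgebra k V) := ⨆ N : ℕ, gen k V ^ (m + N)

/-- The usual grading of `T(V)`, induced by a grading of `V`: the component of degree `n` is
spanned by the products `v₁ ⋯ v_r` with `v_j` homogeneous of degree `e_j` and `∑ e_j = n`. -/
def usualGrading (𝒱 : ℕ → Submodule k V) (n : ℕ) : Submodule k (TensorAlgebra k V) :=
  Submodule.span k {x | ∃ (r : ℕ) (e : Fin r → ℕ) (v : Fin r → V), (∀ j, v j ∈ 𝒱 (e j)) ∧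
    ∑ j, e j = n ∧ x = (List.ofFn fun j => TensorAlgebra.ι k (v j)).prod}

/-- `evenJ R i` is `J_{2 i}`. Here `J_0 = k`, and `J_{2(i+1)}` is the intersection of `R^{(i+1)}`
with the sum over `N ≥ 1` of the intersections, over all `(n_1, …, n_i) ∈ ℕ^i` with sum `i` and
all `(m_1, …, m_{i+1}) ∈ ℕ^{i+1}` with sum `N`, of the subspaces
`V^{(m_1)} J_{2 n_1} ⋯ V^{(m_i)} J_{2 n_i} V^{(m_{i+1})}`.
The entries of a tuple with sum `i` are at most `i`, so that they are taken in `Fin (i + 1)`. -/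
def evenJ (R : Submodule k (TensorAlgebra k V)) : ℕ → Submodule k (TensorAlgebra k V)
  | 0 => 1
  | i + 1 =>
    (⨆ N : {N : ℕ // 1 ≤ N},
      ⨅ (n : {n : Fin i → Fin (i + 1) // ∑ j, (n j : ℕ) = i})
        (m : {m : Fin (i + 1) → ℕ // ∑ j, m j = N.1}),
        (List.ofFn fun j : Fin i => gen k V ^ m.1 j.castSucc * evenJ R (n.1 j)).prod *
          gen k V ^ m.1 (Fin.last i)) ⊓ R ^ (i + 1)
  termination_by i => i
  decreasing_by exact (n.1 j).isLt

/-- `J_{2 i} = evenJ R i` and `J_{2 i + 1} = (V ⊗ J_{2 i}) ∩ (J_{2 i} ⊗ V)`. -/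
def J (R : Submodule k (TensorAlgebra k V)) (i : ℕ) : Submodule k (TensorAlgebra k V) :=
  if Even i then evenJ R (i / 2)
  else (gen k V * evenJ R (i / 2)) ⊓ (evenJ R (i / 2) * gen k V)

/-- The homogeneous components, for the usual grading, of the graded vector space `J_i`. -/
def gradingJ (𝒱 : ℕ → Submodule k V) (R : Submodule k (TensorAlgebra k V)) (i d : ℕ) :
    Submodule k (J R i) :=
  (usualGrading 𝒱 d).submoduleOf (J R i)

/-- The multiplication map `P ⊗ (Q ⊗ S) → T(V)` of three subspaces of `T(V)`. -/
def mul3 (P Q S : Submodule k (TensorAlgebra k V)) : P ⊗[k] (Q ⊗[k] S) →ₗ[k] TensorAlgebra k V :=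
  LinearMap.mul' k (TensorAlgebra k V) ∘ₗ TensorProduct.map P.subtype (Submodule.mulMap Q S)

/-- The subspace `⋂_{0 ≤ l ≤ N} V^{(l)} ⊗ W ⊗ V^{(N - l)}` of `T(V)`. -/
def interT (W : Submodule k (TensorAlgebra k V)) (N : ℕ) : Submodule k (TensorAlgebra k V) :=
  ⨅ l : Fin (N + 1), gen k V ^ (l : ℕ) * W * gen k V ^ (N - l)

end TensorAlgebraSubspaces

/-! ### Connected graded algebras and their presentations -/

section Presentation

variable {k : Type u} [Field k] {A : Type w} [Ring A] [Algebra k A]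

/-- A nonnegatively graded algebra is connected if its component of degree zero is `k · 1`,
of dimension one. -/
def IsConnectedGraded (𝒜 : ℕ → Submodule k A) : Prop := Nontrivial A ∧ 𝒜 0 = 1

variable {V : Type v} [AddCommGroup V] [Module k V]

/-- `π : T(V) → A` presents the graded algebra `A` as `T(V)/(R)`, where `V` is a positively graded
space of generators and `R ⊆ T(V)^{≥ 2}` a (minimal) space of relations. -/
structure IsMinimalPresentation (𝒱 : ℕ → Submodule k V) (𝒜 : ℕ → Submodule k A)
    (π : TensorAlgebra k V →ₐ[k] A) (R : Submodule k (TensorAlgebra k V)) : Prop where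
  /-- The grading of `V` is positive. -/
  positive : 𝒱 0 = ⊥
  /-- `π` preserves degrees. -/
  map_mem : ∀ (n : ℕ) (v : V), v ∈ 𝒱 n → π (TensorAlgebra.ι k v) ∈ 𝒜 n
  surjective : Function.Surjective π
  /-- The kernel of `π` is the two-sided ideal generated by `R`. -/
  ker_eq : TwoSidedIdeal.ker π = TwoSidedIdeal.span (R : Set (TensorAlgebra k V))
  /-- `R` is a graded subspace for the usual grading. -/
  graded : R = ⨆ d : ℕ, R ⊓ usualGrading 𝒱 d
  le_two : R ≤ tensorGE k V 2
  /-- `R ∩ (T(V)_{>0} ⊗ R ⊗ T(V) + T(V) ⊗ R ⊗ T(V)_{>0}) = 0`. -/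
  minimal : R ⊓ (tensorGE k V 1 * R * ⊤ ⊔ ⊤ * R * tensorGE k V 1) = ⊥

variable (𝒜 : ℕ → Submodule k A) [GradedAlgebra 𝒜]

/-- The augmentation `A → A_0 ≃ k` of a connected graded algebra. (The inverse of the isomorphism
`k ≃ A_0` is a left inverse of the injective map `k → A`, `c ↦ c · 1`.) -/
def augmentation : A →ₗ[k] k :=
  (Algebra.linearMap k A).leftInverse ∘ₗ GradedAlgebra.proj 𝒜 0

/-- The irrelevant ideal `A_{>0} = ⨁_{n > 0} A_n`, i.e. the set of the elements whose component
of degree zero vanishes, as a nonunital algebra. -/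
def irrelevant : NonUnitalSubalgebra k A where
  __ := LinearMap.ker (GradedAlgebra.proj 𝒜 0)
  mul_mem' {a b} ha _ := by
    have h (x : A) : GradedAlgebra.proj 𝒜 0 x = GradedRing.projZeroRingHom 𝒜 x := rfl
    change GradedAlgebra.proj 𝒜 0 a = 0 at ha
    change GradedAlgebra.proj 𝒜 0 (a * b) = 0
    rw [h] at ha ⊢
    rw [map_mul, ha, zero_mul]

end Presentation

/-! ### The multi-Koszul complexes -/

section Complex

variable {k : Type u} [Field k] {A : Type w} [Ring A] [Algebra k A]
variable {V : Type v} [AddCommGroup V] [Module k V]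
variable (π : TensorAlgebra k V →ₐ[k] A)


variable (k A) in
/-- The left action of `A` on `A ⊗ W ⊗ A`: `x` acts by `a ⊗ w ⊗ b ↦ (x a) ⊗ w ⊗ b`. -/
def actL (W : Type*) [AddCommGroup W] [Module k W] :
    A →ₗ[k] A ⊗[k] (W ⊗[k] A) →ₗ[k] A ⊗[k] (W ⊗[k] A) :=
  LinearMap.rTensorHom (W ⊗[k] A) ∘ₗ LinearMap.mul k A

variable (k A) in
/-- The right action of `A` on `A ⊗ W ⊗ A`: `y` acts by `a ⊗ w ⊗ b ↦ a ⊗ w ⊗ (b y)`. -/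
def actR (W : Type*) [AddCommGroup W] [Module k W] :
    A →ₗ[k] A ⊗[k] (W ⊗[k] A) →ₗ[k] A ⊗[k] (W ⊗[k] A) :=
  LinearMap.lTensorHom A ∘ₗ LinearMap.lTensorHom W ∘ₗ (LinearMap.mul k A).flip

/-- The `A`-bimodule map `A ⊗ U ⊗ A → A ⊗ W ⊗ A` that extends a linear map `f : U → A ⊗ W ⊗ A`. -/
def bimoduleExtend {U W : Type*} [AddCommGroup U] [Module k U] [AddCommGroup W] [Module k W]
    (f : U →ₗ[k] A ⊗[k] (W ⊗[k] A)) : A ⊗[k] (U ⊗[k] A) →ₗ[k] A ⊗[k] (W ⊗[k] A) :=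
  TensorProduct.lift
    (LinearMap.lcomp k _ (TensorProduct.lift ((actR k A W).flip ∘ₗ f)) ∘ₗ actL k A W)

theorem bimoduleExtend_tmul {U W : Type*} [AddCommGroup U] [Module k U] [AddCommGroup W]
    [Module k W] (f : U →ₗ[k] A ⊗[k] (W ⊗[k] A)) (x y : A) (u : U) :
    bimoduleExtend f (x ⊗ₜ (u ⊗ₜ y)) = actL k A W x (actR k A W y (f u)) := rfl

/-- The map `V^{(l)} W V^{(m)} → A ⊗ W ⊗ A`, `ω₁ ω₂ ω₃ ↦ π(ω₁) ⊗ ω₂ ⊗ π(ω₃)` for `ω₁ ∈ V^{(l)}`,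
`ω₂ ∈ W` and `ω₃ ∈ V^{(m)}`. The multiplication `V^{(l)} ⊗ W ⊗ V^{(m)} → T(V)` is injective for
every subspace `W` of `T(V)`, and the map is only applied to elements of its image. -/
def splitMap (W : Submodule k (TensorAlgebra k V)) (l m : ℕ) :
    TensorAlgebra k V →ₗ[k] A ⊗[k] (W ⊗[k] A) :=
  TensorProduct.map (π.toLinearMap ∘ₗ (gen k V ^ l).subtype)
      (TensorProduct.map LinearMap.id (π.toLinearMap ∘ₗ (gen k V ^ m).subtype)) ∘ₗ
    LinearMap.leftInverse (V := ↥(gen k V ^ l) ⊗[k] (W ⊗[k] ↥(gen k V ^ m)))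
      (V' := TensorAlgebra k V) (mul3 (gen k V ^ l) W (gen k V ^ m))

/-- The map `(V ⊗ W) ∩ (W ⊗ V) → A ⊗ W ⊗ A` that sends `ω`, written both as a sum of products
`v w` and as a sum of products `w' v'`, to `π(v) ⊗ w ⊗ 1 - 1 ⊗ w' ⊗ π(v')`. -/
def oddMap (W : Submodule k (TensorAlgebra k V)) : TensorAlgebra k V →ₗ[k] A ⊗[k] (W ⊗[k] A) :=
  splitMap π W 1 0 - splitMap π W 0 1

/-- The map `⨁_N ⋂_{0 ≤ l ≤ N} V^{(l)} ⊗ W ⊗ V^{(N - l)} → A ⊗ W ⊗ A` that sends `ω` in the `N`-th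
summand, written for each `l` as a sum of products `ω₁^l ω₂^l ω₃^l`, to
`∑_{0 ≤ l ≤ N} π(ω₁^l) ⊗ ω₂^l ⊗ π(ω₃^l)`. For `W = J_{2 j + 1}` the sum over `N` of these subspaces
of `T(V)` is direct and contains `J_{2 j + 2}`, and the map is only applied to elements of
`J_{2 j + 2}`. -/
def evenMap (W : Submodule k (TensorAlgebra k V)) : TensorAlgebra k V →ₗ[k] A ⊗[k] (W ⊗[k] A) :=
  DirectSum.toModule k ℕ (A ⊗[k] (W ⊗[k] A))
      (fun N => (∑ l : Fin (N + 1), splitMap π W l (N - l)) ∘ₗ (interT W N).subtype) ∘ₗ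
    LinearMap.leftInverse (V := ⨁ N, interT W N) (V' := TensorAlgebra k V)
      (DirectSum.coeLinearMap (interT W))

variable (R : Submodule k (TensorAlgebra k V))

/-- The differential `δ^b_{i+1} : A ⊗ J_{i+1} ⊗ A → A ⊗ J_i ⊗ A` of the multi-Koszul bimodule
complex. -/
def bimoduleD (i : ℕ) : A ⊗[k] (J R (i + 1) ⊗[k] A) →ₗ[k] A ⊗[k] (J R i ⊗[k] A) :=
  bimoduleExtend ((if Even i then oddMap π (J R i) else evenMap π (J R i)) ∘ₗ
    (J R (i + 1)).subtype)

/-- The augmentation `δ^b_0 : A ⊗ J_0 ⊗ A → A` of the multi-Koszul bimodule complex, given by the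
multiplication of `A` (where `J_0 = k`). -/
def bimoduleAug : A ⊗[k] (J R 0 ⊗[k] A) →ₗ[k] A :=
  LinearMap.mul' k A ∘ₗ TensorProduct.map LinearMap.id
    (LinearMap.mul' k A ∘ₗ TensorProduct.map (π.toLinearMap ∘ₗ (J R 0).subtype) LinearMap.id)

variable (𝒜 : ℕ → Submodule k A) [GradedAlgebra 𝒜]

/-- The map `A ⊗ W ⊗ A → (A ⊗ W ⊗ A) ⊗_A k = A ⊗ W`, `a ⊗ w ⊗ b ↦ ε(b) a ⊗ w`, where `ε` is the
augmentation. -/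
def tensorRight (W : Type*) [AddCommGroup W] [Module k W] :
    A ⊗[k] (W ⊗[k] A) →ₗ[k] A ⊗[k] W :=
  TensorProduct.map LinearMap.id
    ((TensorProduct.rid k W).toLinearMap ∘ₗ TensorProduct.map LinearMap.id (augmentation 𝒜))

/-- The map `A ⊗ W ⊗ A → k ⊗_A (A ⊗ W ⊗ A) = W ⊗ A`, `a ⊗ w ⊗ b ↦ ε(a) w ⊗ b`, where `ε` is the
augmentation. -/
def tensorLeft (W : Type*) [AddCommGroup W] [Module k W] :
    A ⊗[k] (W ⊗[k] A) →ₗ[k] W ⊗[k] A :=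
  (TensorProduct.lid k (W ⊗[k] A)).toLinearMap ∘ₗ
    TensorProduct.map (augmentation 𝒜) LinearMap.id

/-- The differential `δ_{i+1} = δ^b_{i+1} ⊗_A k : A ⊗ J_{i+1} → A ⊗ J_i` of the left multi-Koszul
complex. The class of `x` in `(A ⊗ W ⊗ A) ⊗_A k = A ⊗ W` is computed through the lift
`a ⊗ w ⊗ 1` of `a ⊗ w`. -/
def leftD (i : ℕ) : A ⊗[k] J R (i + 1) →ₗ[k] A ⊗[k] J R i :=
  tensorRight 𝒜 (J R i) ∘ₗ bimoduleD π R i ∘ₗ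
    TensorProduct.map LinearMap.id ((TensorProduct.mk k (J R (i + 1)) A).flip 1)

/-- The augmentation `δ_0 = δ^b_0 ⊗_A k : A ⊗ J_0 → k` of the left multi-Koszul complex. -/
def leftAug : A ⊗[k] J R 0 →ₗ[k] k :=
  augmentation 𝒜 ∘ₗ bimoduleAug π R ∘ₗ
    TensorProduct.map LinearMap.id ((TensorProduct.mk k (J R 0) A).flip 1)

/-- The differential `δ'_{i+1} = k ⊗_A δ^b_{i+1} : J_{i+1} ⊗ A → J_i ⊗ A` of the right multi-Koszul
complex. -/
def rightD (i : ℕ) : J R (i + 1) ⊗[k] A →ₗ[k] J R i ⊗[k] A :=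
  tensorLeft 𝒜 (J R i) ∘ₗ bimoduleD π R i ∘ₗ TensorProduct.mk k A (J R (i + 1) ⊗[k] A) 1

/-- The augmentation `δ'_0 = k ⊗_A δ^b_0 : J_0 ⊗ A → k` of the right multi-Koszul complex. -/
def rightAug : J R 0 ⊗[k] A →ₗ[k] k :=
  augmentation 𝒜 ∘ₗ bimoduleAug π R ∘ₗ TensorProduct.mk k A (J R 0 ⊗[k] A) 1

/-- `A = T(V)/(R)` is left multi-Koszul: the augmented left multi-Koszul complex
`⋯ → A ⊗ J_2 → A ⊗ J_1 → A ⊗ J_0 → k → 0` is exact. -/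
def IsLeftMultiKoszul : Prop :=
  Function.Surjective (leftAug π R 𝒜) ∧
    Function.Exact (leftD π R 𝒜 0) (leftAug π R 𝒜) ∧
    ∀ i : ℕ, Function.Exact (leftD π R 𝒜 (i + 1)) (leftD π R 𝒜 i)

/-- `A = T(V)/(R)` is right multi-Koszul: the augmented right multi-Koszul complex
`⋯ → J_2 ⊗ A → J_1 ⊗ A → J_0 ⊗ A → k → 0` is exact. -/
def IsRightMultiKoszul : Prop :=
  Function.Surjective (rightAug π R 𝒜) ∧
    Function.Exact (rightD π R 𝒜 0) (rightAug π R 𝒜) ∧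
    ∀ i : ℕ, Function.Exact (rightD π R 𝒜 (i + 1)) (rightD π R 𝒜 i)

end Complex

/-! ### The graded vector spaces `Tor_i^A(k, k)` -/

section Tor

variable (k : Type u) [Field k]

section Bar

variable (I : Type w) [NonUnitalRing I] [Module k I] [IsScalarTower k I I] [SMulCommClass k I I]

/-- The space `I^{⊗ n}` of `n`-chains of the bar complex of the nonunital algebra `I`. -/
abbrev Bar (n : ℕ) : Type _ := ⨂[k] _ : Fin n, I

variable {I}

theorem contractNth_update {n : ℕ} (i : Fin n) (a : Fin (n + 1) → I)
    [DecidableEq (Fin (n + 1))] (p : Fin (n + 1)) :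
    ∃ q : Fin n,
      (∀ x y, ∀ j ≠ q, Fin.contractNth i.castSucc (· * ·) (Function.update a p x) j =
        Fin.contractNth i.castSucc (· * ·) (Function.update a p y) j) ∧
      (∀ x y, Fin.contractNth i.castSucc (· * ·) (Function.update a p (x + y)) q =
        Fin.contractNth i.castSucc (· * ·) (Function.update a p x) q +
        Fin.contractNth i.castSucc (· * ·) (Function.update a p y) q) ∧
      (∀ (c : k) x, Fin.contractNth i.castSucc (· * ·) (Function.update a p (c • x)) q =
        c • Fin.contractNth i.castSucc (· * ·) (Function.update a p x) q) := by
  obtain ⟨p, hp⟩ := p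
  refine ⟨if h : p ≤ i then ⟨p, by omega⟩ else ⟨p - 1, by omega⟩, ?_, ?_, ?_⟩
  · rintro x y ⟨j, hj⟩ hjq
    by_cases h : p ≤ i <;>
    simp only [h, dite_true, dite_false, ne_eq, Fin.mk.injEq] at hjq <;>
    simp only [Fin.contractNth, Function.update_apply, Fin.ext_iff, Fin.val_castSucc,
      Fin.val_succ] <;>
    split_ifs <;> first | rfl | (exfalso; omega)
  · intro x y
    by_cases h : p ≤ i <;>
    simp only [h, dite_true, dite_false, Fin.contractNth, Function.update_apply, Fin.ext_iff,
      Fin.val_castSucc, Fin.val_succ] <;>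
    split_ifs <;>
    first
      | (exfalso; omega)
      | simp [add_mul, mul_add]
  · intro c x
    by_cases h : p ≤ i <;>
    simp only [h, dite_true, dite_false, Fin.contractNth, Function.update_apply, Fin.ext_iff,
      Fin.val_castSucc, Fin.val_succ] <;>
    split_ifs <;>
    first
      | (exfalso; omega)
      | simp [smul_mul_assoc, mul_smul_comm]

variable (I)

/-- The multilinear map `(a_0, …, a_n) ↦ a_0 ⊗ ⋯ ⊗ (a_i a_{i+1}) ⊗ ⋯ ⊗ a_n`. -/
def barFace (n : ℕ) (i : Fin n) : MultilinearMap k (fun _ : Fin (n + 1) => I) (Bar k I n) where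
  toFun a := PiTensorProduct.tprod k (Fin.contractNth i.castSucc (· * ·) a)
  map_update_add' {_} a p x y := by
    classical
    obtain ⟨q, h1, h2, -⟩ := contractNth_update k i a p
    rw [← Function.update_eq_self q (Fin.contractNth i.castSucc (· * ·)
      (Function.update a p (x + y))), h2, (PiTensorProduct.tprod k).map_update_add]
    congr 2 <;> ext1 j <;> by_cases hj : j = q
    · simp [hj]
    · simp [hj, h1 (x + y) x j hj]
    · simp [hj]
    · simp [hj, h1 (x + y) y j hj]
  map_update_smul' {_} a p c x := by
    classical
    obtain ⟨q, h1, -, h3⟩ := contractNth_update k i a p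
    rw [← Function.update_eq_self q (Fin.contractNth i.castSucc (· * ·)
      (Function.update a p (c • x))), h3, (PiTensorProduct.tprod k).map_update_smul]
    congr 2
    ext1 j
    by_cases hj : j = q
    · simp [hj]
    · simp [hj, h1 (c • x) x j hj]

/-- The differential of the bar complex,
`[a_0 | ⋯ | a_n] ↦ ∑_{0 ≤ i < n} (-1)^i [a_0 | ⋯ | a_i a_{i+1} | ⋯ | a_n]`. -/
def barD (n : ℕ) : Bar k I (n + 1) →ₗ[k] Bar k I n :=
  ∑ i : Fin n, (-1 : k) ^ (i : ℕ) • PiTensorProduct.lift (barFace k I n i)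

/-- The cycles of the bar complex. -/
def barCycles : (n : ℕ) → Submodule k (Bar k I n)
  | 0 => ⊤
  | n + 1 => LinearMap.ker (barD k I n)

/-- The `n`-th homology of the bar complex. -/
abbrev BarHomology (n : ℕ) : Type _ :=
  barCycles k I n ⧸ (LinearMap.range (barD k I n)).submoduleOf (barCycles k I n)

variable {k I}

/-- The component of internal degree `d` of `I^{⊗ n}`, for a grading of `I`. -/
def barGrading (ℐ : ℕ → Submodule k I) (n d : ℕ) : Submodule k (Bar k I n) :=
  Submodule.span k {x | ∃ (e : Fin n → ℕ) (a : Fin n → I),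
    (∀ j, a j ∈ ℐ (e j)) ∧ ∑ j, e j = d ∧ x = PiTensorProduct.tprod k a}

/-- The component of internal degree `d` of the `n`-th homology of the bar complex: the classes of
the cycles of internal degree `d`. -/
def gradingBarHomology (ℐ : ℕ → Submodule k I) (n d : ℕ) : Submodule k (BarHomology k I n) :=
  ((barGrading ℐ n d).submoduleOf (barCycles k I n)).map (Submodule.mkQ _)

end Bar

variable {k} {A : Type w} [Ring A] [Algebra k A] (𝒜 : ℕ → Submodule k A) [GradedAlgebra 𝒜]

/-- `Tor_n^A(k, k)`, for a connected graded algebra `A`. It is computed with the normalized bar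
resolution `A ⊗ A_{>0}^{⊗ •}` of the left module `k`: the complex `k ⊗_A (A ⊗ A_{>0}^{⊗ •})` is the
bar complex of the nonunital algebra `A_{>0}`. -/
abbrev Tor (n : ℕ) : Type _ := BarHomology k (irrelevant 𝒜) n

/-- The component of internal degree `d` of `Tor_n^A(k, k)`. -/
def gradingTor (n d : ℕ) : Submodule k (Tor 𝒜 n) :=
  gradingBarHomology (fun e => (𝒜 e).comap (NonUnitalSubalgebra.toSubmodule (irrelevant 𝒜)).subtype) n d

end Tor

/-- Two graded vector spaces are isomorphic: there is a linear isomorphism that maps the component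
of degree `d` onto the component of degree `d`, for all `d`. -/
def GradedIso {k E F : Type*} [Field k] [AddCommGroup E] [Module k E] [AddCommGroup F] [Module k F]
    (ℰ : ℕ → Submodule k E) (ℱ : ℕ → Submodule k F) : Prop :=
  ∃ e : E ≃ₗ[k] F, ∀ d, (ℰ d).map e.toLinearMap = ℱ d

end MultiKoszul

end

/-! Write `T = T(V)`, `T₊` for its augmentation ideal and `I = ker π`. The differentials of the
one-sided complex `A ⊗ J_•` take values in `A_{>0} ⊗ J_•`, so they vanish after reduction to `k`. If
the complex is exact, it is therefore a minimal free resolution of `k`, and `Tor_i` is `J_i` in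
every internal degree.

For the converse, a comparison with the normalized bar resolution (`koszulToBar`) yields graded maps
`J_i → Tor_i` before anything is known about exactness. Suppose that the complex is exact below
position `n`, and let `Z_n` be its cycles there. Then `Tor_{n+1}` is `Z_n / A_{>0} Z_n`, and the map
from `J_{n+1}` sends a generator to the class of its boundary. It is injective because no nonzero
generator has its boundary in `A_{>0} Z_n` (`IsKoszulSystem.primitive`). The given isomorphism
`Tor_{n+1} ≃ J_{n+1}` need not be related to this map: since the homogeneous components are finite
dimensional, its existence alone forces the injection to be bijective. Hence the boundaries generate
`Z_n` modulo `A_{>0} Z_n`, and the graded Nakayama lemma (`le_of_le_sup_augIdeal_smul`) gives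
exactness at `n`. The induction is `IsGradedSystem.exact_of_gradedIso`.

Primitivity is where the definition of `J_n` and the minimality of `R` enter. The multiplication `T
⊗ J_n → T` is injective, because `V` and `R` both generate free left ideals (`leftFree_gen`,
`leftFree_of_disjoint`), and `J_{n+2} ⊆ R J_n`. A generator in `J_{n+2}` whose boundary is
decomposable lies in `(T₊ I + I T₊) J_n`, and `R` meets `T₊ I + I T₊` trivially, so the generator is
zero. In position zero the same conclusion holds because generators of the algebra are not
decomposable in `A`.

The identification of the homology is carried out with the mapping cone of the comparison. As far as
the source is exact, the cone is an exact complex of free modules that is bounded below, so its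
cycles are direct summands (`IsComparison.exists_projection`), and this survives reduction.

All of this is done for an abstract system of spaces in an augmented algebra. The right-hand
statement is the left-hand one for the opposite algebra, together with the isomorphism of bar
complexes given by reversal of tensors. -/

noncomputable section

namespace MultiKoszul

universe u v w

/-! ### Free modules over an augmented algebra and their reductions -/

section FreeModules

variable {k : Type u} [Field k] {B : Type w} [Ring B] [Algebra k B] (ε : B →ₐ[k] k)

/-- The kernel of an augmentation, as a left ideal. -/
def augIdeal : Ideal B := RingHom.ker ε

theorem mem_augIdeal {b : B} : b ∈ augIdeal ε ↔ ε b = 0 := RingHom.mem_ker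

/-- The reduction `B ⊗ U → k ⊗_B (B ⊗ U) = U` of a free module. -/
def red (U : Type*) [AddCommGroup U] [Module k U] : B ⊗[k] U →ₗ[k] U :=
  (TensorProduct.lid k U).toLinearMap ∘ₗ LinearMap.rTensor U ε.toLinearMap

variable {U : Type*} [AddCommGroup U] [Module k U] {U' : Type*} [AddCommGroup U'] [Module k U']

@[simp]
theorem red_tmul (b : B) (u : U) : red ε U (b ⊗ₜ u) = ε b • u := by simp [red]

theorem red_smul (b : B) (x : B ⊗[k] U) : red ε U (b • x) = ε b • red ε U x := by
  induction x with
  | zero => simp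
  | tmul c u => simp [TensorProduct.smul_tmul', mul_smul]
  | add x y hx hy => simp [hx, hy]

theorem red_baseChange (f : U →ₗ[k] U') (x : B ⊗[k] U) :
    red ε U' (f.baseChange B x) = f (red ε U x) := by
  induction x with
  | zero => simp
  | tmul c u => simp
  | add x y hx hy => simp [hx, hy]

theorem sub_one_tmul_red_mem (x : B ⊗[k] U) :
    x - (1 : B) ⊗ₜ[k] red ε U x ∈ augIdeal ε • (⊤ : Submodule B (B ⊗[k] U)) := by
  induction x with
  | zero => simp
  | tmul b u =>
    have : b ⊗ₜ[k] u - (1 : B) ⊗ₜ[k] red ε U (b ⊗ₜ u)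
        = (b - algebraMap k B (ε b)) • ((1 : B) ⊗ₜ[k] u) := by
      rw [TensorProduct.smul_tmul', smul_eq_mul, mul_one, TensorProduct.sub_tmul, red_tmul,
        Algebra.algebraMap_eq_smul_one, TensorProduct.smul_tmul]
    rw [this]
    exact Submodule.smul_mem_smul ((mem_augIdeal ε).2 (by simp)) trivial
  | add x y hx hy =>
    have := add_mem hx hy
    rw [map_add, TensorProduct.tmul_add]
    convert this using 1
    abel

theorem mem_augIdeal_smul_top {x : B ⊗[k] U} :
    x ∈ augIdeal ε • (⊤ : Submodule B (B ⊗[k] U)) ↔ red ε U x = 0 := by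
  constructor
  · intro h
    refine Submodule.smul_induction_on h ?_ ?_
    · intro b hb x _
      rw [red_smul, (mem_augIdeal ε).1 hb, zero_smul]
    · intro x y hx hy
      rw [map_add, hx, hy, add_zero]
  · intro h
    have := sub_one_tmul_red_mem ε x
    rwa [h, TensorProduct.tmul_zero, sub_zero] at this

theorem map_mem_smul_top {M N : Type*} [AddCommGroup M] [Module B M] [AddCommGroup N] [Module B N]
    (I : Ideal B) (f : M →ₗ[B] N) {x : M} (hx : x ∈ I • (⊤ : Submodule B M)) :
    f x ∈ I • (⊤ : Submodule B N) := by
  have : f x ∈ (I • (⊤ : Submodule B M)).map f := Submodule.mem_map_of_mem hx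
  rw [Submodule.map_smul''] at this
  exact Submodule.smul_mono le_rfl le_top this

theorem prod_mem_augIdeal_smul_top {p : (B ⊗[k] U) × (B ⊗[k] U')} :
    p ∈ augIdeal ε • (⊤ : Submodule B ((B ⊗[k] U) × (B ⊗[k] U'))) ↔
      red ε U p.1 = 0 ∧ red ε U' p.2 = 0 := by
  constructor
  · intro h
    exact ⟨(mem_augIdeal_smul_top ε).1 (map_mem_smul_top _ (LinearMap.fst B _ _) h),
      (mem_augIdeal_smul_top ε).1 (map_mem_smul_top _ (LinearMap.snd B _ _) h)⟩
  · rintro ⟨h1, h2⟩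
    have h1' := map_mem_smul_top _ (LinearMap.inl B (B ⊗[k] U) (B ⊗[k] U'))
      ((mem_augIdeal_smul_top ε).2 h1)
    have h2' := map_mem_smul_top _ (LinearMap.inr B (B ⊗[k] U) (B ⊗[k] U'))
      ((mem_augIdeal_smul_top ε).2 h2)
    have := add_mem h1' h2'
    simpa using this

/-- The kernel of the reduction of a free module. -/
def redKer (U : Type*) [AddCommGroup U] [Module k U] : Submodule B (B ⊗[k] U) where
  carrier := {x | red ε U x = 0}
  add_mem' {x y} hx hy := by
    simp only [Set.mem_ofPred_eq] at *
    rw [map_add, hx, hy, add_zero]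
  zero_mem' := by simp
  smul_mem' b x hx := by
    simp only [Set.mem_ofPred_eq] at *
    rw [red_smul, hx, smul_zero]

theorem mem_redKer {x : B ⊗[k] U} : x ∈ redKer ε U ↔ red ε U x = 0 := Iff.rfl

end FreeModules

/-! ### Minimal complexes compared with a free resolution -/

section Comparison

variable {k : Type u} [Field k] {B : Type w} [Ring B] [Algebra k B] (ε : B →ₐ[k] k)

/-- The cycles of a complex of free modules `⋯ → B ⊗ U 1 → B ⊗ U 0`, augmented by the reduction
`B ⊗ U 0 → U 0`. -/
def freeCycles {U : ℕ → Type*} [∀ n, AddCommGroup (U n)] [∀ n, Module k (U n)]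
    (d : ∀ n, B ⊗[k] U (n + 1) →ₗ[B] B ⊗[k] U n) : ∀ n, Submodule B (B ⊗[k] U n)
  | 0 => redKer ε (U 0)
  | n + 1 => LinearMap.ker (d n)

variable {U : ℕ → Type*} [∀ n, AddCommGroup (U n)] [∀ n, Module k (U n)]
  {W : ℕ → Type*} [∀ n, AddCommGroup (W n)] [∀ n, Module k (W n)]
  {d : ∀ n, B ⊗[k] U (n + 1) →ₗ[B] B ⊗[k] U n}
  {d' : ∀ n, B ⊗[k] W (n + 1) →ₗ[B] B ⊗[k] W n}
  {φ : ∀ n, U n →ₗ[k] W n}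

variable (d d' φ) in
/-- A morphism from a complex of free modules to a free resolution. -/
structure IsComparison : Prop where
  range_le : ∀ n, LinearMap.range (d n) ≤ freeCycles ε d n
  minimal : ∀ n x, red ε _ (d n x) = 0
  exact : ∀ n, LinearMap.range (d' n) = freeCycles ε d' n
  comm : ∀ n x, (φ n).baseChange B (d n x) = d' n ((φ (n + 1)).baseChange B x)
  bijective : Function.Bijective (φ 0)

variable (d d' φ) in
/-- The cycles of the mapping cone of a comparison. -/
def coneCycles (n : ℕ) : Submodule B ((B ⊗[k] U n) × (B ⊗[k] W (n + 1))) where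
  carrier := {c | c.1 ∈ freeCycles ε d n ∧ (φ n).baseChange B c.1 = d' n c.2}
  add_mem' := by
    rintro x y ⟨h1, h2⟩ ⟨h3, h4⟩
    exact ⟨add_mem h1 h3, by rw [Prod.fst_add, Prod.snd_add, map_add, map_add, h2, h4]⟩
  zero_mem' := ⟨zero_mem _, by simp⟩
  smul_mem' := by
    rintro b x ⟨h1, h2⟩
    exact ⟨Submodule.smul_mem _ _ h1, by rw [Prod.smul_fst, Prod.smul_snd, map_smul, map_smul, h2]⟩

theorem mem_coneCycles {n : ℕ} {c : (B ⊗[k] U n) × (B ⊗[k] W (n + 1))} :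
    c ∈ coneCycles ε d d' φ n ↔
      c.1 ∈ freeCycles ε d n ∧ (φ n).baseChange B c.1 = d' n c.2 := Iff.rfl

variable (d d' φ) in
/-- The differential of the mapping cone of a comparison. -/
def coneD (n : ℕ) : (B ⊗[k] U (n + 1)) × (B ⊗[k] W (n + 2)) →ₗ[B]
    (B ⊗[k] U n) × (B ⊗[k] W (n + 1)) :=
  LinearMap.prod (d n ∘ₗ LinearMap.fst B _ _)
    ((φ (n + 1)).baseChange B ∘ₗ LinearMap.fst B _ _ - d' (n + 1) ∘ₗ LinearMap.snd B _ _)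

theorem coneD_apply (n : ℕ) (c : (B ⊗[k] U (n + 1)) × (B ⊗[k] W (n + 2))) :
    coneD d d' φ n c = (d n c.1, (φ (n + 1)).baseChange B c.1 - d' (n + 1) c.2) := rfl

namespace IsComparison

variable {ε}

theorem d'_d' (h : IsComparison ε d d' φ) (n : ℕ) (y) : d' n (d' (n + 1) y) = 0 := by
  have : d' (n + 1) y ∈ freeCycles ε d' (n + 1) := by rw [← h.exact]; exact ⟨y, rfl⟩
  exact this

theorem coneD_mem (h : IsComparison ε d d' φ) (n : ℕ) (c) :
    coneD d d' φ n c ∈ coneCycles ε d d' φ n := by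
  refine ⟨h.range_le n ⟨_, rfl⟩, ?_⟩
  simp only [coneD_apply, map_sub, h.d'_d', sub_zero, h.comm]

theorem coneD_eq_zero_iff (n : ℕ) (c) :
    coneD d d' φ n c = 0 ↔ c ∈ coneCycles ε d d' φ (n + 1) := by
  rw [coneD_apply, Prod.mk_eq_zero, sub_eq_zero, mem_coneCycles]
  rfl

theorem baseChange_mem (h : IsComparison ε d d' φ) (n : ℕ) {x} (hx : x ∈ freeCycles ε d n) :
    (φ n).baseChange B x ∈ freeCycles ε d' n := by
  cases n with
  | zero =>
    change red ε _ _ = 0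
    change red ε _ _ = 0 at hx
    rw [red_baseChange, hx, map_zero]
  | succ n =>
    change d' n _ = 0
    change d n _ = 0 at hx
    rw [← h.comm, hx, map_zero]

/-- If the source of a comparison is exact in position `n`, so is the mapping cone. -/
theorem exists_coneD_eq (h : IsComparison ε d d' φ) {n : ℕ}
    (hn : LinearMap.range (d n) = freeCycles ε d n) {c} (hc : c ∈ coneCycles ε d d' φ n) :
    ∃ c', coneD d d' φ n c' = c := by
  obtain ⟨h1, h2⟩ := hc
  rw [← hn] at h1
  obtain ⟨x, hx⟩ := h1
  have : (φ (n + 1)).baseChange B x - c.2 ∈ freeCycles ε d' (n + 1) := by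
    change d' n _ = 0
    rw [map_sub, ← h.comm, hx, h2, sub_self]
  rw [← h.exact] at this
  obtain ⟨y, hy⟩ := this
  refine ⟨(x, y), Prod.ext hx ?_⟩
  simp only [coneD_apply, hy, sub_sub_cancel]

/-- If the source of a comparison is exact in the positions below `n`, the cycles of degree `n` of
the mapping cone are a direct summand, in a way that is compatible with the reductions. -/
theorem exists_projection (h : IsComparison ε d d' φ) (n : ℕ)
    (hn : ∀ m < n, LinearMap.range (d m) = freeCycles ε d m) :
    ∃ e : (B ⊗[k] U n) × (B ⊗[k] W (n + 1)) →ₗ[B] (B ⊗[k] U n) × (B ⊗[k] W (n + 1)),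
      (∀ c, e c ∈ coneCycles ε d d' φ n) ∧ (∀ c ∈ coneCycles ε d d' φ n, e c = c) ∧
      ∀ c, red ε _ ((φ n).baseChange B c.1 - d' n c.2) = 0 →
        c - e c ∈ augIdeal ε • (⊤ : Submodule B ((B ⊗[k] U n) × (B ⊗[k] W (n + 1)))) := by
  induction n with
  | zero =>
    -- In position zero the cycles of the cone form the graph of `y ↦ φ⁻¹ (d' y)`, and `e` is the
    -- projection onto this graph that keeps the second coordinate.
    let ψ : W 0 ≃ₗ[k] U 0 := (LinearEquiv.ofBijective (φ 0) h.bijective).symm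
    have hψ (x : B ⊗[k] U 0) :
        (ψ.toLinearMap).baseChange B ((φ 0).baseChange B x) = x := by
      rw [← LinearMap.comp_apply, ← LinearMap.baseChange_comp]
      have : ψ.toLinearMap ∘ₗ φ 0 = LinearMap.id := by
        ext u
        exact (LinearEquiv.ofBijective (φ 0) h.bijective).symm_apply_apply u
      rw [this, LinearMap.baseChange_id, LinearMap.id_apply]
    have hφ (y : B ⊗[k] W 0) :
        (φ 0).baseChange B ((ψ.toLinearMap).baseChange B y) = y := by
      rw [← LinearMap.comp_apply, ← LinearMap.baseChange_comp]
      have : φ 0 ∘ₗ ψ.toLinearMap = LinearMap.id := by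
        ext u
        exact (LinearEquiv.ofBijective (φ 0) h.bijective).apply_symm_apply u
      rw [this, LinearMap.baseChange_id, LinearMap.id_apply]
    have hd (y) : red ε _ (d' 0 y) = 0 := by
      have : d' 0 y ∈ freeCycles ε d' 0 := by rw [← h.exact]; exact ⟨y, rfl⟩
      exact this
    let e : (B ⊗[k] U 0) × (B ⊗[k] W 1) →ₗ[B] (B ⊗[k] U 0) × (B ⊗[k] W 1) :=
      LinearMap.prod ((ψ.toLinearMap).baseChange B ∘ₗ d' 0 ∘ₗ LinearMap.snd B _ _)
        (LinearMap.snd B _ _)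
    have he (c) : e c = ((ψ.toLinearMap).baseChange B (d' 0 c.2), c.2) := rfl
    refine ⟨e, fun c => ⟨?_, ?_⟩, fun c hc => ?_, fun c hc => ?_⟩
    · change red ε _ _ = 0
      rw [he, red_baseChange, hd, map_zero]
    · rw [he, hφ]
    · rw [he, ← hc.2, hψ]
    · rw [prod_mem_augIdeal_smul_top]
      rw [map_sub, hd, sub_zero, red_baseChange] at hc
      refine ⟨?_, by simp [he]⟩
      rw [he, Prod.fst_sub, map_sub, red_baseChange, hd, map_zero, sub_zero]
      exact h.bijective.1 (by rw [hc, map_zero])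
  | succ n ih =>
    obtain ⟨e, he1, he2, -⟩ := ih fun m hm => hn m (by omega)
    have hex (c : coneCycles ε d d' φ n) := h.exists_coneD_eq (hn n (by omega)) c.2
    let D : (B ⊗[k] U (n + 1)) × (B ⊗[k] W (n + 2)) →ₗ[B] coneCycles ε d d' φ n :=
      (coneD d d' φ n).codRestrict _ (h.coneD_mem n)
    -- The term of degree `n` of the cone is free and `D` maps the next term onto the cycles, so the
    -- projection `e` lifts through `D` to a map `s`. One degree higher, the complementary
    -- projection is `s ∘ coneD`.
    obtain ⟨s, hs⟩ := Module.projective_lifting_property D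
      (e.codRestrict (coneCycles ε d d' φ n) he1) (by
        intro c
        obtain ⟨c', hc'⟩ := hex c
        exact ⟨c', Subtype.ext hc'⟩)
    have hs' (c) : coneD d d' φ n (s c) = e c := congrArg Subtype.val (LinearMap.congr_fun hs c)
    refine ⟨LinearMap.id - s ∘ₗ coneD d d' φ n, fun c => ?_, fun c hc => ?_, fun c hc => ?_⟩
    · rw [← coneD_eq_zero_iff]
      simp only [LinearMap.sub_apply, LinearMap.id_apply, LinearMap.comp_apply, map_sub, hs']
      rw [he2 _ (h.coneD_mem n c), sub_self]
    · rw [← coneD_eq_zero_iff] at hc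
      simp [hc]
    · simp only [LinearMap.sub_apply, LinearMap.id_apply, LinearMap.comp_apply, sub_sub_cancel]
      apply map_mem_smul_top
      rw [prod_mem_augIdeal_smul_top]
      exact ⟨h.minimal _ _, hc⟩

/-- If the source of a comparison is exact in the positions below `n`, the cycles of degree `n` of
the mapping cone that reduce to zero are decomposable. -/
theorem fst_mem_of_red (h : IsComparison ε d d' φ) {n : ℕ}
    (hn : ∀ m < n, LinearMap.range (d m) = freeCycles ε d m) {x y}
    (hc : (x, y) ∈ coneCycles ε d d' φ n) (hx : red ε _ x = 0) (hy : red ε _ y = 0) :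
    x ∈ augIdeal ε • freeCycles ε d n := by
  obtain ⟨e, he1, he2, -⟩ := h.exists_projection n hn
  have h1 := (prod_mem_augIdeal_smul_top ε (p := (x, y))).2 ⟨hx, hy⟩
  -- A linear projection carries the decomposable elements of the whole cone to decomposable
  -- elements of the cycles, and it fixes `(x, y)`.
  have h2 := Submodule.mem_map_of_mem (f := LinearMap.fst B _ _ ∘ₗ e) h1
  rw [Submodule.map_smul''] at h2
  rw [LinearMap.comp_apply, he2 _ hc] at h2
  refine Submodule.smul_mono le_rfl ?_ h2
  rintro _ ⟨c, -, rfl⟩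
  exact (he1 c).1

variable (ε d') in
/-- The reduction `W (n + 1) → W n` of the differential of a complex of free modules. -/
def redD (n : ℕ) : W (n + 1) →ₗ[k] W n :=
  red ε (W n) ∘ₗ (d' n).restrictScalars k ∘ₗ TensorProduct.mk k B (W (n + 1)) 1

theorem red_d' (n : ℕ) (y) : red ε _ (d' n y) = redD ε d' n (red ε _ y) := by
  have h1 := map_mem_smul_top (augIdeal ε) (d' n) (sub_one_tmul_red_mem ε y)
  rw [mem_augIdeal_smul_top, map_sub, map_sub, sub_eq_zero] at h1
  exact h1

/-- If the source of a comparison is exact in the positions up to `n`, the comparison is injective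
in homology in degree `n`. -/
theorem injective_homology (h : IsComparison ε d d' φ) {n : ℕ}
    (hn : ∀ m ≤ n, LinearMap.range (d m) = freeCycles ε d m) {u : U n} {w : W (n + 1)}
    (huw : φ n u = redD ε d' n w) : u = 0 := by
  obtain ⟨e, he1, he2, he3⟩ := h.exists_projection n fun m hm => hn m hm.le
  -- The chain `(1 ⊗ u, 1 ⊗ w)` of the cone is a cycle only after reduction. The projection replaces
  -- it by a cycle with the same reduction. That cycle is a boundary, so its first coordinate
  -- reduces to zero by minimality.
  have h1 := he3 ((1 : B) ⊗ₜ u, (1 : B) ⊗ₜ w) (by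
    simp only [map_sub, red_d', red_baseChange, red_tmul, map_one, one_smul, huw, sub_self])
  obtain ⟨c, hc⟩ := h.exists_coneD_eq (hn n le_rfl) (he1 ((1 : B) ⊗ₜ u, (1 : B) ⊗ₜ w))
  rw [prod_mem_augIdeal_smul_top, ← hc] at h1
  simpa [coneD_apply, h.minimal] using h1.1

/-- If the source of a comparison is exact in the positions below `n`, the comparison is surjective
in homology in degree `n`. -/
theorem surjective_homology (h : IsComparison ε d d' φ) {n : ℕ}
    (hn : ∀ m ≤ n, LinearMap.range (d m) = freeCycles ε d m) {w : W (n + 1)}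
    (hw : redD ε d' n w = 0) : ∃ u w', w = φ (n + 1) u + redD ε d' (n + 1) w' := by
  -- The argument for injectivity, applied to the chain `(0, 1 ⊗ w)` and read off in the second
  -- coordinate.
  obtain ⟨e, he1, he2, he3⟩ := h.exists_projection n fun m hm => hn m hm.le
  have h1 := he3 (0, (1 : B) ⊗ₜ w) (by simp [red_d', hw])
  obtain ⟨c, hc⟩ := h.exists_coneD_eq (hn n le_rfl) (he1 (0, (1 : B) ⊗ₜ w))
  rw [prod_mem_augIdeal_smul_top, ← hc] at h1
  refine ⟨red ε _ c.1, - red ε _ c.2, ?_⟩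
  have h2 := h1.2
  simp only [coneD_apply, Prod.snd_sub, map_sub, red_tmul, map_one, one_smul, red_baseChange,
    red_d', sub_eq_zero] at h2
  rw [h2, map_neg, sub_eq_add_neg]

/-- The cycles of a complex with primitive generators reduce to zero. -/
theorem red_eq_zero_of_mem (h : IsComparison ε d d' φ) {n : ℕ}
    (hp : ∀ u : U (n + 1), d n ((1 : B) ⊗ₜ u) ∈ augIdeal ε • freeCycles ε d n → u = 0)
    {x} (hx : x ∈ freeCycles ε d (n + 1)) : red ε _ x = 0 := by
  apply hp
  -- As `x` and `1 ⊗ red x` differ by a decomposable element and `d x = 0`, the boundary of `1 ⊗ red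
  -- x` is a combination of boundaries with coefficients in the augmentation ideal.
  have h1 := Submodule.mem_map_of_mem (f := d n) (sub_one_tmul_red_mem ε x)
  have h0 : d n x = 0 := hx
  rw [Submodule.map_smul'', map_sub, h0, zero_sub] at h1
  have h2 := neg_mem h1
  rw [neg_neg] at h2
  refine Submodule.smul_mono le_rfl ?_ h2
  rintro _ ⟨c, -, rfl⟩
  exact h.range_le n ⟨c, rfl⟩

/-- Primitivity of the generators replaces exactness in position `n`: if `φ u` is a boundary after
reduction, then `d (1 ⊗ u)` is the first coordinate of a cycle of the cone that reduces to zero, so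
it is decomposable in the cycles. -/
theorem injective_homology_of_primitive (h : IsComparison ε d d' φ) {n : ℕ}
    (hn : ∀ m < n, LinearMap.range (d m) = freeCycles ε d m)
    (hp : ∀ u : U (n + 1), d n ((1 : B) ⊗ₜ u) ∈ augIdeal ε • freeCycles ε d n → u = 0)
    {u : U (n + 1)} {w : W (n + 2)} (huw : φ (n + 1) u = redD ε d' (n + 1) w) : u = 0 := by
  apply hp
  refine h.fst_mem_of_red hn (y := (1 : B) ⊗ₜ φ (n + 1) u - d' (n + 1) ((1 : B) ⊗ₜ w))
    ⟨h.range_le n ⟨_, rfl⟩, ?_⟩ (h.minimal _ _) ?_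
  · simp only [map_sub, h.d'_d', sub_zero, h.comm, LinearMap.baseChange_tmul]
  · simp [red_d', huw]

/-- If the source of a comparison is exact in the positions below `n` and the comparison is
surjective in homology in degree `n + 1`, the cycles in position `n` are generated by boundaries up
to decomposable elements. -/
theorem cycles_le_of_surjective (h : IsComparison ε d d' φ) {n : ℕ}
    (hn : ∀ m < n, LinearMap.range (d m) = freeCycles ε d m)
    (hred : ∀ x ∈ freeCycles ε d n, red ε _ x = 0)
    (hs : ∀ w : W (n + 1), redD ε d' n w = 0 → ∃ u w', w = φ (n + 1) u + redD ε d' (n + 1) w') :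
    freeCycles ε d n ≤ LinearMap.range (d n) ⊔ augIdeal ε • freeCycles ε d n := by
  intro x hx
  have h1 := h.baseChange_mem n hx
  rw [← h.exact] at h1
  obtain ⟨y, hy⟩ := h1
  -- The image of the cycle `x` bounds some `y` in the resolution. Since `x` reduces to zero, `red
  -- y` is a cycle of the reduced resolution, and surjectivity provides the generator `u` whose
  -- boundary approximates `x`.
  obtain ⟨u, w, huw⟩ := hs (red ε _ y) (by
    rw [← red_d', hy, red_baseChange, hred x hx, map_zero])
  have h2 : x - d n ((1 : B) ⊗ₜ u) ∈ augIdeal ε • freeCycles ε d n := by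
    refine h.fst_mem_of_red hn
      (y := y - (1 : B) ⊗ₜ φ (n + 1) u - d' (n + 1) ((1 : B) ⊗ₜ w))
      ⟨sub_mem hx (h.range_le n ⟨_, rfl⟩), ?_⟩ ?_ ?_
    · simp only [map_sub, h.d'_d', sub_zero, h.comm, LinearMap.baseChange_tmul, hy]
    · rw [map_sub, hred x hx, h.minimal, sub_zero]
    · simp [red_d', huw]
  have h3 : d n ((1 : B) ⊗ₜ u) ∈ LinearMap.range (d n) := ⟨_, rfl⟩
  have := add_mem (Submodule.mem_sup_left h3) (Submodule.mem_sup_right h2)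
  rwa [add_sub_cancel] at this

end IsComparison
end Comparison

/-! ### Linear maps out of free modules -/

section FreeLift

variable {k : Type u} [Field k] {B : Type w} [Ring B] [Algebra k B]
  {U N : Type*} [AddCommGroup U] [Module k U] [AddCommGroup N] [Module k N] [Module B N]
  [IsScalarTower k B N]

/-- The `B`-linear map `B ⊗ U → N` that extends a linear map `U → N`. -/
def freeLift (f : U →ₗ[k] N) : B ⊗[k] U →ₗ[B] N :=
  haveI : SMulCommClass k B N := IsScalarTower.to_smulCommClass
  haveI : SMulCommClass B k N := SMulCommClass.symm _ _ _
  TensorProduct.AlgebraTensorModule.lift (LinearMap.toSpanSingleton B (U →ₗ[k] N) f)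

@[simp]
theorem freeLift_tmul (f : U →ₗ[k] N) (b : B) (u : U) : freeLift f (b ⊗ₜ u) = b • f u := rfl

end FreeLift

/-! ### The bar complex by recursion on the first entry -/

section BarCons

variable (k : Type u) [Field k] (I : Type w) [NonUnitalRing I] [Module k I]

/-- The concatenation map `a ⊗ [a_1 | ⋯ | a_n] ↦ [a | a_1 | ⋯ | a_n]`. -/
def barCons (n : ℕ) : I ⊗[k] Bar k I n →ₗ[k] Bar k I (n + 1) :=
  TensorProduct.lift (PiTensorProduct.lift.toLinearMap ∘ₗ
    (PiTensorProduct.tprod k (s := fun _ : Fin (n + 1) => I)).curryLeft)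

/-- The map `[a_0 | ⋯ | a_n] ↦ a_0 ⊗ [a_1 | ⋯ | a_n]`. -/
def barSplit (n : ℕ) : Bar k I (n + 1) →ₗ[k] I ⊗[k] Bar k I n :=
  PiTensorProduct.lift (LinearMap.uncurryLeft (M := fun _ : Fin (n + 1) => I)
    ((PiTensorProduct.lift (s := fun _ : Fin n => I)).symm.toLinearMap ∘ₗ
      TensorProduct.mk k I (Bar k I n)))

variable {k I}

theorem barCons_tprod {n : ℕ} (a : I) (x : Fin n → I) :
    barCons k I n (a ⊗ₜ PiTensorProduct.tprod k x) =
      PiTensorProduct.tprod k (Fin.cons a x : Fin (n + 1) → I) := by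
  simp [barCons]

theorem barSplit_tprod {n : ℕ} (x : Fin (n + 1) → I) :
    barSplit k I n (PiTensorProduct.tprod k x) =
      x 0 ⊗ₜ PiTensorProduct.tprod k (Fin.tail x) := by
  simp [barSplit]

theorem barSplit_barCons {n : ℕ} (x) : barSplit k I n (barCons k I n x) = x := by
  have : barSplit k I n ∘ₗ barCons k I n = LinearMap.id := by
    refine TensorProduct.ext' fun a y => ?_
    induction y using PiTensorProduct.induction_on with
    | smul_tprod r y =>
      rw [TensorProduct.tmul_smul, map_smul, map_smul, LinearMap.comp_apply, barCons_tprod,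
        barSplit_tprod, Fin.cons_zero, Fin.tail_cons, LinearMap.id_apply]
    | add x y hx hy => simp only [TensorProduct.tmul_add, map_add, hx, hy]
  exact LinearMap.congr_fun this x

theorem barCons_barSplit {n : ℕ} (x) : barCons k I n (barSplit k I n x) = x := by
  have : barCons k I n ∘ₗ barSplit k I n = LinearMap.id := by
    refine PiTensorProduct.ext (MultilinearMap.ext fun x => ?_)
    simp only [LinearMap.compMultilinearMap_apply, LinearMap.comp_apply, barSplit_tprod,
      barCons_tprod, Fin.cons_self_tail, LinearMap.id_apply]
  exact LinearMap.congr_fun this x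

theorem bar_induction {n : ℕ} {p : Bar k I (n + 1) → Prop} (x : Bar k I (n + 1))
    (hc : ∀ a y, p (barCons k I n (a ⊗ₜ y))) (h0 : p 0) (ha : ∀ x y, p x → p y → p (x + y)) :
    p x := by
  rw [← barCons_barSplit x]
  generalize barSplit k I n x = y
  induction y with
  | zero => rwa [map_zero]
  | tmul a y => exact hc a y
  | add x y hx hy => rw [map_add]; exact ha _ _ hx hy

variable [IsScalarTower k I I] [SMulCommClass k I I]

variable (k) in
/-- The map `[a_0 | ⋯ | a_n] ↦ [a a_0 | ⋯ | a_n]`. -/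
def barMerge (n : ℕ) (a : I) : Bar k I (n + 1) →ₗ[k] Bar k I (n + 1) :=
  barCons k I n ∘ₗ LinearMap.rTensor _ (LinearMap.mulLeft k a) ∘ₗ barSplit k I n

theorem barMerge_barCons {n : ℕ} (a b : I) (y) :
    barMerge k n a (barCons k I n (b ⊗ₜ y)) = barCons k I n ((a * b) ⊗ₜ y) := by
  simp [barMerge, barSplit_barCons]

theorem barD_tprod {n : ℕ} (x : Fin (n + 1) → I) :
    barD k I n (PiTensorProduct.tprod k x) = ∑ i : Fin n, (-1 : k) ^ (i : ℕ) •
      PiTensorProduct.tprod k (Fin.contractNth i.castSucc (· * ·) x) := by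
  simp [barD, barFace]

theorem contractNth_zero_cons {α : Type*} (op : α → α → α) {n : ℕ} (a : α) (x : Fin (n + 1) → α) :
    Fin.contractNth 0 op (Fin.cons a x : Fin (n + 2) → α) =
      (Fin.cons (op a (x 0)) (Fin.tail x) : Fin (n + 1) → α) := by
  ext j
  refine Fin.cases ?_ (fun j => ?_) j
  · simp [Fin.contractNth]
  · simp [Fin.contractNth, Fin.tail]

theorem contractNth_succ_cons {α : Type*} (op : α → α → α) {n : ℕ} (i : Fin (n + 1)) (a : α)
    (x : Fin (n + 1) → α) :
    Fin.contractNth i.succ op (Fin.cons a x : Fin (n + 2) → α) =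
      (Fin.cons a (Fin.contractNth i op x) : Fin (n + 1) → α) := by
  ext j
  refine Fin.cases ?_ (fun j => ?_) j
  · simp [Fin.contractNth]
  · simp [Fin.contractNth]

/-- The face of index zero multiplies `a` into the first entry of `x`. The remaining faces are those
of `x` with the index raised by one, which accounts for the sign. -/
theorem barD_barCons {n : ℕ} (a : I) (x : Bar k I (n + 1)) :
    barD k I (n + 1) (barCons k I (n + 1) (a ⊗ₜ x)) =
      barMerge k n a x - barCons k I n (a ⊗ₜ barD k I n x) := by
  induction x using PiTensorProduct.induction_on with
  | smul_tprod r x =>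
    simp only [TensorProduct.tmul_smul, map_smul, ← smul_sub]
    congr 1
    rw [barCons_tprod, barD_tprod, Fin.sum_univ_succ, barD_tprod, TensorProduct.tmul_sum, map_sum,
      sub_eq_add_neg, ← Finset.sum_neg_distrib]
    congr 1
    · simp [barMerge, barSplit_tprod, barCons_tprod, contractNth_zero_cons]
    · refine Finset.sum_congr rfl fun i _ => ?_
      rw [TensorProduct.tmul_smul, map_smul, barCons_tprod, ← Fin.succ_castSucc,
        contractNth_succ_cons, Fin.val_succ, pow_succ, mul_neg_one, neg_smul]
  | add x y hx hy =>
    simp only [TensorProduct.tmul_add, map_add, hx, hy]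
    abel

theorem barD_zero : barD k I 0 = 0 := by simp [barD]

end BarCons

/-! ### Exactness of the normalized bar resolution -/

section BarResolution

variable {k : Type u} [Field k] {B : Type w} [Ring B] [Algebra k B] (ε : B →ₐ[k] k)
  {I : Type*} [NonUnitalRing I] [Module k I] [IsScalarTower k I I] [SMulCommClass k I I]

/-- A nonunital algebra `I` is embedded as the kernel of an augmentation `ε : B → k`, by means of a
map `i : I → B`; the map `κ : B → I` is given by `b ↦ b - ε(b)`. -/
structure IsAugmentationKernel (i : I →ₙₐ[k] B) (κ : B →ₗ[k] I) : Prop where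
  injective : Function.Injective i
  apply_eq_zero : ∀ a, ε (i a) = 0
  apply_proj : ∀ b, i (κ b) = b - algebraMap k B (ε b)

variable (i : I →ₙₐ[k] B) (κ : B →ₗ[k] I)

/-- The map `[a_0 | ⋯ | a_n] ↦ a_0 ⊗ [a_1 | ⋯ | a_n] ∈ B ⊗ I^{⊗ n}`. -/
def barCut (n : ℕ) : Bar k I (n + 1) →ₗ[k] B ⊗[k] Bar k I n :=
  LinearMap.rTensor _ (i : I →ₗ[k] B) ∘ₗ barSplit k I n

/-- The differential of the normalized bar resolution `B ⊗ I^{⊗ •}`. -/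
def barResD (n : ℕ) : B ⊗[k] Bar k I (n + 1) →ₗ[B] B ⊗[k] Bar k I n :=
  freeLift (barCut i n - TensorProduct.mk k B (Bar k I n) 1 ∘ₗ barD k I n)

/-- The contraction `b ⊗ x ↦ 1 ⊗ [b - ε(b) | x]` of the bar resolution. -/
def barContraction (n : ℕ) : B ⊗[k] Bar k I n →ₗ[k] B ⊗[k] Bar k I (n + 1) :=
  TensorProduct.mk k B (Bar k I (n + 1)) 1 ∘ₗ barCons k I n ∘ₗ LinearMap.rTensor _ κ

theorem barContraction_tmul (n : ℕ) (b : B) (x : Bar k I n) :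
    barContraction κ n (b ⊗ₜ x) = 1 ⊗ₜ barCons k I n (κ b ⊗ₜ x) := rfl

theorem barCut_barCons (n : ℕ) (a : I) (x : Bar k I n) :
    barCut i n (barCons k I n (a ⊗ₜ x)) = i a ⊗ₜ x := by
  simp [barCut, barSplit_barCons]

theorem barResD_tmul (n : ℕ) (b : B) (x : Bar k I (n + 1)) :
    barResD i n (b ⊗ₜ x) = b • barCut i n x - b ⊗ₜ barD k I n x := by
  simp [barResD, smul_sub, TensorProduct.smul_tmul']

namespace IsAugmentationKernel

variable {ε i κ} (h : IsAugmentationKernel ε i κ)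
include h

theorem proj_apply (a : I) : κ (i a) = a :=
  h.injective (by rw [h.apply_proj, h.apply_eq_zero, map_zero, sub_zero])

theorem proj_mul (b : B) (a : I) : κ (b * i a) = κ b * a + ε b • a := by
  apply h.injective
  rw [h.apply_proj, map_add i, map_mul i, h.apply_proj, map_mul ε, h.apply_eq_zero, mul_zero,
    map_zero, map_smul, sub_zero, sub_mul, Algebra.algebraMap_eq_smul_one, smul_mul_assoc, one_mul,
    sub_add_cancel]

theorem rTensor_apply_proj {U : Type*} [AddCommGroup U] [Module k U] (x : B ⊗[k] U) :
    LinearMap.rTensor U (i : I →ₗ[k] B) (LinearMap.rTensor U κ x) = x - 1 ⊗ₜ red ε U x := by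
  induction x with
  | zero => simp
  | tmul b u =>
    simp only [LinearMap.rTensor_tmul, red_tmul]
    have : (i : I →ₗ[k] B) (κ b) = b - algebraMap k B (ε b) := h.apply_proj b
    rw [this, TensorProduct.sub_tmul, Algebra.algebraMap_eq_smul_one, TensorProduct.smul_tmul]
  | add x y hx hy =>
    simp only [map_add, hx, hy, TensorProduct.tmul_add]
    abel

theorem red_barCut (n : ℕ) (x : Bar k I (n + 1)) : red ε _ (barCut i n x) = 0 := by
  induction x using bar_induction with
  | hc a y => rw [barCut_barCons, red_tmul, h.apply_eq_zero, zero_smul]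
  | h0 => simp
  | ha x y hx hy => rw [map_add, map_add, hx, hy, add_zero]

theorem redD_barResD (n : ℕ) :
    IsComparison.redD ε (barResD (k := k) i) n = - barD k I n := by
  ext1
  refine MultilinearMap.ext fun x => ?_
  simp [IsComparison.redD, barResD_tmul, h.red_barCut]

theorem homotopy_zero (z : B ⊗[k] Bar k I 0) :
    barResD i 0 (barContraction κ 0 z) = z - 1 ⊗ₜ red ε _ z := by
  rw [← h.rTensor_apply_proj]
  induction z with
  | zero => simp
  | tmul b x =>
    rw [barContraction_tmul, barResD_tmul, barD_zero, LinearMap.zero_apply, TensorProduct.tmul_zero,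
      sub_zero, one_smul, barCut_barCons, LinearMap.rTensor_tmul, LinearMap.rTensor_tmul]
    rfl
  | add x y hx hy => simp only [map_add, hx, hy]

/-- The contracting homotopy identity `d h + h d = id`. The term with `ε b` in `κ (b * i a) = κ b *
a + ε b • a` cancels the constant part of `i (κ b) = b - ε b`. -/
theorem homotopy_succ (n : ℕ) (z : B ⊗[k] Bar k I (n + 1)) :
    barResD i (n + 1) (barContraction κ (n + 1) z) = z - barContraction κ n (barResD i n z) := by
  induction z with
  | zero => simp
  | tmul b x =>
    induction x using bar_induction with
    | hc a y =>
      rw [barContraction_tmul, barResD_tmul, barResD_tmul, barCut_barCons, barCut_barCons,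
        barD_barCons, one_smul, map_sub, barContraction_tmul, TensorProduct.smul_tmul',
        barContraction_tmul, smul_eq_mul, h.proj_mul, h.apply_proj, barMerge_barCons,
        TensorProduct.add_tmul, map_add, TensorProduct.tmul_add, TensorProduct.sub_tmul,
        TensorProduct.tmul_sub, Algebra.algebraMap_eq_smul_one, TensorProduct.smul_tmul,
        ← TensorProduct.smul_tmul' (ε b) a y, map_smul]
      abel
    | h0 => simp
    | ha x y hx hy =>
      simp only [TensorProduct.tmul_add, map_add] at hx hy ⊢
      rw [hx, hy]
      abel
  | add x y hx hy =>
    simp only [map_add, hx, hy]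
    abel

/-- Because `κ (i a) = a`, every generator `1 ⊗ [a | y]` is a value of the contraction, so these
values generate the free module. -/
theorem ext_barContraction {n : ℕ} {N : Type*} [AddCommGroup N] [Module B N]
    {f : B ⊗[k] Bar k I (n + 1) →ₗ[B] N} (hf : ∀ z, f (barContraction κ n z) = 0) : f = 0 := by
  ext x
  rw [LinearMap.zero_apply]
  induction x with
  | zero => simp
  | tmul b x =>
    have : b ⊗ₜ[k] x = b • ((1 : B) ⊗ₜ[k] x) := by simp [TensorProduct.smul_tmul']
    rw [this, map_smul]
    suffices f ((1 : B) ⊗ₜ[k] x) = 0 by rw [this, smul_zero]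
    induction x using bar_induction with
    | hc a y =>
      have := hf (i a ⊗ₜ y)
      rwa [barContraction_tmul, h.proj_apply] at this
    | h0 => simp
    | ha x y hx hy => 
      rw [TensorProduct.tmul_add, map_add, hx (by simp [TensorProduct.smul_tmul']), hy (by simp [TensorProduct.smul_tmul']), add_zero]
  | add x y hx hy => rw [map_add, hx, hy, add_zero]

theorem red_barResD (z) : red ε _ (barResD i 0 z) = 0 := by
  induction z with
  | zero => simp
  | tmul b x => 
    rw [barResD_tmul, barD_zero, LinearMap.zero_apply, TensorProduct.tmul_zero, sub_zero, red_smul,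
      h.red_barCut, smul_zero]
  | add x y hx hy => rw [map_add, map_add, hx, hy, add_zero]

/-- By linearity it suffices to test on values of the contraction `h`, where the homotopy identity
gives `d d h = d - d h d = h d d`, which vanishes by induction. -/
theorem barResD_barResD (n : ℕ) : barResD i n ∘ₗ barResD i (n + 1) = 0 := by
  induction n with
  | zero =>
    refine h.ext_barContraction fun z => ?_
    rw [LinearMap.comp_apply, h.homotopy_succ, map_sub, h.homotopy_zero, h.red_barResD]
    simp
  | succ n ih =>
    refine h.ext_barContraction fun z => ?_
    rw [LinearMap.comp_apply, h.homotopy_succ, map_sub, h.homotopy_succ, ← LinearMap.comp_apply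
      (barResD i n), ih]
    simp

theorem range_barResD (n : ℕ) :
    LinearMap.range (barResD i n) = freeCycles ε (barResD (k := k) i) n := by
  cases n with
  | zero =>
    apply le_antisymm
    · rintro _ ⟨z, rfl⟩
      exact h.red_barResD z
    · intro z hz
      exact ⟨barContraction κ 0 z, by
        rw [h.homotopy_zero, (mem_redKer ε).1 hz, TensorProduct.tmul_zero, sub_zero]⟩
  | succ n =>
    apply le_antisymm
    · rintro _ ⟨z, rfl⟩
      exact LinearMap.congr_fun (h.barResD_barResD n) z
    · intro z hz
      exact ⟨barContraction κ (n + 1) z, by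
        rw [h.homotopy_succ, LinearMap.mem_ker.1 hz, map_zero, sub_zero]⟩

end IsAugmentationKernel

end BarResolution

/-! ### The bar complex of the opposite algebra -/

section Reversal

variable (k : Type u) [Field k] (I : Type w) [NonUnitalRing I] [Module k I]

/-- The isomorphism between the bar complexes of a nonunital algebra and of its opposite, given by
the reversal of tensors. -/
def barRev (n : ℕ) : Bar k Iᵐᵒᵖ n ≃ₗ[k] Bar k I n :=
  (PiTensorProduct.congr fun _ => (MulOpposite.opLinearEquiv k).symm).trans
    (PiTensorProduct.reindex k (fun _ => I) Fin.revPerm)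

variable {k I}

theorem barRev_tprod {n : ℕ} (a : Fin n → Iᵐᵒᵖ) :
    barRev k I n (PiTensorProduct.tprod k a) =
      PiTensorProduct.tprod k fun j => (a j.rev).unop := by
  rw [barRev, LinearEquiv.trans_apply, PiTensorProduct.congr_tprod, PiTensorProduct.reindex_tprod]
  rfl

theorem contractNth_rev {n : ℕ} (i : Fin n) (a : Fin (n + 1) → Iᵐᵒᵖ) :
    (fun j : Fin n => (Fin.contractNth i.castSucc (· * ·) a j.rev).unop) =
      Fin.contractNth i.rev.castSucc (· * ·) fun j => (a j.rev).unop := by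
  ext j
  obtain ⟨i, hi⟩ := i
  obtain ⟨j, hj⟩ := j
  rcases lt_trichotomy (n - (j + 1)) i with h | h | h
  · rw [Fin.contractNth_apply_of_lt _ _ _ _ (by simpa using h),
      Fin.contractNth_apply_of_gt _ _ _ _ (by simp; omega)]
    congr 2
    ext; simp
  · rw [Fin.contractNth_apply_of_eq _ _ _ _ (by simpa using h),
      Fin.contractNth_apply_of_eq _ _ _ _ (by simp; omega), MulOpposite.unop_mul]
    congr 3 <;> (ext; simp; try omega)
  · rw [Fin.contractNth_apply_of_gt _ _ _ _ (by simpa using h),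
      Fin.contractNth_apply_of_lt _ _ _ _ (by simp; omega)]
    congr 2
    ext; simp; omega

variable [IsScalarTower k I I] [SMulCommClass k I I]

/-- Reversal exchanges the face of index `i` with that of index `n - 1 - i`, and the two signs
differ by the factor `(-1) ^ (n + 1)`, which does not depend on `i`. -/
theorem barD_barRev {n : ℕ} (x : Bar k Iᵐᵒᵖ (n + 1)) :
    barD k I n (barRev k I (n + 1) x) = (-1 : k) ^ (n + 1) • barRev k I n (barD k Iᵐᵒᵖ n x) := by
  induction x using PiTensorProduct.induction_on with
  | smul_tprod r x =>
    simp only [map_smul]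
    rw [smul_comm]
    congr 1
    rw [barRev_tprod, barD_tprod, barD_tprod, map_sum, Finset.smul_sum,
      ← Equiv.sum_comp Fin.revPerm]
    refine Finset.sum_congr rfl fun i _ => ?_
    rw [map_smul, barRev_tprod, contractNth_rev, smul_smul, ← pow_add]
    congr 1
    have : n + 1 + (i : ℕ) = (Fin.revPerm i : ℕ) + 2 * (i + 1) := by
      simp only [Fin.revPerm_apply, Fin.val_rev]; omega
    rw [this, pow_add, pow_mul]
    simp
  | add x y hx hy => simp only [map_add, hx, hy, smul_add]

end Reversal

/-! ### Subspaces of the form `P ⊗ U` in `S ⊗ U` -/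

section RangeTensor

variable {k : Type u} [Field k] {S : Type*} [Ring S] [Algebra k S]
  {U : Type*} [AddCommGroup U] [Module k U]

variable (U) in
/-- The image of `P ⊗ U` in `S ⊗ U`. -/
def tensorRange (P : Submodule k S) : Submodule k (S ⊗[k] U) :=
  LinearMap.range (LinearMap.rTensor U P.subtype)

theorem tmul_mem_tensorRange {P : Submodule k S} {p : S} (hp : p ∈ P) (u : U) :
    p ⊗ₜ u ∈ tensorRange U P := ⟨⟨p, hp⟩ ⊗ₜ u, rfl⟩

theorem exists_mem_tensorRange {P : Submodule k S} {j : U →ₗ[k] S} {x : S}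
    (hx : x ∈ P * LinearMap.range j) :
    ∃ X ∈ tensorRange U P, freeLift (B := S) j X = x := by
  refine Submodule.mul_induction_on hx ?_ ?_
  · rintro p hp _ ⟨u, rfl⟩
    exact ⟨p ⊗ₜ u, tmul_mem_tensorRange hp u, rfl⟩
  · rintro x y ⟨X, hX, rfl⟩ ⟨Y, hY, rfl⟩
    exact ⟨X + Y, add_mem hX hY, map_add _ _ _⟩

theorem tensorRange_induction {P : Submodule k S} {p : S ⊗[k] U → Prop} {X : S ⊗[k] U}
    (hX : X ∈ tensorRange U P) (h0 : p 0) (ht : ∀ s ∈ P, ∀ u, p (s ⊗ₜ u))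
    (ha : ∀ x y, p x → p y → p (x + y)) : p X := by
  obtain ⟨Y, rfl⟩ := hX
  induction Y with
  | zero => rwa [map_zero]
  | tmul s u => exact ht s s.2 u
  | add x y hx hy => rw [map_add]; exact ha _ _ hx hy

theorem freeLift_mem {P : Submodule k S} (j : U →ₗ[k] S) {X : S ⊗[k] U}
    (hX : X ∈ tensorRange U P) : freeLift (B := S) j X ∈ P * LinearMap.range j := by
  refine tensorRange_induction
    (p := fun X => freeLift (B := S) j X ∈ P * LinearMap.range j) hX ?_ ?_ ?_
  · rw [map_zero]; exact zero_mem _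
  · intro s hs u
    exact Submodule.mul_mem_mul hs ⟨u, rfl⟩
  · intro x y hx hy
    rw [map_add]; exact add_mem hx hy

theorem rTensor_eq_zero {P : Submodule k S} {N : Type*} [AddCommGroup N] [Module k N]
    {f : S →ₗ[k] N} (hf : ∀ p ∈ P, f p = 0) {X : S ⊗[k] U} (hX : X ∈ tensorRange U P) :
    LinearMap.rTensor U f X = 0 := by
  refine tensorRange_induction (p := fun X => LinearMap.rTensor U f X = 0) hX (map_zero _) ?_ ?_
  · intro s hs u
    rw [LinearMap.rTensor_tmul, hf s hs, TensorProduct.zero_tmul]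
  · intro x y hx hy
    rw [map_add, hx, hy, add_zero]

theorem rTensor_eq_self {P : Submodule k S} {f : S →ₗ[k] S} (hf : ∀ p ∈ P, f p = p)
    {X : S ⊗[k] U} (hX : X ∈ tensorRange U P) : LinearMap.rTensor U f X = X := by
  refine tensorRange_induction (p := fun X => LinearMap.rTensor U f X = X) hX (map_zero _) ?_ ?_
  · intro s hs u
    rw [LinearMap.rTensor_tmul, hf s hs]
  · intro x y hx hy
    rw [map_add, hx, hy]

theorem mem_tensorRange_ker {N : Type*} [AddCommGroup N] [Module k N]
    {f : S →ₗ[k] N} {X : S ⊗[k] U} (hX : LinearMap.rTensor U f X = 0) :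
    X ∈ tensorRange U (LinearMap.ker f) := by
  have h : Function.Exact (LinearMap.ker f).subtype f := LinearMap.exact_subtype_ker_map f
  exact (Module.Flat.rTensor_exact U h X).1 hX

theorem exists_projection_of_disjoint {P Q : Submodule k S} (h : Disjoint P Q) :
    ∃ f : S →ₗ[k] S, (∀ p ∈ P, f p = p) ∧ ∀ q ∈ Q, f q = 0 := by
  obtain ⟨C, hC, hCP⟩ := h.symm.exists_isCompl
  refine ⟨P.subtype ∘ₗ Submodule.projectionOnto P C hCP.symm, fun p hp => ?_, fun q hq => ?_⟩
  · have := Submodule.projectionOnto_apply_left hCP.symm ⟨p, hp⟩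
    simp only [LinearMap.comp_apply]
    rw [this]; rfl
  · have := Submodule.projectionOnto_apply_right hCP.symm ⟨q, hC hq⟩
    simp only [LinearMap.comp_apply]
    rw [this]; simp

/-- Injectivity of the multiplication moves the question to `S ⊗ U`, where a projection of `S` onto
`P` that kills `Q` fixes `P ⊗ U` and annihilates `Q ⊗ U`. -/
theorem eq_zero_of_mem_mul_of_disjoint {P Q : Submodule k S} (h : Disjoint P Q) {j : U →ₗ[k] S}
    (hj : Function.Injective (freeLift (B := S) j)) {x : S} (hP : x ∈ P * LinearMap.range j)
    (hQ : x ∈ Q * LinearMap.range j) : x = 0 := by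
  obtain ⟨f, hf1, hf2⟩ := exists_projection_of_disjoint h
  obtain ⟨X, hX, rfl⟩ := exists_mem_tensorRange hP
  obtain ⟨Y, hY, hYX⟩ := exists_mem_tensorRange hQ
  obtain rfl := hj hYX
  rw [← rTensor_eq_self hf1 hX, rTensor_eq_zero hf2 hY, map_zero]

end RangeTensor

/-! ### The abstract one-sided Koszul complex and its primitive generators -/

section KoszulSystem

variable {k : Type u} [Field k] {S : Type*} [Ring S] [Algebra k S]
  {B : Type w} [Ring B] [Algebra k B] (π : S →ₐ[k] B) (ε : B →ₐ[k] k) (G R : Submodule k S)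
  {U : ℕ → Type*} [∀ n, AddCommGroup (U n)] [∀ n, Module k (U n)] (j : ∀ n, U n →ₗ[k] S)

/-- The properties of the spaces `J_n` of generators of the one-sided multi-Koszul complexes,
for spaces that are embedded in an algebra `S` by means of maps `j n`. -/
structure IsKoszulSystem : Prop where
  surjective : Function.Surjective π
  injective : ∀ n, Function.Injective (freeLift (B := S) (j n))
  bijective : Function.Bijective fun u => ε (π (j 0 u))
  mem_succ : ∀ n u, j (n + 1) u ∈
    LinearMap.ker (ε.comp π).toLinearMap * LinearMap.range (j n)
  mem_two : ∀ n u, j (n + 2) u ∈ R * LinearMap.range (j n)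
  mem_odd : ∀ n u, Even n → j (n + 1) u ∈ G * LinearMap.range (j n)
  rel_le : R ≤ LinearMap.ker π.toLinearMap
  rel_disjoint : Disjoint R
    (LinearMap.ker (ε.comp π).toLinearMap * LinearMap.ker π.toLinearMap ⊔
      LinearMap.ker π.toLinearMap * LinearMap.ker (ε.comp π).toLinearMap)
  exists_linear : ∃ τ : B →ₗ[k] S, (∀ g ∈ G, τ (π g) = g) ∧
    ∀ b c, ε b = 0 → ε c = 0 → τ (b * c) = 0

/-- The map `U (n + 1) → S ⊗ U n` that writes an element as a sum of products. -/
def koszulSplit (n : ℕ) : U (n + 1) →ₗ[k] S ⊗[k] U n :=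
  LinearMap.leftInverse ((freeLift (B := S) (j n)).restrictScalars k) ∘ₗ j (n + 1)

/-- The differential `B ⊗ U (n + 1) → B ⊗ U n`. -/
def koszulD (n : ℕ) : B ⊗[k] U (n + 1) →ₗ[B] B ⊗[k] U n :=
  freeLift (LinearMap.rTensor (U n) π.toLinearMap ∘ₗ koszulSplit j n)

/-- The comparison map from the spaces `U n` to the bar complex. -/
def koszulToBar {I : Type*} [NonUnitalRing I] [Module k I] (κ : B →ₗ[k] I) :
    ∀ n, U n →ₗ[k] Bar k I n
  | 0 => (PiTensorProduct.isEmptyEquiv (R := k) (s := fun _ : Fin 0 => I) (Fin 0)).symm.toLinearMap ∘ₗ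
      (ε.comp π).toLinearMap ∘ₗ j 0
  | n + 1 => barCons k I n ∘ₗ TensorProduct.map κ (koszulToBar κ n) ∘ₗ
      LinearMap.rTensor (U n) π.toLinearMap ∘ₗ koszulSplit j n

variable {π ε G R j}

theorem rTensor_algHom_smul {V : Type*} [AddCommGroup V] [Module k V] (s : S) (X : S ⊗[k] V) :
    LinearMap.rTensor V π.toLinearMap (s • X) = π s • LinearMap.rTensor V π.toLinearMap X := by
  induction X with
  | zero => simp
  | tmul t u => simp [TensorProduct.smul_tmul']
  | add x y hx hy => simp only [smul_add, map_add, hx, hy]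

theorem koszulD_one_tmul (n : ℕ) (u : U (n + 1)) :
    koszulD π j n (1 ⊗ₜ u) = LinearMap.rTensor (U n) π.toLinearMap (koszulSplit j n u) := by
  simp [koszulD]

theorem red_rTensor {V : Type*} [AddCommGroup V] [Module k V] {X : S ⊗[k] V}
    (hX : X ∈ tensorRange V (LinearMap.ker (ε.comp π).toLinearMap)) :
    red ε V (LinearMap.rTensor V π.toLinearMap X) = 0 := by
  refine tensorRange_induction
    (p := fun X => red ε V (LinearMap.rTensor V π.toLinearMap X) = 0) hX (by simp) ?_ ?_
  · intro s hs u
    have : ε (π s) = 0 := hs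
    simp [this]
  · intro x y hx hy
    rw [map_add, map_add, hx, hy, add_zero]

namespace IsKoszulSystem

variable (h : IsKoszulSystem π ε G R j)
include h

theorem freeLift_koszulSplit (n : ℕ) (u : U (n + 1)) :
    freeLift (B := S) (j n) (koszulSplit j n u) = j (n + 1) u := by
  obtain ⟨X, -, hX⟩ := exists_mem_tensorRange (h.mem_succ n u)
  rw [koszulSplit, LinearMap.comp_apply, ← hX]
  congr 1
  exact LinearMap.leftInverse_apply_of_inj
    (f := (freeLift (B := S) (j n)).restrictScalars k) (LinearMap.ker_eq_bot.2 (h.injective n)) X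

theorem eq_koszulSplit {n : ℕ} {u : U (n + 1)} {X : S ⊗[k] U n}
    (hX : freeLift (B := S) (j n) X = j (n + 1) u) : koszulSplit j n u = X :=
  h.injective n (by rw [h.freeLift_koszulSplit, hX])

theorem koszulSplit_mem {n : ℕ} {u : U (n + 1)} {P : Submodule k S}
    (hu : j (n + 1) u ∈ P * LinearMap.range (j n)) :
    koszulSplit j n u ∈ tensorRange (U n) P := by
  obtain ⟨X, hX, hXu⟩ := exists_mem_tensorRange hu
  rwa [h.eq_koszulSplit hXu]

theorem koszulD_rTensor (n : ℕ) (X : S ⊗[k] U (n + 1)) :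
    koszulD π j n (LinearMap.rTensor _ π.toLinearMap X) =
      LinearMap.rTensor _ π.toLinearMap (freeLift (B := S) (koszulSplit j n) X) := by
  induction X with
  | zero => simp
  | tmul s u =>
    simp only [LinearMap.rTensor_tmul, freeLift_tmul, koszulD, LinearMap.comp_apply,
      rTensor_algHom_smul]
    rfl
  | add x y hx hy => simp only [map_add, hx, hy]

theorem freeLift_freeLift (n : ℕ) (X : S ⊗[k] U (n + 1)) :
    freeLift (B := S) (j n) (freeLift (B := S) (koszulSplit j n) X) =
      freeLift (B := S) (j (n + 1)) X := by
  induction X with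
  | zero => simp
  | tmul s u => rw [freeLift_tmul, map_smul, h.freeLift_koszulSplit, freeLift_tmul]
  | add x y hx hy => simp only [map_add, hx, hy]

theorem red_koszulD (n : ℕ) (x) : red ε _ (koszulD π j n x) = 0 := by
  induction x with
  | zero => simp
  | tmul b u =>
    have : b ⊗ₜ[k] u = b • ((1 : B) ⊗ₜ[k] u) := by simp [TensorProduct.smul_tmul']
    rw [this, map_smul, red_smul, koszulD_one_tmul, red_rTensor, smul_zero]
    exact h.koszulSplit_mem (h.mem_succ n u)
  | add x y hx hy => rw [map_add, map_add, hx, hy, add_zero]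

/-- Splitting off two factors in succession is the unique way to write an element of `U (n + 2)` in
`S ⊗ U n`. As the element comes from `R · U n`, the result lies in `R ⊗ U n`, which `π` kills. -/
theorem koszulD_koszulD (n : ℕ) (x) : koszulD π j n (koszulD π j (n + 1) x) = 0 := by
  induction x with
  | zero => simp
  | tmul b u =>
    have : b ⊗ₜ[k] u = b • ((1 : B) ⊗ₜ[k] u) := by simp [TensorProduct.smul_tmul']
    rw [this, map_smul, map_smul, koszulD_one_tmul, h.koszulD_rTensor]
    obtain ⟨X, hX, hXu⟩ := exists_mem_tensorRange (h.mem_two n u)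
    have : freeLift (B := S) (koszulSplit j n) (koszulSplit j (n + 1) u) = X :=
      h.injective n (by rw [h.freeLift_freeLift, h.freeLift_koszulSplit, hXu])
    rw [this, rTensor_eq_zero (fun p hp => h.rel_le hp) hX, smul_zero]
  | add x y hx hy => rw [map_add, map_add, hx, hy, add_zero]

variable {I : Type*} [NonUnitalRing I] [Module k I] [IsScalarTower k I I] [SMulCommClass k I I]
  {i : I →ₙₐ[k] B} {κ : B →ₗ[k] I}

omit h in
theorem _root_.MultiKoszul.koszulToBar_succ (n : ℕ) (u : U (n + 1)) :
    koszulToBar π ε j κ (n + 1) u =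
      barCons k I n (TensorProduct.map κ (koszulToBar π ε j κ n) (koszulD π j n (1 ⊗ₜ u))) := by
  rw [koszulD_one_tmul]; rfl

-- Follows from the product rule `κ (b c) = κ b κ c + ε b κ c + ε c κ b` of the projection `b ↦ b -
-- ε b`.
omit h in
theorem _root_.MultiKoszul.map_proj_smul (hi : IsAugmentationKernel ε i κ) {V W : Type*}
    [AddCommGroup V] [Module k V] [AddCommGroup W] [Module k W] (f : V →ₗ[k] W) (b : B)
    (x : B ⊗[k] V) :
    TensorProduct.map κ f (b • x) =
      LinearMap.rTensor W (LinearMap.mulLeft k (κ b)) (TensorProduct.map κ f x) +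
        ε b • TensorProduct.map κ f x + κ b ⊗ₜ f (red ε V x) := by
  induction x with
  | zero => simp
  | tmul c v =>
    have h1 : κ (b * c) = κ b * κ c + ε b • κ c + ε c • κ b := by
      have := hi.proj_mul b (κ c)
      rw [hi.apply_proj, mul_sub, map_sub, Algebra.algebraMap_eq_smul_one, mul_smul_comm, mul_one,
        map_smul, sub_eq_iff_eq_add] at this
      exact this
    simp only [TensorProduct.smul_tmul', smul_eq_mul, TensorProduct.map_tmul, h1,
      TensorProduct.add_tmul, LinearMap.rTensor_tmul, LinearMap.mulLeft_apply, red_tmul, map_smul,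
      TensorProduct.tmul_smul]
  | add x y hx hy =>
    simp only [smul_add, map_add, hx, hy, TensorProduct.tmul_add]
    abel

/-- The image of a generator is a bar cycle because the Koszul differential squares to zero: each
face that merges two entries reflects a composite of two differentials. -/
theorem barD_koszulToBar (hi : IsAugmentationKernel ε i κ) (n : ℕ) (u : U (n + 1)) :
    barD k I n (koszulToBar π ε j κ (n + 1) u) = 0 := by
  induction n with
  | zero => rw [barD_zero, LinearMap.zero_apply]
  | succ n ih =>
    -- On a pure tensor `b ⊗ v` only the merging face survives, since the image of `v` is a cycle by
    -- induction. The product rule for `κ` then produces `d (b ⊗ v)` minus its part with coefficient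
    -- `ε b`, which is the boundary of `1 ⊗ red (b ⊗ v)`.
    have key (y : B ⊗[k] U (n + 1)) :
        barD k I (n + 1) (barCons k I (n + 1) (TensorProduct.map κ (koszulToBar π ε j κ (n + 1)) y))
          = barCons k I n (TensorProduct.map κ (koszulToBar π ε j κ n)
            (koszulD π j n (y - 1 ⊗ₜ red ε _ y))) := by
      induction y with
      | zero => simp
      | tmul b v =>
        have h1 : b ⊗ₜ[k] v = b • ((1 : B) ⊗ₜ[k] v) := by simp [TensorProduct.smul_tmul']
        rw [TensorProduct.map_tmul, barD_barCons, ih, TensorProduct.tmul_zero, map_zero, sub_zero,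
          koszulToBar_succ, barMerge, LinearMap.comp_apply, LinearMap.comp_apply, barSplit_barCons,
          red_tmul, TensorProduct.tmul_smul, h1, map_sub, map_smul, map_sub,
          map_proj_smul hi, h.red_koszulD, map_zero, TensorProduct.tmul_zero, add_zero,
          LinearMap.map_smul_of_tower, map_smul, add_sub_cancel_right]
      | add x y hx hy =>
        simp only [map_add, hx, hy, TensorProduct.tmul_add, map_sub]
        abel
    rw [koszulToBar_succ, key, h.red_koszulD, TensorProduct.tmul_zero, sub_zero, h.koszulD_koszulD,
      map_zero, map_zero]

/-- Since generators go to bar cycles, the differential of the bar resolution only cuts off the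
first entry there. Compatibility then holds because `i ∘ κ` acts as the identity on coefficients
killed by `ε`, and the Koszul boundaries have such coefficients. -/
theorem isComparison (hi : IsAugmentationKernel ε i κ) :
    IsComparison ε (koszulD π j) (barResD i) (koszulToBar π ε j κ) where
  range_le n := by
    rintro _ ⟨x, rfl⟩
    cases n with
    | zero => exact h.red_koszulD 0 x
    | succ n => exact h.koszulD_koszulD n x
  minimal := h.red_koszulD
  exact := hi.range_barResD
  comm n x := by
    induction x with
    | zero => simp
    | tmul b u =>
      have h1 : b ⊗ₜ[k] u = b • ((1 : B) ⊗ₜ[k] u) := by simp [TensorProduct.smul_tmul']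
      rw [h1, map_smul, map_smul, map_smul, map_smul]
      congr 1
      rw [LinearMap.baseChange_tmul, barResD_tmul, h.barD_koszulToBar hi, TensorProduct.tmul_zero,
        sub_zero, one_smul, barCut, LinearMap.comp_apply, koszulToBar_succ, barSplit_barCons]
      generalize hy : koszulD π j n ((1 : B) ⊗ₜ[k] u) = y
      have h2 : TensorProduct.map κ (koszulToBar π ε j κ n) y =
          LinearMap.rTensor _ κ (LinearMap.lTensor B (koszulToBar π ε j κ n) y) := by
        rw [← LinearMap.comp_apply, LinearMap.rTensor_comp_lTensor]
      have h3 : LinearMap.lTensor B (koszulToBar π ε j κ n) y =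
        (koszulToBar π ε j κ n).baseChange B y := rfl
      rw [h2, h3, hi.rTensor_apply_proj, red_baseChange, ← hy, h.red_koszulD, map_zero,
        TensorProduct.tmul_zero, sub_zero]
    | add x y hx hy => simp only [map_add, hx, hy]
  bijective := by
    change Function.Bijective ((PiTensorProduct.isEmptyEquiv (R := k) (s := fun _ : Fin 0 => I)
      (Fin 0)).symm ∘ fun u => ε (π (j 0 u)))
    exact (LinearEquiv.bijective _).comp h.bijective

theorem injective_j (n : ℕ) : Function.Injective (j n) := by
  intro u v huv
  have h1 : (1 : S) ⊗ₜ[k] u = (1 : S) ⊗ₜ[k] v := h.injective n (by simp [huv])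
  have h2 := congrArg (red (ε.comp π) (U n)) h1
  simpa using h2

/-- Here `d (1 ⊗ u)` has coefficients in `π G`. If it is decomposable and the cycles reduce to zero,
its coefficients also lie in the square of the augmentation ideal. The map `τ` recovers `G` from `π
G` and kills that square. -/
theorem eq_zero_of_even {n : ℕ} (hn : Even n)
    (hK : ∀ x ∈ freeCycles ε (koszulD π j) n, red ε _ x = 0) {u : U (n + 1)}
    (hu : koszulD π j n ((1 : B) ⊗ₜ u) ∈ augIdeal ε • freeCycles ε (koszulD π j) n) : u = 0 := by
  obtain ⟨τ, h1, h2⟩ := h.exists_linear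
  have h3 {b : B} (hb : ε b = 0) (x : B ⊗[k] U n) :
      LinearMap.rTensor _ τ (b • x) = τ b ⊗ₜ red ε _ x := by
    induction x with
    | zero => simp
    | tmul c v =>
      have h4 := h2 b (c - algebraMap k B (ε c)) hb (by simp)
      rw [mul_sub, map_sub, Algebra.algebraMap_eq_smul_one, mul_smul_comm, mul_one, map_smul,
        sub_eq_zero] at h4
      rw [TensorProduct.smul_tmul', smul_eq_mul, LinearMap.rTensor_tmul, h4, red_tmul,
        TensorProduct.smul_tmul]
    | add x y hx hy => simp only [smul_add, map_add, hx, hy, TensorProduct.tmul_add]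
  have h5 : LinearMap.rTensor _ τ (koszulD π j n ((1 : B) ⊗ₜ u)) = 0 := by
    refine Submodule.smul_induction_on hu ?_ ?_
    · intro b hb x hx
      rw [h3 ((mem_augIdeal ε).1 hb), hK x hx, TensorProduct.tmul_zero]
    · intro x y hx hy
      rw [map_add, hx, hy, add_zero]
  rw [koszulD_one_tmul, ← LinearMap.comp_apply, ← LinearMap.rTensor_comp,
    rTensor_eq_self (fun g hg => h1 g hg) (h.koszulSplit_mem (h.mem_odd n u hn))] at h5
  apply h.injective_j (n + 1)
  rw [← h.freeLift_koszulSplit, h5, map_zero, map_zero]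

/-- Let `S₊` be the kernel of `ε ∘ π`. A cycle lifts to an element of `S ⊗ U (n + 1)` with product
in `ker π · U n`, so a decomposable boundary lifts to one with product in `S₊ ker π · U n`. The
splitting of `u` differs from this lift by an element of `ker π ⊗ U (n + 1)`, whose product lies in
`ker π S₊ · U n`. Minimality of `R` then applies, because `u` comes from `R · U n`. -/
theorem eq_zero_of_odd {n : ℕ} {u : U (n + 2)}
    (hu : koszulD π j (n + 1) ((1 : B) ⊗ₜ u) ∈
      augIdeal ε • freeCycles ε (koszulD π j) (n + 1)) : u = 0 := by
  have key : ∀ z ∈ augIdeal ε • freeCycles ε (koszulD π j) (n + 1), ∃ Z,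
      LinearMap.rTensor _ π.toLinearMap Z = z ∧ freeLift (B := S) (j (n + 1)) Z ∈
        LinearMap.ker (ε.comp π).toLinearMap * LinearMap.ker π.toLinearMap *
          LinearMap.range (j n) := by
    intro z hz
    refine Submodule.smul_induction_on hz ?_ ?_
    · intro b hb x hx
      obtain ⟨t, rfl⟩ := h.surjective b
      obtain ⟨X, rfl⟩ := LinearMap.rTensor_surjective (U (n + 1)) (g := π.toLinearMap) h.surjective x
      refine ⟨t • X, rTensor_algHom_smul t X, ?_⟩
      rw [map_smul, smul_eq_mul, mul_assoc]
      refine Submodule.mul_mem_mul ((mem_augIdeal ε).1 hb) ?_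
      have hx' : koszulD π j n _ = 0 := hx
      rw [h.koszulD_rTensor] at hx'
      rw [← h.freeLift_freeLift]
      exact freeLift_mem _ (mem_tensorRange_ker hx')
    · rintro x y ⟨X, rfl, hX⟩ ⟨Y, rfl, hY⟩
      exact ⟨X + Y, map_add _ _ _, by rw [map_add]; exact add_mem hX hY⟩
  obtain ⟨Z, hZ1, hZ2⟩ := key _ hu
  have h1 : koszulSplit j (n + 1) u - Z ∈ tensorRange _ (LinearMap.ker π.toLinearMap) := by
    apply mem_tensorRange_ker
    rw [map_sub, hZ1, koszulD_one_tmul, sub_self]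
  have h2 := freeLift_mem (j (n + 1)) h1
  have h3 : LinearMap.range (j (n + 1)) ≤
      LinearMap.ker (ε.comp π).toLinearMap * LinearMap.range (j n) := by
    rintro _ ⟨v, rfl⟩
    exact h.mem_succ n v
  -- The ambiguity of the lift is pushed down one more degree, through `U (n + 1) ⊆ S₊ · U n`, to be
  -- compared with the other term inside `S · U n`.
  have h4 := mul_le_mul_right h3 (LinearMap.ker π.toLinearMap) h2
  rw [← mul_assoc, map_sub, h.freeLift_koszulSplit] at h4
  have h5 : j (n + 2) u ∈ (LinearMap.ker (ε.comp π).toLinearMap * LinearMap.ker π.toLinearMap ⊔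
      LinearMap.ker π.toLinearMap * LinearMap.ker (ε.comp π).toLinearMap) *
        LinearMap.range (j n) := by
    rw [Submodule.sup_mul]
    have := add_mem (Submodule.mem_sup_right h4) (Submodule.mem_sup_left hZ2)
    rwa [sub_add_cancel] at this
  have h6 := eq_zero_of_mem_mul_of_disjoint h.rel_disjoint (h.injective n) (h.mem_two n u) h5
  exact h.injective_j (n + 2) (by rw [h6, map_zero])

/-- The case of even `n` needs that the cycles in position `n` reduce to zero. This holds by
definition for `n = 0`, and otherwise it follows from primitivity in the odd position just below,
which is obtained independently. -/
theorem primitive (hi : IsAugmentationKernel ε i κ) (n : ℕ) (u : U (n + 1))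
    (hu : koszulD π j n ((1 : B) ⊗ₜ u) ∈ augIdeal ε • freeCycles ε (koszulD π j) n) : u = 0 := by
  rcases Nat.even_or_odd n with hn | hn
  · refine h.eq_zero_of_even hn ?_ hu
    cases n with
    | zero => exact fun x hx => hx
    | succ n =>
      obtain ⟨m, rfl⟩ : ∃ m, n = m + 1 := ⟨n - 1, by rcases hn with ⟨r, hr⟩; omega⟩
      exact fun x hx => (h.isComparison hi).red_eq_zero_of_mem (fun u => h.eq_zero_of_odd) hx
  · obtain ⟨m, rfl⟩ : ∃ m, n = m + 1 := ⟨n - 1, by rcases hn with ⟨r, hr⟩; omega⟩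
    exact h.eq_zero_of_odd hu

theorem red_eq_zero (hi : IsAugmentationKernel ε i κ) (n : ℕ) :
    ∀ x ∈ freeCycles ε (koszulD π j) n, red ε _ x = 0 := by
  cases n with
  | zero => exact fun x hx => hx
  | succ n => exact fun x hx => (h.isComparison hi).red_eq_zero_of_mem (h.primitive hi n) hx

end IsKoszulSystem

end KoszulSystem

/-! ### Subspaces that generate free one-sided ideals -/

section Free

variable {k : Type u} [Field k] {S : Type*} [Ring S] [Algebra k S]

/-- The multiplication `S ⊗ P → S` is injective. -/
def LeftFree (P : Submodule k S) : Prop :=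
  Function.Injective (freeLift (B := S) P.subtype)

/-- The multiplication `P ⊗ S → S` is injective. -/
def RightFree (P : Submodule k S) : Prop :=
  Function.Injective (LinearMap.mul' k S ∘ₗ LinearMap.rTensor S P.subtype)

theorem freeLift_comp {U U' : Type*} [AddCommGroup U] [Module k U] [AddCommGroup U'] [Module k U']
    (j : U' →ₗ[k] S) (f : U →ₗ[k] U') (X : S ⊗[k] U) :
    freeLift (B := S) (j ∘ₗ f) X = freeLift (B := S) j (LinearMap.lTensor S f X) := by
  induction X with
  | zero => simp
  | tmul s u => simp
  | add x y hx hy => simp only [map_add, hx, hy]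

theorem LeftFree.injective {U : Type*} [AddCommGroup U] [Module k U] {j : U →ₗ[k] S}
    (h : LeftFree (LinearMap.range j)) (hj : Function.Injective j) :
    Function.Injective (freeLift (B := S) j) := by
  have h2 : (freeLift (B := S) j : S ⊗[k] U → S) =
      freeLift (B := S) (LinearMap.range j).subtype ∘ LinearMap.lTensor S j.rangeRestrict := by
    ext X
    exact freeLift_comp (LinearMap.range j).subtype j.rangeRestrict X
  rw [h2]
  refine Function.Injective.comp h ?_
  exact Module.Flat.lTensor_preserves_injective_linearMap _
    fun u v huv => hj (congrArg Subtype.val huv)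

theorem LeftFree.mono {P Q : Submodule k S} (h : LeftFree Q) (hPQ : P ≤ Q) : LeftFree P := by
  have h2 : (freeLift (B := S) P.subtype : S ⊗[k] P → S) =
      freeLift (B := S) Q.subtype ∘ LinearMap.lTensor S (Submodule.inclusion hPQ) := by
    ext X
    exact freeLift_comp Q.subtype (Submodule.inclusion hPQ) X
  rw [LeftFree, h2]
  exact Function.Injective.comp h (Module.Flat.lTensor_preserves_injective_linearMap _
    (Submodule.inclusion_injective hPQ))

theorem LeftFree.of_surjective {U : Type*} [AddCommGroup U] [Module k U] {P : Submodule k S}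
    {f : U →ₗ[k] P} (hf : Function.Surjective f)
    (h : Function.Injective (freeLift (B := S) (P.subtype ∘ₗ f))) : LeftFree P := by
  have h3 : (freeLift (B := S) (P.subtype ∘ₗ f) : S ⊗[k] U → S) =
      freeLift (B := S) P.subtype ∘ LinearMap.lTensor S f := by
    ext X
    exact freeLift_comp P.subtype f X
  rw [h3] at h
  exact (Function.Injective.of_comp_iff' _ ⟨h.of_comp, LinearMap.lTensor_surjective _ hf⟩).1 h

theorem leftFree_one : LeftFree (1 : Submodule k S) := by
  rw [Submodule.one_eq_range]
  refine LeftFree.of_surjective (LinearMap.surjective_rangeRestrict (Algebra.linearMap k S)) ?_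
  intro x y hxy
  have h2 (x : S ⊗[k] k) : freeLift (B := S) ((LinearMap.range (Algebra.linearMap k S)).subtype ∘ₗ
      (Algebra.linearMap k S).rangeRestrict) x = TensorProduct.rid k S x := by
    induction x with
    | zero => simp
    | tmul s c =>
      rw [freeLift_tmul, TensorProduct.rid_tmul, Algebra.smul_def, Algebra.commutes]
      rfl
    | add x y hx hy => simp only [map_add, hx, hy]
  rw [h2, h2] at hxy
  exact (TensorProduct.rid k S).injective hxy

/-- The multiplication of `S ⊗ P ⊗ Q` factors through `S ⊗ Q`, and both factors are injective since
tensoring over a field preserves injections. -/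
theorem LeftFree.mul {P Q : Submodule k S} (hP : LeftFree P) (hQ : LeftFree Q) :
    LeftFree (P * Q) := by
  let f : P ⊗[k] Q →ₗ[k] (P * Q : Submodule k S) :=
    (Submodule.mulMap P Q).codRestrict _ fun x => by
      rw [← Submodule.mulMap_range]
      exact ⟨x, rfl⟩
  have hf : Function.Surjective f := by
    rintro ⟨x, hx⟩
    rw [← Submodule.mulMap_range] at hx
    obtain ⟨y, rfl⟩ := hx
    exact ⟨y, rfl⟩
  refine LeftFree.of_surjective (U := P ⊗[k] Q) hf ?_
  have h2 : (freeLift (U := P ⊗[k] Q) (B := S) ((P * Q).subtype ∘ₗ f) :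
      S ⊗[k] (P ⊗[k] Q) → S) =
      freeLift (B := S) Q.subtype ∘ (LinearMap.rTensor Q
        ((freeLift (B := S) P.subtype).restrictScalars k)) ∘
        (TensorProduct.assoc k S P Q).symm := by
    ext X
    induction X with
    | zero => simp
    | tmul s y =>
      induction y with
      | zero => simp
      | tmul p q => simp [f, mul_assoc]
      | add x y hx hy =>
        simp only [Function.comp_apply, TensorProduct.tmul_add, map_add] at hx hy ⊢
        rw [hx, hy]
    | add x y hx hy =>
      simp only [Function.comp_apply, map_add] at hx hy ⊢
      rw [hx, hy]
  rw [h2]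
  exact hQ.comp ((Module.Flat.rTensor_preserves_injective_linearMap _ hP).comp
    (LinearEquiv.injective _))

theorem LeftFree.pow {P : Submodule k S} (hP : LeftFree P) (n : ℕ) : LeftFree (P ^ n) := by
  induction n with
  | zero => rw [pow_zero]; exact leftFree_one
  | succ n ih => rw [pow_succ]; exact ih.mul hP

theorem mul_eq_mul_range {P Q : Submodule k S} : P * Q = P * LinearMap.range Q.subtype := by
  rw [Submodule.range_subtype]

/-- Inside `S ⊗ Q` the intersection of `S ⊗ P` and `C ⊗ Q` is `C ⊗ P`: a projection of `S` onto `C`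
fixes the tensor and preserves `S ⊗ P`. This is what allows a factor `R` to be split off from
`J_{n+2}` with the remaining factor in `J_n`. -/
theorem LeftFree.mem_mul {P Q C D : Submodule k S} (hQ : LeftFree Q) (hPQ : P ≤ Q) {x : S}
    (h1 : x ∈ D * P) (h2 : x ∈ C * Q) : x ∈ C * P := by
  rw [mul_eq_mul_range] at h1 h2 ⊢
  obtain ⟨Y, -, hY⟩ := exists_mem_tensorRange h1
  obtain ⟨X, hX, hXx⟩ := exists_mem_tensorRange h2
  obtain ⟨E, hE⟩ := Submodule.exists_isCompl C
  let f := C.subtype ∘ₗ Submodule.projectionOnto C E hE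
  have hf : ∀ c ∈ C, f c = c := fun c hc =>
    congrArg Subtype.val (Submodule.projectionOnto_apply_left hE ⟨c, hc⟩)
  have h3 : LinearMap.lTensor S (Submodule.inclusion hPQ) Y = X := by
    apply hQ
    rw [hXx, ← freeLift_comp, ← hY]
    rfl
  have h4 : LinearMap.rTensor P f Y ∈ tensorRange P C :=
    ⟨LinearMap.rTensor P (Submodule.projectionOnto C E hE) Y, by
      rw [← LinearMap.comp_apply, ← LinearMap.rTensor_comp]⟩
  have h5 : freeLift (B := S) P.subtype (LinearMap.rTensor P f Y) = x := by
    have h6 : freeLift (B := S) P.subtype (LinearMap.rTensor P f Y) =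
        freeLift (B := S) Q.subtype
          (LinearMap.lTensor S (Submodule.inclusion hPQ) (LinearMap.rTensor P f Y)) := by
      rw [← freeLift_comp]
      rfl
    rw [h6, ← LinearMap.comp_apply (LinearMap.lTensor _ _), LinearMap.lTensor_comp_rTensor,
      ← LinearMap.rTensor_comp_lTensor, LinearMap.comp_apply, h3, rTensor_eq_self hf hX, hXx]
  rw [← h5]
  exact freeLift_mem _ h4

/-- In `S ⊗ C` the intersection of `P ⊗ C` and `Q ⊗ C` is the kernel of the map to the direct sum of
the quotients by `P` and `Q`, that is `(P ⊓ Q) ⊗ C`. -/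
theorem LeftFree.inf_mul_le {P Q C : Submodule k S} (hC : LeftFree C) :
    P * C ⊓ Q * C ≤ (P ⊓ Q) * C := by
  rintro x ⟨h1, h2⟩
  rw [SetLike.mem_coe, mul_eq_mul_range] at h1 h2
  rw [mul_eq_mul_range]
  obtain ⟨X, hX, rfl⟩ := exists_mem_tensorRange h1
  obtain ⟨Y, hY, hXY⟩ := exists_mem_tensorRange h2
  obtain rfl := hC hXY
  apply freeLift_mem
  let f : S →ₗ[k] (S ⧸ P) × (S ⧸ Q) := P.mkQ.prod Q.mkQ
  have hf : LinearMap.ker f = P ⊓ Q := by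
    simp [f, LinearMap.ker_prod]
  rw [← hf]
  apply mem_tensorRange_ker
  have h3 : f = LinearMap.inl k _ _ ∘ₗ P.mkQ + LinearMap.inr k _ _ ∘ₗ Q.mkQ := by
    ext x <;> simp [f]
  rw [h3, LinearMap.rTensor_add, LinearMap.add_apply, LinearMap.rTensor_comp,
    LinearMap.rTensor_comp, LinearMap.comp_apply, LinearMap.comp_apply,
    rTensor_eq_zero (f := P.mkQ) (fun p hp => by simpa using hp) hX,
    rTensor_eq_zero (f := Q.mkQ) (fun p hp => by simpa using hp) hY, map_zero, map_zero, add_zero]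

/-- The filtration of an algebra by the length of products of elements of a subspace `G`. -/
def lengthFiltration (G : Submodule k S) : ℕ → Submodule k S
  | 0 => ⊥
  | n + 1 => 1 ⊔ G * lengthFiltration G n

theorem lengthFiltration_mono (G : Submodule k S) : Monotone (lengthFiltration G) := by
  refine monotone_nat_of_le_succ fun n => ?_
  induction n with
  | zero => exact bot_le
  | succ n ih => exact sup_le_sup le_rfl (mul_le_mul_right ih G)

theorem pow_le_lengthFiltration (G : Submodule k S) (n : ℕ) :
    G ^ n ≤ lengthFiltration G (n + 1) := by
  induction n with
  | zero => rw [pow_zero]; exact le_sup_left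
  | succ n ih => rw [pow_succ']; exact (mul_le_mul_right ih G).trans le_sup_right

/-- In an algebra that is generated by a subspace `G` such that `G ⊗ S → S` is injective, a
subspace `R` generates a free left ideal if it does not meet `G S R`. -/
theorem leftFree_of_disjoint {G R : Submodule k S} (hG : RightFree G)
    (htop : ⨆ n : ℕ, G ^ n = ⊤) (hR : Disjoint R (G * ⊤ * R)) : LeftFree R := by
  let μ : S ⊗[k] R →ₗ[k] S := (freeLift (B := S) R.subtype).restrictScalars k
  let μG : G ⊗[k] S →ₗ[k] S := LinearMap.mul' k S ∘ₗ LinearMap.rTensor S G.subtype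
  let ν : G ⊗[k] (S ⊗[k] R) →ₗ[k] S ⊗[k] R :=
    LinearMap.rTensor R μG ∘ₗ (TensorProduct.assoc k G S R).symm.toLinearMap
  have hν (g : G) (s : S) (r : R) : ν (g ⊗ₜ (s ⊗ₜ r)) = ((g : S) * s) ⊗ₜ r := by simp [ν, μG]
  have hμν (Y) : μ (ν Y) = μG (LinearMap.lTensor G μ Y) := by
    induction Y with
    | zero => simp
    | tmul g y =>
      induction y with
      | zero => simp
      | tmul s r => rw [hν]; simp [μ, μG, mul_assoc]
      | add x y hx hy => simp only [TensorProduct.tmul_add, map_add, hx, hy]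
    | add x y hx hy => simp only [map_add, hx, hy]
  have hmem (Y) : μG (LinearMap.lTensor G μ Y) ∈ G * ⊤ * R := by
    induction Y with
    | zero => simp
    | tmul g y =>
      induction y with
      | zero => simp
      | tmul s r =>
        have : μG (LinearMap.lTensor G μ (g ⊗ₜ (s ⊗ₜ r))) = (g : S) * s * r := by
          simp [μ, μG, mul_assoc]
        rw [this]
        exact Submodule.mul_mem_mul (Submodule.mul_mem_mul g.2 trivial) r.2
      | add x y hx hy =>
        simp only [TensorProduct.tmul_add, map_add]
        exact add_mem hx hy
    | add x y hx hy =>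
      simp only [map_add]
      exact add_mem hx hy
  -- Induction on the length of the coefficients. The filtration starts at `⊥`, so the base case is
  -- empty, and products of `n` generators occur in step `n + 1`.
  have key (m : ℕ) : ∀ X ∈ tensorRange R (lengthFiltration G m), μ X = 0 → X = 0 := by
    induction m with
    | zero =>
      intro X hX _
      exact tensorRange_induction (p := fun X => X = 0) hX rfl
        (fun s hs u => by rw [(Submodule.mem_bot k).1 hs, TensorProduct.zero_tmul])
        (fun x y hx hy => by rw [hx, hy, add_zero])
    | succ m ih =>
      intro X hX hX0
      let F := tensorRange R (lengthFiltration G m)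
      have hdec : ∃ (ρ : R) (Y : G ⊗[k] F), X = 1 ⊗ₜ ρ + ν (LinearMap.lTensor G F.subtype Y) := by
        refine tensorRange_induction (p := fun X => ∃ (ρ : R) (Y : G ⊗[k] F),
          X = 1 ⊗ₜ ρ + ν (LinearMap.lTensor G F.subtype Y)) hX ⟨0, 0, by simp⟩ ?_ ?_
        · intro s hs r
          obtain ⟨c, hc, t, ht, rfl⟩ := Submodule.mem_sup.1 hs
          obtain ⟨c, rfl⟩ := Submodule.mem_one.1 hc
          have ht' : ∃ Y : G ⊗[k] F, t ⊗ₜ[k] r = ν (LinearMap.lTensor G F.subtype Y) := by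
            refine Submodule.mul_induction_on ht ?_ ?_
            · intro g hg s hs
              exact ⟨⟨g, hg⟩ ⊗ₜ ⟨s ⊗ₜ r, tmul_mem_tensorRange hs r⟩, by
                rw [LinearMap.lTensor_tmul, Submodule.subtype_apply, hν]⟩
            · rintro x y ⟨X, hX⟩ ⟨Y, hY⟩
              exact ⟨X + Y, by rw [TensorProduct.add_tmul, hX, hY, map_add, map_add]⟩
          obtain ⟨Y, hY⟩ := ht'
          refine ⟨c • r, Y, ?_⟩
          rw [TensorProduct.add_tmul, hY, Algebra.algebraMap_eq_smul_one, TensorProduct.smul_tmul]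
        · rintro x y ⟨ρ, X, rfl⟩ ⟨σ, Y, rfl⟩
          refine ⟨ρ + σ, X + Y, ?_⟩
          rw [TensorProduct.tmul_add, map_add, map_add]
          abel
      obtain ⟨ρ, Y, rfl⟩ := hdec
      rw [map_add, hμν] at hX0
      -- The relation `ρ + (element of G S R) = 0` forces `ρ = 0` by disjointness. What remains is a
      -- relation in `G ⊗ S`, and freeness of `G` cancels the first factor, leaving shorter
      -- coefficients.
      have h1 : μ (1 ⊗ₜ ρ) = ρ := by simp [μ]
      have h2 : (ρ : S) = 0 := by
        refine Submodule.disjoint_def.1 hR _ ρ.2 ?_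
        rw [← h1, eq_neg_of_add_eq_zero_left hX0]
        exact neg_mem (hmem _)
      have h3 : ρ = 0 := Subtype.ext h2
      rw [h3, TensorProduct.tmul_zero, map_zero, zero_add] at hX0
      have h4 := hG (hX0.trans (map_zero μG).symm)
      rw [← LinearMap.comp_apply, ← LinearMap.lTensor_comp] at h4
      have h5 : Function.Injective (μ ∘ₗ F.subtype) := by
        rw [injective_iff_map_eq_zero]
        intro x hx
        exact Subtype.ext (ih x x.2 hx)
      have h6 : Y = 0 := Module.Flat.lTensor_preserves_injective_linearMap (M := G) _ h5
        (h4.trans (map_zero _).symm)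
      rw [h3, h6]
      simp
  have hfil (X : S ⊗[k] R) : ∃ m, X ∈ tensorRange R (lengthFiltration G m) := by
    induction X with
    | zero => exact ⟨0, zero_mem _⟩
    | tmul s r =>
      have h1 : s ∈ ⨆ n, lengthFiltration G n := by
        have : (⊤ : Submodule k S) ≤ ⨆ n, lengthFiltration G n := by
          rw [← htop]
          exact iSup_le fun n => (pow_le_lengthFiltration G n).trans (le_iSup _ (n + 1))
        exact this trivial
      obtain ⟨m, hm⟩ := (Submodule.mem_iSup_of_directed _
        (lengthFiltration_mono G).directed_le).1 h1
      exact ⟨m, tmul_mem_tensorRange hm r⟩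
    | add x y hx hy =>
      obtain ⟨m, hm⟩ := hx
      obtain ⟨n, hn⟩ := hy
      have hmono {a b : ℕ} (hab : a ≤ b) :
          tensorRange R (lengthFiltration G a) ≤ tensorRange R (lengthFiltration G b) := by
        intro X hX
        exact tensorRange_induction (p := fun X => X ∈ tensorRange R (lengthFiltration G b)) hX
          (zero_mem _) (fun s hs u => tmul_mem_tensorRange (lengthFiltration_mono G hab hs) u)
          (fun x y hx hy => add_mem hx hy)
      exact ⟨max m n, add_mem (hmono (le_max_left _ _) hm) (hmono (le_max_right _ _) hn)⟩
  intro X Y hXY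
  obtain ⟨m, hm⟩ := hfil (X - Y)
  refine sub_eq_zero.1 (key m _ hm ?_)
  rw [map_sub, sub_eq_zero]
  exact hXY

end Free

/-! ### Free presentations, their opposites, and the spaces `J_n` -/

section Presentations

variable {k : Type u} [Field k] {S : Type*} [Ring S] [Algebra k S]
  {B : Type w} [Ring B] [Algebra k B]

/-- The augmentation of the opposite of an augmented algebra. -/
def opAug (ε : B →ₐ[k] k) : Bᵐᵒᵖ →ₐ[k] k := ε.fromOpposite fun _ _ => mul_comm _ _

@[simp]
theorem opAug_apply (ε : B →ₐ[k] k) (b : Bᵐᵒᵖ) : opAug ε b = ε b.unop := rfl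

/-- A subspace, regarded as a subspace of the opposite algebra. -/
def opSub (P : Submodule k S) : Submodule k Sᵐᵒᵖ :=
  P.map (↑(MulOpposite.opLinearEquiv k : S ≃ₗ[k] Sᵐᵒᵖ) : S →ₗ[k] Sᵐᵒᵖ)

theorem mem_opSub {P : Submodule k S} {x : Sᵐᵒᵖ} : x ∈ opSub P ↔ x.unop ∈ P := by
  constructor
  · rintro ⟨y, hy, rfl⟩
    exact hy
  · intro h
    exact ⟨x.unop, h, rfl⟩

theorem opSub_mul (P Q : Submodule k S) : opSub (P * Q) = opSub Q * opSub P :=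
  Submodule.map_op_mul P Q

theorem opSub_one : opSub (1 : Submodule k S) = 1 := Submodule.map_op_one

theorem opSub_pow (P : Submodule k S) (n : ℕ) : opSub (P ^ n) = opSub P ^ n :=
  Submodule.map_op_pow P n

theorem opSub_mono {P Q : Submodule k S} (h : P ≤ Q) : opSub P ≤ opSub Q := Submodule.map_mono h

theorem opSub_top : opSub (⊤ : Submodule k S) = ⊤ :=
  eq_top_iff.2 fun _ _ => mem_opSub.2 trivial

theorem opSub_sup (P Q : Submodule k S) : opSub (P ⊔ Q) = opSub P ⊔ opSub Q :=
  Submodule.map_sup ..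

theorem disjoint_opSub {P Q : Submodule k S} (h : Disjoint P Q) :
    Disjoint (opSub P) (opSub Q) := by
  rw [Submodule.disjoint_def] at h ⊢
  intro x hP hQ
  exact MulOpposite.unop_injective (h _ (mem_opSub.1 hP) (mem_opSub.1 hQ))

theorem ker_op (π : S →ₐ[k] B) :
    LinearMap.ker (AlgHom.op π).toLinearMap = opSub (LinearMap.ker π.toLinearMap) := by
  ext x
  rw [mem_opSub]
  change MulOpposite.op (π x.unop) = 0 ↔ π x.unop = 0
  exact MulOpposite.op_eq_zero_iff _

theorem ker_opAug_comp (π : S →ₐ[k] B) (ε : B →ₐ[k] k) :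
    LinearMap.ker ((opAug ε).comp (AlgHom.op π)).toLinearMap =
      opSub (LinearMap.ker (ε.comp π).toLinearMap) := by
  ext x
  rw [mem_opSub]
  rfl

theorem leftFree_opSub {P : Submodule k S} (h : RightFree P) : LeftFree (opSub P) := by
  let e : Sᵐᵒᵖ ⊗[k] P ≃ₗ[k] P ⊗[k] S :=
    (TensorProduct.congr (MulOpposite.opLinearEquiv k).symm (LinearEquiv.refl k P)).trans
      (TensorProduct.comm k S P)
  let f : P →ₗ[k] opSub P := (MulOpposite.opLinearEquiv k).toLinearMap.restrict
    fun x hx => mem_opSub.2 hx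
  have hf : Function.Surjective f := fun x => ⟨⟨x.1.unop, mem_opSub.1 x.2⟩, rfl⟩
  refine LeftFree.of_surjective hf ?_
  have h1 (X) : (freeLift (B := Sᵐᵒᵖ) ((opSub P).subtype ∘ₗ f) X).unop =
      (LinearMap.mul' k S ∘ₗ LinearMap.rTensor S P.subtype) (e X) := by
    induction X with
    | zero => simp
    | tmul s p => rfl
    | add x y hx hy => simp only [map_add, MulOpposite.unop_add, hx, hy]
  intro X Y hXY
  apply e.injective
  apply h
  rw [← h1, ← h1, hXY]

theorem rightFree_opSub {P : Submodule k S} (h : LeftFree P) : RightFree (opSub P) := by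
  let f : P ≃ₗ[k] opSub P := Submodule.equivMapOfInjective _ (LinearEquiv.injective _) P
  let e : P ⊗[k] Sᵐᵒᵖ ≃ₗ[k] S ⊗[k] P :=
    (TensorProduct.congr (LinearEquiv.refl k P) (MulOpposite.opLinearEquiv k).symm).trans
      (TensorProduct.comm k P S)
  let f' : P ⊗[k] Sᵐᵒᵖ ≃ₗ[k] opSub P ⊗[k] Sᵐᵒᵖ := TensorProduct.congr f (LinearEquiv.refl k _)
  have h1 (X) : ((LinearMap.mul' k Sᵐᵒᵖ ∘ₗ LinearMap.rTensor Sᵐᵒᵖ (opSub P).subtype) (f' X)).unop =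
      freeLift (B := S) P.subtype (e X) := by
    induction X with
    | zero => simp
    | tmul p s => rfl
    | add x y hx hy => simp only [map_add, MulOpposite.unop_add, hx, hy]
  intro X Y hXY
  obtain ⟨X, rfl⟩ := f'.surjective X
  obtain ⟨Y, rfl⟩ := f'.surjective Y
  congr 1
  apply e.injective
  apply h
  rw [← h1, ← h1, hXY]

/-- A presentation `π : S → B` of an augmented algebra `B`, where `S` is freely generated by `G`
and the kernel of `π` contains a minimal space of relations `R`. -/
structure IsFreePresentation (π : S →ₐ[k] B) (ε : B →ₐ[k] k) (G R : Submodule k S) : Prop where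
  surjective : Function.Surjective π
  leftFree : LeftFree G
  rightFree : RightFree G
  iSup_pow : ⨆ n : ℕ, G ^ n = ⊤
  gen_le : G ≤ LinearMap.ker (ε.comp π).toLinearMap
  rel_le : R ≤ LinearMap.ker π.toLinearMap
  rel_disjoint : Disjoint R
    (LinearMap.ker (ε.comp π).toLinearMap * LinearMap.ker π.toLinearMap ⊔
      LinearMap.ker π.toLinearMap * LinearMap.ker (ε.comp π).toLinearMap)
  exists_linear : ∃ τ : B →ₗ[k] S, (∀ g ∈ G, τ (π g) = g) ∧
    ∀ b c, ε b = 0 → ε c = 0 → τ (b * c) = 0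

/-- Properties of the family of subspaces `J_n` that are used for its one-sided complexes. -/
structure IsKoszulFamily (G R : Submodule k S) (J : ℕ → Submodule k S) : Prop where
  zero : J 0 = 1
  even_le : ∀ m, J (2 * m) ≤ R ^ m
  odd_left : ∀ m, J (2 * m + 1) ≤ G * J (2 * m)
  odd_right : ∀ m, J (2 * m + 1) ≤ J (2 * m) * G
  even_left : ∀ m, J (2 * m + 2) ≤ ⊤ * J (2 * m + 1)
  even_right : ∀ m, J (2 * m + 2) ≤ J (2 * m + 1) * ⊤

variable {π : S →ₐ[k] B} {ε : B →ₐ[k] k} {G R : Submodule k S} {J : ℕ → Submodule k S}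

theorem IsFreePresentation.op (h : IsFreePresentation π ε G R) :
    IsFreePresentation (AlgHom.op π) (opAug ε) (opSub G) (opSub R) where
  surjective b := by
    obtain ⟨s, hs⟩ := h.surjective b.unop
    exact ⟨MulOpposite.op s, by simp [hs]⟩
  leftFree := leftFree_opSub h.rightFree
  rightFree := rightFree_opSub h.leftFree
  iSup_pow := by
    simp_rw [← opSub_pow]
    simp only [opSub]
    rw [← Submodule.map_iSup, h.iSup_pow]
    exact opSub_top
  gen_le := by
    rw [ker_opAug_comp]
    exact opSub_mono h.gen_le
  rel_le := by
    rw [ker_op]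
    exact opSub_mono h.rel_le
  rel_disjoint := by
    rw [ker_opAug_comp, ker_op, ← opSub_mul, ← opSub_mul, ← opSub_sup, sup_comm]
    exact disjoint_opSub h.rel_disjoint
  exists_linear := by
    obtain ⟨τ, h1, h2⟩ := h.exists_linear
    refine ⟨(MulOpposite.opLinearEquiv k).toLinearMap ∘ₗ τ ∘ₗ
      (MulOpposite.opLinearEquiv k).symm.toLinearMap, fun g hg => ?_, fun b c hb hc => ?_⟩
    · exact MulOpposite.unop_injective (h1 _ (mem_opSub.1 hg))
    · exact MulOpposite.unop_injective (h2 _ _ hc hb)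

theorem IsKoszulFamily.op (h : IsKoszulFamily G R J) :
    IsKoszulFamily (opSub G) (opSub R) fun n => opSub (J n) where
  zero := by simp only [h.zero, opSub_one]
  even_le m := by rw [← opSub_pow]; exact opSub_mono (h.even_le m)
  odd_left m := by rw [← opSub_mul]; exact opSub_mono (h.odd_right m)
  odd_right m := by rw [← opSub_mul]; exact opSub_mono (h.odd_left m)
  even_left m := by rw [← opSub_top, ← opSub_mul]; exact opSub_mono (h.even_right m)
  even_right m := by rw [← opSub_top, ← opSub_mul]; exact opSub_mono (h.even_left m)

namespace IsFreePresentation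

variable (h : IsFreePresentation π ε G R)
include h

omit h in
theorem _root_.MultiKoszul.ker_comp_mul_top (f : S →ₐ[k] B) :
    LinearMap.ker f.toLinearMap * ⊤ ≤ LinearMap.ker f.toLinearMap := by
  rw [Submodule.mul_le]
  intro a ha b _
  have : f a = 0 := ha
  change f (a * b) = 0
  rw [map_mul, this, zero_mul]

/-- Any relation between left multiples of `R` would put an element of `R` into `G S R`, which is
contained in `S₊ ker π`, and minimality excludes this. -/
theorem rel_leftFree : LeftFree R := by
  refine leftFree_of_disjoint h.rightFree h.iSup_pow (h.rel_disjoint.mono_right ?_)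
  refine le_trans (mul_le_mul' ?_ h.rel_le) le_sup_left
  exact (mul_le_mul_left h.gen_le _).trans (ker_comp_mul_top _)

/-- The map `τ ∘ π` is the identity on `G` but kills both `R` and products of two elements of
augmentation zero. -/
theorem gen_disjoint :
    Disjoint G (R ⊔ LinearMap.ker (ε.comp π).toLinearMap * G) := by
  obtain ⟨τ, h1, h2⟩ := h.exists_linear
  rw [Submodule.disjoint_def]
  intro g hg hg'
  rw [← h1 g hg]
  have : R ⊔ LinearMap.ker (ε.comp π).toLinearMap * G ≤
      LinearMap.ker (τ ∘ₗ π.toLinearMap) := by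
    refine sup_le (fun r hr => ?_) (Submodule.mul_le.2 fun s hs g hg => ?_)
    · have h3 : π r = 0 := h.rel_le hr
      simp [h3]
    · have h3 : ε (π s) = 0 := hs
      have h4 : ε (π g) = 0 := h.gen_le hg
      simp [h2 _ _ h3 h4]
  exact this hg'

variable (hJ : IsKoszulFamily G R J)
include hJ

/-- `J_{2m}` sits in `R ^ m` and `J_{2m+1}` in `G R ^ m`. Freeness passes to products and to
subspaces. -/
theorem leftFree_J (n : ℕ) : LeftFree (J n) := by
  rcases Nat.even_or_odd' n with ⟨m, rfl | rfl⟩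
  · exact (h.rel_leftFree.pow m).mono (hJ.even_le m)
  · exact (h.leftFree.mul (h.rel_leftFree.pow m)).mono
      ((hJ.odd_left m).trans (mul_le_mul_right (hJ.even_le m) G))

/-- Two applications of the factorization properties give `J_{n+2} ⊆ S J_n`, while the bound by
powers of `R` gives `J_{n+2} ⊆ R Q`, for a free subspace `Q ⊇ J_n`: either `R ^ m` or `R ^ m G`.
Then `LeftFree.mem_mul` combines the two. -/
theorem J_add_two_le (n : ℕ) : J (n + 2) ≤ R * J n := by
  rcases Nat.even_or_odd' n with ⟨m, rfl | rfl⟩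
  · intro x hx
    refine (h.rel_leftFree.pow m).mem_mul (D := ⊤) (hJ.even_le m) ?_ ?_
    · have h1 := (hJ.even_left m).trans (mul_le_mul_right (hJ.odd_left m) ⊤) hx
      rw [← mul_assoc] at h1
      exact Submodule.mul_le.2 (fun a _ b hb => Submodule.mul_mem_mul Submodule.mem_top hb) h1
    · rw [← pow_succ']
      exact hJ.even_le (m + 1) hx
  · intro x hx
    have hx' : x ∈ J (2 * (m + 1) + 1) := hx
    refine ((h.rel_leftFree.pow m).mul h.leftFree).mem_mul (D := ⊤)
      ((hJ.odd_right m).trans (mul_le_mul_left (hJ.even_le m) G)) ?_ ?_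
    · have h1 := (hJ.odd_left (m + 1)).trans (mul_le_mul_right (hJ.even_left m) G) hx'
      rw [← mul_assoc] at h1
      exact Submodule.mul_le.2 (fun a _ b hb => Submodule.mul_mem_mul Submodule.mem_top hb) h1
    · rw [← mul_assoc, ← pow_succ']
      exact (hJ.odd_right (m + 1)).trans (mul_le_mul_left (hJ.even_le (m + 1)) G) hx'

/-- This is what makes the complex minimal. For odd `n` the inclusion in `S J_n` leaves a possible
component `w` in `J_n` itself, which has to be excluded. -/
theorem J_succ_le (n : ℕ) :
    J (n + 1) ≤ LinearMap.ker (ε.comp π).toLinearMap * J n := by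
  rcases Nat.even_or_odd' n with ⟨m, rfl | rfl⟩
  · exact (hJ.odd_left m).trans (mul_le_mul_left h.gen_le _)
  · intro x hx
    have htop : (⊤ : Submodule k S) ≤ 1 ⊔ LinearMap.ker (ε.comp π).toLinearMap := by
      intro s _
      refine Submodule.mem_sup.2 ⟨algebraMap k S (ε (π s)), Submodule.algebraMap_mem _,
        s - algebraMap k S (ε (π s)), ?_, by abel⟩
      change ε (π _) = 0
      simp
    have h1 := (hJ.even_left m).trans (mul_le_mul_left htop _) hx
    rw [Submodule.sup_mul, one_mul] at h1
    obtain ⟨w, hw, y, hy, hwy⟩ := Submodule.mem_sup.1 h1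
    -- On one side `w` lies in `G J_{2m}`. On the other side, as a difference, it lies in `(R + S₊
    -- G) J_{2m}`, and `G` meets `R + S₊ G` trivially.
    have hw0 : w = 0 := by
      have h2 := h.leftFree_J hJ (2 * m)
      rw [LeftFree] at h2
      refine eq_zero_of_mem_mul_of_disjoint (j := (J (2 * m)).subtype) h.gen_disjoint h2 ?_ ?_
      · rw [Submodule.range_subtype]
        exact hJ.odd_left m hw
      · rw [Submodule.range_subtype, eq_sub_of_add_eq hwy, Submodule.sup_mul]
        refine sub_mem (Submodule.mem_sup_left (h.J_add_two_le hJ (2 * m) hx))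
          (Submodule.mem_sup_right ?_)
        rw [mul_assoc]
        exact mul_le_mul_right (hJ.odd_left m) _ hy
    rwa [← hwy, hw0, zero_add]

theorem isKoszulSystem [Nontrivial S] {U : ℕ → Type*} [∀ n, AddCommGroup (U n)]
    [∀ n, Module k (U n)] (j : ∀ n, U n →ₗ[k] S) (hj : ∀ n, Function.Injective (j n))
    (hjJ : ∀ n, LinearMap.range (j n) = J n) : IsKoszulSystem π ε G R j where
  surjective := h.surjective
  injective n := LeftFree.injective (by rw [hjJ]; exact h.leftFree_J hJ n) (hj n)
  bijective := by
    have h1 : LinearMap.range (j 0) = 1 := by rw [hjJ, hJ.zero]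
    constructor
    · intro u v huv
      obtain ⟨c, hc⟩ := Submodule.mem_one.1 (h1.le ⟨u, rfl⟩)
      obtain ⟨d, hd⟩ := Submodule.mem_one.1 (h1.le ⟨v, rfl⟩)
      simp only [← hc, ← hd, AlgHom.commutes, Algebra.algebraMap_self, RingHom.id_apply] at huv
      apply hj 0
      rw [← hc, ← hd, huv]
    · intro c
      obtain ⟨u, hu⟩ : algebraMap k S c ∈ LinearMap.range (j 0) := by
        rw [h1]; exact Submodule.algebraMap_mem c
      exact ⟨u, by simp [hu]⟩
  mem_succ n u := by
    rw [hjJ]; exact h.J_succ_le hJ n (by rw [← hjJ]; exact ⟨u, rfl⟩)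
  mem_two n u := by
    rw [hjJ]; exact h.J_add_two_le hJ n (by rw [← hjJ]; exact ⟨u, rfl⟩)
  mem_odd n u hn := by
    obtain ⟨m, rfl⟩ := even_iff_exists_two_mul.1 hn
    rw [hjJ]; exact hJ.odd_left m (by rw [← hjJ]; exact ⟨u, rfl⟩)
  rel_le := h.rel_le
  rel_disjoint := h.rel_disjoint
  exists_linear := h.exists_linear

end IsFreePresentation

end Presentations

/-! ### Freeness and length grading of the tensor algebra -/

section TensorAlgebra

variable {k : Type u} [Field k] {V : Type v} [AddCommGroup V] [Module k V]

variable (k V) in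
/-- The multiplication map `V ⊗ T(V) → T(V)`. -/
def genMul : V ⊗[k] TensorAlgebra k V →ₗ[k] TensorAlgebra k V :=
  LinearMap.mul' k _ ∘ₗ LinearMap.rTensor _ (TensorAlgebra.ι k)

/-- The algebra `T(V)` acts on `k ⊕ (V ⊗ T(V))` by `v · y = v ⊗ ψ y`, where `ψ` is the natural map
to `T(V)`. Acting on the vector `(1, 0)` splits the multiplication map. -/
theorem genMul_injective : Function.Injective (genMul k V) := by
  let ψ : k × (V ⊗[k] TensorAlgebra k V) →ₗ[k] TensorAlgebra k V :=
    LinearMap.coprod (Algebra.linearMap k _) (genMul k V)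
  let act : V →ₗ[k] Module.End k (k × (V ⊗[k] TensorAlgebra k V)) :=
    LinearMap.llcomp k _ _ _ (LinearMap.inr k k (V ⊗[k] TensorAlgebra k V)) ∘ₗ
      LinearMap.lcomp k _ ψ ∘ₗ TensorProduct.mk k V (TensorAlgebra k V)
  have hact (v y) : act v y = (0, v ⊗ₜ ψ y) := rfl
  let Ψ : TensorAlgebra k V →ₐ[k] Module.End k (k × (V ⊗[k] TensorAlgebra k V)) :=
    TensorAlgebra.lift k act
  have hΨ (v) : Ψ (TensorAlgebra.ι k v) = act v := TensorAlgebra.lift_ι_apply act v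
  have hψ (t) : ∀ y, ψ (Ψ t y) = t * ψ y := by
    induction t using TensorAlgebra.induction with
    | algebraMap r => intro y; simp [Algebra.smul_def]
    | ι v => intro y; rw [hΨ, hact]; simp [ψ, genMul]
    | mul a b ha hb => intro y; rw [map_mul, Module.End.mul_apply, ha, hb, mul_assoc]
    | add a b ha hb => intro y; rw [map_add, LinearMap.add_apply, map_add, ha, hb, add_mul]
  have hinv (x : V ⊗[k] TensorAlgebra k V) : (Ψ (genMul k V x) (1, 0)).2 = x := by
    induction x with
    | zero => simp
    | tmul v t =>
      have : genMul k V (v ⊗ₜ t) = TensorAlgebra.ι k v * t := by simp [genMul]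
      rw [this, map_mul, Module.End.mul_apply, hΨ, hact, hψ]
      simp [ψ]
    | add x y hx hy => simp only [map_add, LinearMap.add_apply, Prod.snd_add, hx, hy]
  exact Function.LeftInverse.injective (g := fun t => (Ψ t (1, 0)).2) hinv

theorem rightFree_gen : RightFree (gen k V) := by
  rw [RightFree, injective_iff_map_eq_zero]
  intro x hx
  let f : V →ₗ[k] gen k V := (TensorAlgebra.ι k).codRestrict (gen k V) fun v => ⟨v, rfl⟩
  have hf : Function.Surjective f := by
    rintro ⟨_, v, rfl⟩
    exact ⟨v, rfl⟩
  obtain ⟨y, rfl⟩ := LinearMap.rTensor_surjective (TensorAlgebra k V) hf x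
  rw [LinearMap.comp_apply, ← LinearMap.comp_apply (LinearMap.rTensor _ _),
    ← LinearMap.rTensor_comp] at hx
  have h1 : genMul k V y = 0 := hx
  rw [genMul_injective (h1.trans (map_zero _).symm), map_zero]

variable (k V) in
/-- The anti-automorphism of `T(V)` that fixes `V`. -/
def tensorReverse : TensorAlgebra k V →ₐ[k] (TensorAlgebra k V)ᵐᵒᵖ :=
  TensorAlgebra.lift k ((MulOpposite.opLinearEquiv k).toLinearMap ∘ₗ TensorAlgebra.ι k)

theorem tensorReverse_ι (v : V) :
    tensorReverse k V (TensorAlgebra.ι k v) = MulOpposite.op (TensorAlgebra.ι k v) :=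
  TensorAlgebra.lift_ι_apply _ v

theorem tensorReverse_tensorReverse (t : TensorAlgebra k V) :
    tensorReverse k V (tensorReverse k V t).unop = MulOpposite.op t := by
  induction t using TensorAlgebra.induction with
  | algebraMap r => simp
  | ι v => simp [tensorReverse_ι]
  | mul a b ha hb => simp only [map_mul, MulOpposite.unop_mul, ha, hb, MulOpposite.op_mul]
  | add a b ha hb => simp only [map_add, MulOpposite.unop_add, ha, hb, MulOpposite.op_add]

/-- The mirror image of `rightFree_gen` under the anti-automorphism that reverses words. -/
theorem leftFree_gen : LeftFree (gen k V) := by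
  let ρ : TensorAlgebra k V →ₗ[k] TensorAlgebra k V :=
    (MulOpposite.opLinearEquiv k).symm.toLinearMap ∘ₗ (tensorReverse k V).toLinearMap
  have hρρ : ρ ∘ₗ ρ = LinearMap.id :=
    LinearMap.ext fun t => congrArg MulOpposite.unop (tensorReverse_tensorReverse t)
  let e : TensorAlgebra k V ⊗[k] gen k V →ₗ[k] gen k V ⊗[k] TensorAlgebra k V :=
    (TensorProduct.comm k (TensorAlgebra k V) (gen k V)).toLinearMap ∘ₗ
      LinearMap.rTensor (gen k V) ρ
  have he : Function.Injective e := by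
    refine (TensorProduct.comm k (TensorAlgebra k V) (gen k V)).injective.comp ?_
    refine Function.LeftInverse.injective (g := LinearMap.rTensor (gen k V) ρ) fun x => ?_
    rw [← LinearMap.rTensor_comp_apply, hρρ, LinearMap.rTensor_id, LinearMap.id_apply]
  have h1 (X) : (LinearMap.mul' k (TensorAlgebra k V) ∘ₗ
      LinearMap.rTensor (TensorAlgebra k V) (gen k V).subtype) (e X) =
      ρ (freeLift (B := TensorAlgebra k V) (gen k V).subtype X) := by
    induction X with
    | zero => simp
    | tmul t g =>
      obtain ⟨_, v, rfl⟩ := g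
      simp [e, ρ, tensorReverse_ι]
    | add x y hx hy => simp only [map_add, hx, hy]
  intro X Y hXY
  apply he
  apply rightFree_gen
  rw [h1, h1, hXY]

instance genGradedAlgebra : GradedAlgebra fun n : ℕ => gen k V ^ n :=
  TensorAlgebra.gradedAlgebra

theorem iSup_gen_pow : ⨆ n : ℕ, gen k V ^ n = ⊤ :=
  (DirectSum.Decomposition.isInternal (fun n : ℕ => gen k V ^ n)).submodule_iSup_eq_top

theorem tensorGE_le {m : ℕ} {P : Submodule k (TensorAlgebra k V)}
    (h : ∀ n, m ≤ n → gen k V ^ n ≤ P) : tensorGE k V m ≤ P :=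
  iSup_le fun n => h _ (Nat.le_add_right m n)

theorem gen_pow_le_tensorGE {m n : ℕ} (h : m ≤ n) : gen k V ^ n ≤ tensorGE k V m := by
  obtain ⟨l, rfl⟩ := Nat.exists_eq_add_of_le h
  exact le_iSup (fun N => gen k V ^ (m + N)) l

theorem tensorGE_zero : tensorGE k V 0 = ⊤ := by
  rw [tensorGE]
  simp only [zero_add, iSup_gen_pow]

theorem tensorGE_mul (m n : ℕ) : tensorGE k V m * tensorGE k V n ≤ tensorGE k V (m + n) := by
  simp only [tensorGE, Submodule.iSup_mul, Submodule.mul_iSup]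
  refine iSup_le fun a => iSup_le fun b => ?_
  rw [← pow_add]
  exact gen_pow_le_tensorGE (by omega)

theorem ker_algebraMapInv_le :
    LinearMap.ker (TensorAlgebra.algebraMapInv (R := k) (M := V)).toLinearMap ≤
      tensorGE k V 1 := by
  intro t ht
  have ht : TensorAlgebra.algebraMapInv t = 0 := ht
  have h1 : tensorGE k V 1 ≤
      LinearMap.ker (TensorAlgebra.algebraMapInv (R := k) (M := V)).toLinearMap := by
    refine tensorGE_le fun n hn => ?_
    obtain ⟨n, rfl⟩ := Nat.exists_eq_add_of_le' hn
    rw [pow_succ, Submodule.mul_le]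
    rintro a _ _ ⟨v, rfl⟩
    simp [TensorAlgebra.algebraMapInv]
  have h2 : (⊤ : Submodule k (TensorAlgebra k V)) ≤ 1 ⊔ tensorGE k V 1 := by
    rw [← iSup_gen_pow]
    refine iSup_le fun n => ?_
    cases n with
    | zero => rw [pow_zero]; exact le_sup_left
    | succ n => exact (gen_pow_le_tensorGE (by omega)).trans le_sup_right
  obtain ⟨c, hc, s, hs, rfl⟩ := Submodule.mem_sup.1 (h2 (Submodule.mem_top (x := t)))
  obtain ⟨c, rfl⟩ := Submodule.mem_one.1 hc
  have h3 : TensorAlgebra.algebraMapInv s = 0 := h1 hs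
  rw [map_add, h3, add_zero, AlgHom.commutes] at ht
  have hc0 : c = 0 := ht
  rwa [hc0, map_zero, zero_add]

theorem mem_span_twoSidedIdeal_le {S : Type*} [Ring S] [Algebra k S] {R : Submodule k S} {x : S}
    (hx : x ∈ TwoSidedIdeal.span (R : Set S)) : x ∈ ⊤ * R * ⊤ := by
  induction hx using TwoSidedIdeal.span_induction with
  | mem x h =>
    have := Submodule.mul_mem_mul (Submodule.mul_mem_mul (Submodule.mem_top (x := (1 : S))) h)
      (Submodule.mem_top (x := (1 : S)))
    rwa [one_mul, mul_one] at this
  | zero => exact zero_mem _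
  | add x y _ _ hx hy => exact add_mem hx hy
  | neg x _ hx => exact neg_mem hx
  | left_absorb a x _ hx =>
    have h1 : a * x ∈ ⊤ * (⊤ * R * ⊤) := Submodule.mul_mem_mul Submodule.mem_top hx
    rw [← mul_assoc, ← mul_assoc] at h1
    have h2 : ⊤ * ⊤ * R * ⊤ ≤ ⊤ * R * ⊤ := mul_le_mul_left (mul_le_mul_left le_top R) ⊤
    exact h2 h1
  | right_absorb b x _ hx =>
    have h1 : x * b ∈ (⊤ * R * ⊤) * ⊤ := Submodule.mul_mem_mul hx Submodule.mem_top
    rw [mul_assoc] at h1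
    have h2 : ⊤ * R * (⊤ * ⊤) ≤ ⊤ * R * ⊤ := mul_le_mul_right le_top (⊤ * R)
    exact h2 h1

end TensorAlgebra

/-! ### The augmentation of a connected graded algebra -/

section Augmentation

variable {k : Type u} [Field k] {A : Type w} [Ring A] [Algebra k A]
  {𝒜 : ℕ → Submodule k A} [GradedAlgebra 𝒜]

theorem algebraMap_augmentation (h : IsConnectedGraded 𝒜) (a : A) :
    algebraMap k A (augmentation 𝒜 a) = GradedAlgebra.proj 𝒜 0 a := by
  have := h.1
  have h1 : GradedAlgebra.proj 𝒜 0 a ∈ (1 : Submodule k A) := by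
    rw [← h.2, GradedAlgebra.proj_apply]
    exact SetLike.coe_mem _
  obtain ⟨c, hc⟩ := Submodule.mem_one.1 h1
  rw [← hc, augmentation, LinearMap.comp_apply, ← hc]
  congr 1
  exact LinearMap.leftInverse_apply_of_inj (f := Algebra.linearMap k A)
    (LinearMap.ker_eq_bot.2 (algebraMap k A).injective) c

variable (𝒜) in
/-- The augmentation of a connected graded algebra, as a homomorphism of algebras. -/
def augHom (h : IsConnectedGraded 𝒜) : A →ₐ[k] k :=
  haveI := h.1
  AlgHom.ofLinearMap (augmentation 𝒜)
    ((algebraMap k A).injective (by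
      rw [algebraMap_augmentation h, map_one (algebraMap k A)]
      exact map_one (GradedRing.projZeroRingHom 𝒜)))
    (fun a b => (algebraMap k A).injective (by
      rw [map_mul (algebraMap k A), algebraMap_augmentation h, algebraMap_augmentation h,
        algebraMap_augmentation h]
      exact map_mul (GradedRing.projZeroRingHom 𝒜) a b))

theorem augHom_apply (h : IsConnectedGraded 𝒜) (a : A) : augHom 𝒜 h a = augmentation 𝒜 a := rfl

theorem augHom_eq_zero_iff (h : IsConnectedGraded 𝒜) (a : A) :
    augHom 𝒜 h a = 0 ↔ GradedAlgebra.proj 𝒜 0 a = 0 := by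
  have := h.1
  rw [← algebraMap_augmentation h, ← augHom_apply h, map_eq_zero_iff _ (algebraMap k A).injective]

end Augmentation

/-! ### Minimal presentations as free presentations -/

section Presentation

variable {k : Type u} [Field k] {V : Type v} [AddCommGroup V] [Module k V]
  {𝒱 : ℕ → Submodule k V} [DirectSum.Decomposition 𝒱]
  {A : Type w} [Ring A] [Algebra k A] {𝒜 : ℕ → Submodule k A} [GradedAlgebra 𝒜]
  {π : TensorAlgebra k V →ₐ[k] A} {R : Submodule k (TensorAlgebra k V)}

namespace IsMinimalPresentation

variable (hp : IsMinimalPresentation 𝒱 𝒜 π R)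
include hp

/-- Generators have positive degree and `π` preserves degrees, so both augmentations vanish on `V`.
-/
theorem augHom_comp (h : IsConnectedGraded 𝒜) :
    (augHom 𝒜 h).comp π = TensorAlgebra.algebraMapInv := by
  ext v
  induction v using DirectSum.Decomposition.inductionOn 𝒱 with
  | zero => simp
  | homogeneous v =>
    rename_i i
    simp only [LinearMap.comp_apply, AlgHom.toLinearMap_apply, AlgHom.comp_apply]
    have h1 : TensorAlgebra.algebraMapInv (TensorAlgebra.ι k (v : V)) = (0 : k) := by
      simp [TensorAlgebra.algebraMapInv]
    rw [h1, augHom_eq_zero_iff, GradedAlgebra.proj_apply]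
    by_cases hi : i = 0
    · subst hi
      have h2 : (v : V) = 0 := (Submodule.mem_bot k).1 (hp.positive.le v.2)
      simp [h2]
    · exact DirectSum.decompose_of_mem_ne 𝒜 (hp.map_mem i v v.2) hi
  | add v w hv hw => rw [map_add, map_add, hv, hw]

theorem ker_le_ideal : LinearMap.ker π.toLinearMap ≤ ⊤ * R * ⊤ := by
  intro x hx
  apply mem_span_twoSidedIdeal_le
  rw [← hp.ker_eq]
  exact (TwoSidedIdeal.mem_ker π).2 hx

theorem ker_le_tensorGE : LinearMap.ker π.toLinearMap ≤ tensorGE k V 2 := by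
  refine hp.ker_le_ideal.trans ?_
  rw [← tensorGE_zero]
  exact (mul_le_mul_left ((mul_le_mul_right hp.le_two _).trans (tensorGE_mul 0 2)) _).trans
    (tensorGE_mul 2 0)

theorem isFreePresentation (h : IsConnectedGraded 𝒜) :
    IsFreePresentation π (augHom 𝒜 h) (gen k V) R where
  surjective := hp.surjective
  leftFree := leftFree_gen
  rightFree := rightFree_gen
  iSup_pow := iSup_gen_pow
  gen_le := by
    rw [hp.augHom_comp h]
    rintro _ ⟨v, rfl⟩
    simp [TensorAlgebra.algebraMapInv]
  rel_le := by
    intro r hr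
    have : r ∈ TwoSidedIdeal.ker π := by
      rw [hp.ker_eq]
      exact TwoSidedIdeal.subset_span hr
    exact (TwoSidedIdeal.mem_ker π).1 this
  rel_disjoint := by
    rw [disjoint_iff, eq_bot_iff, ← hp.minimal, hp.augHom_comp h]
    have h1 := ker_algebraMapInv_le (k := k) (V := V)
    refine inf_le_inf le_rfl (sup_le_sup ?_ ?_)
    · refine (mul_le_mul' h1 hp.ker_le_ideal).trans ?_
      rw [← mul_assoc, ← mul_assoc]
      refine mul_le_mul_left (mul_le_mul_left ?_ _) _
      rw [← tensorGE_zero]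
      exact tensorGE_mul 1 0
    · refine (mul_le_mul' hp.ker_le_ideal h1).trans ?_
      rw [mul_assoc]
      refine mul_le_mul_right ?_ _
      rw [← tensorGE_zero]
      exact tensorGE_mul 0 1
  -- A linear section `σ` of `π` followed by the projection `p` to tensor length one. Since `ker π`
  -- has length at least two, `p σ π = p`, so the choice of section is immaterial, and products of
  -- two augmentation-zero elements also have length at least two.
  exists_linear := by
    obtain ⟨σ, hσ⟩ := π.toLinearMap.exists_rightInverse_of_surjective
      (LinearMap.range_eq_top.2 hp.surjective)
    let p := GradedAlgebra.proj (fun n : ℕ => gen k V ^ n) 1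
    have hp2 : ∀ t ∈ tensorGE k V 2, p t = 0 := by
      intro t ht
      have : tensorGE k V 2 ≤ LinearMap.ker p := tensorGE_le fun n hn s hs =>
        DirectSum.decompose_of_mem_ne (fun n : ℕ => gen k V ^ n) hs (by omega)
      exact this ht
    have hτ (t) : p (σ (π t)) = p t := by
      rw [← sub_eq_zero, ← map_sub]
      apply hp2
      apply hp.ker_le_tensorGE
      have : π (σ (π t)) = π t := LinearMap.congr_fun hσ (π t)
      rw [LinearMap.mem_ker, map_sub, sub_eq_zero]
      exact this
    refine ⟨p ∘ₗ σ, fun g hg => ?_, fun b c hb hc => ?_⟩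
    · rw [LinearMap.comp_apply, hτ]
      exact DirectSum.decompose_of_mem_same (fun n : ℕ => gen k V ^ n) (by simpa using hg)
    · obtain ⟨s, rfl⟩ := hp.surjective b
      obtain ⟨t, rfl⟩ := hp.surjective c
      have h1 := ker_algebraMapInv_le (k := k) (V := V)
      rw [← hp.augHom_comp h] at h1
      rw [← map_mul, LinearMap.comp_apply, hτ]
      exact hp2 _ (tensorGE_mul 1 1 (Submodule.mul_mem_mul (h1 hb) (h1 hc)))

end IsMinimalPresentation
end Presentation

/-! ### Factorization properties of the spaces `J_n` -/

section Family

variable {k : Type u} [Field k] {S : Type*} [Ring S] [Algebra k S]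

theorem LeftFree.mul_inf_le {P Q C : Submodule k S} (hC : LeftFree (opSub C)) :
    C * P ⊓ C * Q ≤ C * (P ⊓ Q) := by
  rintro x ⟨h1, h2⟩
  have h3 : MulOpposite.op x ∈ opSub P * opSub C ⊓ opSub Q * opSub C := by
    rw [← opSub_mul, ← opSub_mul]
    exact ⟨mem_opSub.2 h1, mem_opSub.2 h2⟩
  have h4 := hC.inf_mul_le h3
  have h5 : opSub P ⊓ opSub Q = opSub (P ⊓ Q) := by
    ext y
    simp only [Submodule.mem_inf, mem_opSub]
  rw [h5, ← opSub_mul] at h4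
  exact mem_opSub.1 h4

/-- If `S ⊗ W → S` is injective, the products of the components of a grading of `S` with `W` are
independent. -/
theorem LeftFree.iSupIndep_mul {𝒢 : ℕ → Submodule k S} [DirectSum.Decomposition 𝒢]
    {W : Submodule k S} (hW : LeftFree W) : iSupIndep fun n => 𝒢 n * W := by
  let μ : S ⊗[k] W →ₗ[k] S := (freeLift (B := S) W.subtype).restrictScalars k
  let p (n : ℕ) : S →ₗ[k] S := (𝒢 n).subtype ∘ₗ DirectSum.component k ℕ (fun n => 𝒢 n) n ∘ₗ
    (DirectSum.decomposeLinearEquiv 𝒢).toLinearMap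
  -- The projection of the coefficients onto degree `n`, transported to `S` along the injective
  -- multiplication map.
  let q (n : ℕ) : S →ₗ[k] S := μ ∘ₗ LinearMap.rTensor W (p n) ∘ₗ LinearMap.leftInverse μ
  have hq (n) (X) : q n (μ X) = μ (LinearMap.rTensor W (p n) X) := by
    simp only [q, LinearMap.comp_apply]
    rw [LinearMap.leftInverse_apply_of_inj (f := μ) (LinearMap.ker_eq_bot.2 hW)]
  have hmem {n} {x} (hx : x ∈ 𝒢 n * W) : ∃ X ∈ tensorRange W (𝒢 n), μ X = x := by
    rw [mul_eq_mul_range] at hx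
    exact exists_mem_tensorRange hx
  intro n
  rw [Submodule.disjoint_def]
  intro x hx hx'
  have h1 : q n x = x := by
    obtain ⟨X, hX, rfl⟩ := hmem hx
    rw [hq, rTensor_eq_self (fun s hs => DirectSum.decompose_of_mem_same 𝒢 hs) hX]
  rw [← h1]
  have h2 : ⨆ m, ⨆ (_ : m ≠ n), 𝒢 m * W ≤ LinearMap.ker (q n) := by
    refine iSup_le fun m => iSup_le fun hm y hy => ?_
    obtain ⟨X, hX, rfl⟩ := hmem hy
    rw [LinearMap.mem_ker, hq,
      rTensor_eq_zero (fun s hs => DirectSum.decompose_of_mem_ne 𝒢 hs hm) hX, map_zero]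
  exact h2 hx'

variable {V : Type v} [AddCommGroup V] [Module k V] {R : Submodule k (TensorAlgebra k V)}

theorem J_two_mul (m : ℕ) : J R (2 * m) = evenJ R m := by simp [J]

theorem J_two_mul_add_one (m : ℕ) :
    J R (2 * m + 1) = gen k V * evenJ R m ⊓ evenJ R m * gen k V := by
  have h1 : ¬ Even (2 * m + 1) := by simp
  have h2 : (2 * m + 1) / 2 = m := by omega
  rw [J, if_neg h1, h2]

theorem evenJ_zero : evenJ R 0 = 1 := by rw [evenJ]

theorem evenJ_le_pow (i : ℕ) : evenJ R i ≤ R ^ i := by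
  cases i with
  | zero => rw [evenJ_zero, pow_zero]
  | succ i => rw [evenJ]; exact inf_le_right

/-- The tuples with `n_1 = i` and all other `n_j = 0` give the subspaces `V^{(l)} J_{2i} V^{(N-l)}`.
For `i = 0` there is a single factor `V^{(N)}`, which splits at any place. -/
theorem inter_le (i N l : ℕ) (hl : l ≤ N) :
    (⨅ (n : {n : Fin i → Fin (i + 1) // ∑ j, (n j : ℕ) = i})
        (m : {m : Fin (i + 1) → ℕ // ∑ j, m j = N}),
        (List.ofFn fun j : Fin i => gen k V ^ m.1 j.castSucc * evenJ R (n.1 j)).prod *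
          gen k V ^ m.1 (Fin.last i)) ≤
      gen k V ^ l * evenJ R i * gen k V ^ (N - l) := by
  cases i with
  | zero =>
    let n : {n : Fin 0 → Fin (0 + 1) // ∑ j, (n j : ℕ) = 0} := ⟨fun _ => 0, by simp⟩
    let m : {m : Fin (0 + 1) → ℕ // ∑ j, m j = N} := ⟨fun _ => N, by simp⟩
    refine (iInf_le_of_le n (iInf_le _ m)).trans ?_
    simp only [List.ofFn_zero, List.prod_nil, one_mul, evenJ_zero, mul_one]
    rw [← pow_add, Nat.add_sub_cancel' hl]
  | succ i =>
    let n : {n : Fin (i + 1) → Fin (i + 1 + 1) // ∑ j, (n j : ℕ) = i + 1} :=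
      ⟨(Fin.cons (Fin.last _) fun _ => 0 : Fin (i + 1) → Fin (i + 1 + 1)), by simp [Fin.sum_univ_succ]⟩
    let m : {m : Fin (i + 1 + 1) → ℕ // ∑ j, m j = N} :=
      ⟨(Fin.cons l (Fin.snoc (fun _ => 0) (N - l) : Fin (i + 1) → ℕ) : Fin (i + 1 + 1) → ℕ), by
        rw [Fin.sum_univ_succ]
        simp [Fin.sum_univ_castSucc, Nat.add_sub_cancel' hl]⟩
    refine (iInf_le_of_le n (iInf_le _ m)).trans (le_of_eq ?_)
    rw [List.ofFn_succ, List.prod_cons, List.prod_eq_one, mul_one]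
    · simp only [n, m]
      rw [← Fin.succ_last]
      simp
    · intro x hx
      obtain ⟨j, rfl⟩ := (List.mem_ofFn' _ _).1 hx
      simp only [n, m]
      rw [← Fin.succ_castSucc]
      simp [evenJ_zero]

theorem leftFree_opSub_gen_pow (l : ℕ) : LeftFree (opSub (gen k V ^ l)) := by
  rw [opSub_pow]
  exact (leftFree_opSub rightFree_gen).pow l

/-- Intersecting the conditions for `l` and `l + 1` in total length `N + 1` gives `V^{(l)} (V J_{2i}
∩ J_{2i} V) V^{(N-l)}`, by freeness of the powers of `V` on both sides. The middle factor is
`J_{2i+1}`, and the exponent drops by one. -/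
theorem evenJ_succ_le (i : ℕ) : evenJ R (i + 1) ≤ ⨆ N, interT (J R (2 * i + 1)) N := by
  rw [evenJ]
  refine inf_le_left.trans (iSup_le fun N => ?_)
  obtain ⟨N, hN⟩ := N
  obtain ⟨N, rfl⟩ := Nat.exists_eq_add_of_le' hN
  refine le_iSup_of_le N (le_iInf fun l => ?_)
  obtain ⟨l, hl⟩ := l
  have h1 := inter_le (R := R) i (N + 1) (l + 1) (by omega)
  have h2 := inter_le (R := R) i (N + 1) l (by omega)
  refine (le_inf h1 h2).trans ?_
  have h3 : N + 1 - (l + 1) = N - l := by omega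
  have h4 : N + 1 - l = 1 + (N - l) := by omega
  rw [J_two_mul_add_one, h3, h4, pow_succ, pow_add, pow_one, ← mul_assoc]
  refine ((leftFree_gen.pow _).inf_mul_le).trans (mul_le_mul_left ?_ _)
  rw [mul_assoc, mul_assoc]
  exact (leftFree_opSub_gen_pow l).mul_inf_le

variable (R) in
theorem isKoszulFamily : IsKoszulFamily (gen k V) R (J R) where
  zero := by
    have := J_two_mul (R := R) 0
    rwa [mul_zero, evenJ_zero] at this
  even_le m := by rw [J_two_mul]; exact evenJ_le_pow m
  odd_left m := by rw [J_two_mul_add_one, J_two_mul]; exact inf_le_left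
  odd_right m := by rw [J_two_mul_add_one, J_two_mul]; exact inf_le_right
  even_left m := by
    have h1 : 2 * m + 2 = 2 * (m + 1) := by ring
    rw [h1, J_two_mul]
    refine (evenJ_succ_le m).trans (iSup_le fun N => (iInf_le _ (Fin.last N)).trans ?_)
    simp only [Fin.val_last, Nat.sub_self, pow_zero, mul_one]
    exact mul_le_mul_left le_top _
  even_right m := by
    have h1 : 2 * m + 2 = 2 * (m + 1) := by ring
    rw [h1, J_two_mul]
    refine (evenJ_succ_le m).trans (iSup_le fun N => (iInf_le _ 0).trans ?_)
    simp only [Fin.val_zero, pow_zero, one_mul]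
    exact mul_le_mul_right le_top _

/-- The summand of index `N` lies in `V^{(N)} W`, and these products are independent when `W` is
free. The decomposition used in the even differential is therefore unique. -/
theorem coeLinearMap_interT_injective {W : Submodule k (TensorAlgebra k V)} (hW : LeftFree W) :
    Function.Injective (DirectSum.coeLinearMap (interT W)) := by
  have h1 : iSupIndep (interT W) :=
    (hW.iSupIndep_mul (𝒢 := fun n : ℕ => gen k V ^ n)).mono fun N => by
      refine (iInf_le _ (Fin.last N)).trans ?_
      simp only [Fin.val_last, Nat.sub_self, pow_zero, mul_one]
      exact le_rfl
  exact h1.dfinsupp_lsum_injective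

end Family

/-! ### Reduction of the bimodule differentials on one side -/

section SplitMap

variable {k : Type u} [Field k] {V : Type v} [AddCommGroup V] [Module k V]
  {A : Type w} [Ring A] [Algebra k A] {𝒜 : ℕ → Submodule k A} [GradedAlgebra 𝒜]
  {π : TensorAlgebra k V →ₐ[k] A} {W : Submodule k (TensorAlgebra k V)}

theorem algebraMapInv_gen_pow {m : ℕ} (hm : m ≠ 0) {t : TensorAlgebra k V}
    (ht : t ∈ gen k V ^ m) : TensorAlgebra.algebraMapInv t = 0 := by
  obtain ⟨m, rfl⟩ := Nat.exists_eq_succ_of_ne_zero hm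
  have h : gen k V ^ (m + 1) ≤
      LinearMap.ker (TensorAlgebra.algebraMapInv (R := k) (M := V)).toLinearMap := by
    rw [pow_succ, Submodule.mul_le]
    rintro a _ _ ⟨v, rfl⟩
    simp [TensorAlgebra.algebraMapInv]
  exact h ht

theorem algebraMap_algebraMapInv {t : TensorAlgebra k V} (ht : t ∈ gen k V ^ 0) :
    algebraMap k _ (TensorAlgebra.algebraMapInv t) = t := by
  rw [pow_zero] at ht
  obtain ⟨c, rfl⟩ := Submodule.mem_one.1 ht
  rw [AlgHom.commutes]
  rfl

variable (W) in
/-- The map `V^{(l)} ⊗ W ⊗ V^{(m)} → T(V) ⊗ W` induced by the augmentation of the last factor. -/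
def collapseRight (l m : ℕ) :
    ↥(gen k V ^ l) ⊗[k] (W ⊗[k] ↥(gen k V ^ m)) →ₗ[k] TensorAlgebra k V ⊗[k] W :=
  TensorProduct.map (gen k V ^ l).subtype ((TensorProduct.rid k W).toLinearMap ∘ₗ
    LinearMap.lTensor W (TensorAlgebra.algebraMapInv.toLinearMap ∘ₗ (gen k V ^ m).subtype))

variable (W) in
/-- The map `V^{(l)} ⊗ W ⊗ V^{(m)} → W ⊗ T(V)` induced by the augmentation of the first factor. -/
def collapseLeft (l m : ℕ) :
    ↥(gen k V ^ l) ⊗[k] (W ⊗[k] ↥(gen k V ^ m)) →ₗ[k] W ⊗[k] TensorAlgebra k V :=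
  (TensorProduct.lid k (W ⊗[k] TensorAlgebra k V)).toLinearMap ∘ₗ
    TensorProduct.map (TensorAlgebra.algebraMapInv.toLinearMap ∘ₗ (gen k V ^ l).subtype)
      (LinearMap.lTensor W (gen k V ^ m).subtype)

theorem algebraMapInv_comp_subtype_injective :
    Function.Injective ((TensorAlgebra.algebraMapInv (R := k) (M := V)).toLinearMap ∘ₗ
      (gen k V ^ 0).subtype) := by
  intro x y hxy
  apply Subtype.ext
  rw [← algebraMap_algebraMapInv x.2, ← algebraMap_algebraMapInv y.2]
  exact congrArg (algebraMap k (TensorAlgebra k V)) hxy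

theorem map_injective {M N M' N' : Type*} [AddCommGroup M] [Module k M] [AddCommGroup N]
    [Module k N] [AddCommGroup M'] [Module k M'] [AddCommGroup N'] [Module k N']
    {f : M →ₗ[k] M'} {g : N →ₗ[k] N'} (hf : Function.Injective f) (hg : Function.Injective g) :
    Function.Injective (TensorProduct.map f g) := by
  rw [← LinearMap.lTensor_comp_rTensor]
  exact (Module.Flat.lTensor_preserves_injective_linearMap g hg).comp
    (Module.Flat.rTensor_preserves_injective_linearMap f hf)

theorem collapseRight_injective (l : ℕ) : Function.Injective (collapseRight (k := k) W l 0) := by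
  have h : Function.Injective ((TensorProduct.rid k W).toLinearMap ∘ₗ LinearMap.lTensor W
      ((TensorAlgebra.algebraMapInv (R := k) (M := V)).toLinearMap ∘ₗ (gen k V ^ 0).subtype)) :=
    (TensorProduct.rid k W).injective.comp
      (Module.Flat.lTensor_preserves_injective_linearMap _ algebraMapInv_comp_subtype_injective)
  exact map_injective (M := ↥(gen k V ^ l)) (N := W ⊗[k] ↥(gen k V ^ 0))
    (M' := TensorAlgebra k V) (N' := W) (gen k V ^ l).injective_subtype h

theorem collapseLeft_injective (m : ℕ) : Function.Injective (collapseLeft (k := k) W 0 m) := by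
  have h : Function.Injective (LinearMap.lTensor W (gen k V ^ m).subtype) :=
    Module.Flat.lTensor_preserves_injective_linearMap _ (gen k V ^ m).injective_subtype
  exact (TensorProduct.lid k (W ⊗[k] TensorAlgebra k V)).injective.comp
    (map_injective (M := ↥(gen k V ^ 0)) (N := W ⊗[k] ↥(gen k V ^ m)) (M' := k)
      (N' := W ⊗[k] TensorAlgebra k V) algebraMapInv_comp_subtype_injective h)

theorem collapseRight_eq_zero (l : ℕ) {m : ℕ} (hm : m ≠ 0) :
    collapseRight (k := k) W l m = 0 := by
  have h : (TensorAlgebra.algebraMapInv (R := k) (M := V)).toLinearMap ∘ₗ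
      (gen k V ^ m).subtype = 0 :=
    LinearMap.ext fun t => algebraMapInv_gen_pow hm t.2
  rw [collapseRight, h, LinearMap.lTensor_zero, LinearMap.comp_zero, TensorProduct.map_zero_right]

theorem collapseLeft_eq_zero {l : ℕ} (hl : l ≠ 0) (m : ℕ) :
    collapseLeft (k := k) W l m = 0 := by
  have h : (TensorAlgebra.algebraMapInv (R := k) (M := V)).toLinearMap ∘ₗ
      (gen k V ^ l).subtype = 0 :=
    LinearMap.ext fun t => algebraMapInv_gen_pow hl t.2
  rw [collapseLeft, h, TensorProduct.map_zero_left, LinearMap.comp_zero]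

/-- The multiplication map `W ⊗ S → S` of a subspace `W` of an algebra `S`. -/
def mulRight {S : Type*} [Ring S] [Algebra k S] (W : Submodule k S) : W ⊗[k] S →ₗ[k] S :=
  LinearMap.mul' k S ∘ₗ LinearMap.rTensor S W.subtype

theorem mul3_tmul {P Q S : Submodule k (TensorAlgebra k V)} (p : P) (q : Q) (s : S) :
    mul3 P Q S (p ⊗ₜ (q ⊗ₜ s)) = p * (q * s : TensorAlgebra k V) := rfl

theorem tensor3_induction {P Q S : Type*} [AddCommGroup P] [Module k P] [AddCommGroup Q]
    [Module k Q] [AddCommGroup S] [Module k S] {p : P ⊗[k] (Q ⊗[k] S) → Prop}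
    (Z : P ⊗[k] (Q ⊗[k] S)) (h0 : p 0) (ht : ∀ x y z, p (x ⊗ₜ (y ⊗ₜ z)))
    (ha : ∀ x y, p x → p y → p (x + y)) : p Z := by
  induction Z with
  | zero => exact h0
  | tmul x Y =>
    induction Y with
    | zero => rwa [TensorProduct.tmul_zero]
    | tmul y z => exact ht x y z
    | add y z hy hz => rw [TensorProduct.tmul_add]; exact ha _ _ hy hz
  | add x y hx hy => exact ha _ _ hx hy

theorem freeLift_collapseRight (l : ℕ) (Z) :
    freeLift (B := TensorAlgebra k V) W.subtype (collapseRight W l 0 Z) =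
      mul3 (gen k V ^ l) W (gen k V ^ 0) Z := by
  induction Z using tensor3_induction with
  | h0 => simp only [map_zero]
  | ht x y z =>
    rw [mul3_tmul, ← algebraMap_algebraMapInv z.2, ← Algebra.commutes, ← Algebra.smul_def]
    simp [collapseRight]
  | ha x y hx hy => simp only [map_add, hx, hy]

theorem mulRight_collapseLeft (m : ℕ) (Z) :
    mulRight W (collapseLeft W 0 m Z) = mul3 (gen k V ^ 0) W (gen k V ^ m) Z := by
  induction Z using tensor3_induction with
  | h0 => simp only [map_zero]
  | ht x y z =>
    rw [mul3_tmul, ← algebraMap_algebraMapInv x.2, ← Algebra.smul_def]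
    simp [collapseLeft, mulRight]
  | ha x y hx hy => simp only [map_add, hx, hy]

section TensorOneSide

variable (hπ : ∀ t, augmentation 𝒜 (π t) = TensorAlgebra.algebraMapInv t)
include hπ

theorem tensorRight_map (l m : ℕ) (Z) :
    tensorRight 𝒜 W (TensorProduct.map (π.toLinearMap ∘ₗ (gen k V ^ l).subtype)
      (TensorProduct.map LinearMap.id (π.toLinearMap ∘ₗ (gen k V ^ m).subtype)) Z) =
        LinearMap.rTensor W π.toLinearMap (collapseRight W l m Z) := by
  induction Z using tensor3_induction with
  | h0 => simp only [map_zero]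
  | ht x y z => simp [tensorRight, collapseRight, hπ]
  | ha x y hx hy => simp only [map_add, hx, hy]

theorem tensorLeft_map (l m : ℕ) (Z) :
    tensorLeft 𝒜 W (TensorProduct.map (π.toLinearMap ∘ₗ (gen k V ^ l).subtype)
      (TensorProduct.map LinearMap.id (π.toLinearMap ∘ₗ (gen k V ^ m).subtype)) Z) =
        LinearMap.lTensor W π.toLinearMap (collapseLeft W l m Z) := by
  induction Z using tensor3_induction with
  | h0 => simp only [map_zero]
  | ht x y z => simp [tensorLeft, collapseLeft, hπ]
  | ha x y hx hy => simp only [map_add, hx, hy]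

theorem tensorRight_splitMap_of_ne {l m : ℕ} (hm : m ≠ 0) (x) :
    tensorRight 𝒜 W (splitMap π W l m x) = 0 := by
  rw [splitMap, LinearMap.comp_apply, tensorRight_map hπ, collapseRight_eq_zero l hm,
    LinearMap.zero_apply, map_zero]

theorem tensorLeft_splitMap_of_ne {l m : ℕ} (hl : l ≠ 0) (x) :
    tensorLeft 𝒜 W (splitMap π W l m x) = 0 := by
  rw [splitMap, LinearMap.comp_apply, tensorLeft_map hπ, collapseLeft_eq_zero hl m,
    LinearMap.zero_apply, map_zero]

/-- When the right factor has length zero, the three-fold multiplication is the two-fold one up to a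
scalar, hence injective. The chosen left inverse is then a true inverse on its image. -/
theorem tensorRight_splitMap (hW : LeftFree W) {l : ℕ} {X : TensorAlgebra k V ⊗[k] W}
    (hX : freeLift (B := TensorAlgebra k V) W.subtype X ∈ gen k V ^ l * W) :
    tensorRight 𝒜 W (splitMap π W l 0 (freeLift (B := TensorAlgebra k V) W.subtype X)) =
      LinearMap.rTensor W π.toLinearMap X := by
  obtain ⟨Z, hZ⟩ : ∃ Z, mul3 (gen k V ^ l) W (gen k V ^ 0) Z =
      freeLift (B := TensorAlgebra k V) W.subtype X := by
    refine Submodule.mul_induction_on hX (fun a ha b hb => ?_) ?_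
    · exact ⟨⟨a, ha⟩ ⊗ₜ (⟨b, hb⟩ ⊗ₜ ⟨1, Submodule.one_le.1 (pow_zero (gen k V)).ge⟩), by
        simp [mul3_tmul]⟩
    · rintro _ _ ⟨Z, rfl⟩ ⟨Z', rfl⟩
      exact ⟨Z + Z', map_add _ _ _⟩
  have hinj : Function.Injective (mul3 (gen k V ^ l) W (gen k V ^ 0)) := by
    intro Z Z' h
    rw [← freeLift_collapseRight, ← freeLift_collapseRight] at h
    exact collapseRight_injective l (hW h)
  have h1 : collapseRight W l 0 Z = X := hW (by rw [freeLift_collapseRight, hZ])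
  rw [splitMap, LinearMap.comp_apply, ← hZ,
    LinearMap.leftInverse_apply_of_inj (LinearMap.ker_eq_bot.2 hinj), tensorRight_map hπ, h1]

theorem tensorLeft_splitMap (hW : RightFree W) {m : ℕ} {Y : W ⊗[k] TensorAlgebra k V}
    (hY : mulRight W Y ∈ W * gen k V ^ m) :
    tensorLeft 𝒜 W (splitMap π W 0 m (mulRight W Y)) = LinearMap.lTensor W π.toLinearMap Y := by
  obtain ⟨Z, hZ⟩ : ∃ Z, mul3 (gen k V ^ 0) W (gen k V ^ m) Z = mulRight W Y := by
    refine Submodule.mul_induction_on hY (fun a ha b hb => ?_) ?_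
    · exact ⟨⟨1, Submodule.one_le.1 (pow_zero (gen k V)).ge⟩ ⊗ₜ (⟨a, ha⟩ ⊗ₜ ⟨b, hb⟩), by
        simp [mul3_tmul]⟩
    · rintro _ _ ⟨Z, rfl⟩ ⟨Z', rfl⟩
      exact ⟨Z + Z', map_add _ _ _⟩
  have hinj : Function.Injective (mul3 (gen k V ^ 0) W (gen k V ^ m)) := by
    intro Z Z' h
    rw [← mulRight_collapseLeft, ← mulRight_collapseLeft] at h
    exact collapseLeft_injective m (hW h)
  have h1 : collapseLeft W 0 m Z = Y := hW (by
    rw [← mulRight_collapseLeft] at hZ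
    exact hZ)
  rw [splitMap, LinearMap.comp_apply, ← hZ,
    LinearMap.leftInverse_apply_of_inj (LinearMap.ker_eq_bot.2 hinj), tensorLeft_map hπ, h1]

-- The formal left inverse in `evenMap` is a genuine one because the sum over `N` is direct. A
-- linear identity for `evenMap` can therefore be checked on each summand.
omit hπ in
theorem evenMap_apply_eq {N : Type*} [AddCommMonoid N] [Module k N] (hW : LeftFree W)
    {x : TensorAlgebra k V} (hx : x ∈ ⨆ N, interT W N) (f : A ⊗[k] (W ⊗[k] A) →ₗ[k] N)
    (g : TensorAlgebra k V →ₗ[k] N)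
    (hfg : ∀ M, ∀ y ∈ interT W M, f (∑ l : Fin (M + 1), splitMap π W l (M - l) y) = g y) :
    f (evenMap π W x) = g x := by
  rw [← DirectSum.range_coeLinearMap] at hx
  obtain ⟨Ω, rfl⟩ := hx
  rw [evenMap, LinearMap.comp_apply, LinearMap.leftInverse_apply_of_inj
    (LinearMap.ker_eq_bot.2 (coeLinearMap_interT_injective hW))]
  induction Ω using DirectSum.induction_on with
  | zero => simp only [map_zero]
  | of M y =>
    have h1 := hfg M y y.2
    change f (DirectSum.toModule k ℕ _ _ (DirectSum.lof k ℕ (fun N => interT W N) M y)) =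
      g (DirectSum.coeLinearMap (interT W) (DirectSum.lof k ℕ (fun N => interT W N) M y))
    rw [DirectSum.toModule_lof, DirectSum.coeLinearMap_lof, ← h1, LinearMap.comp_apply,
      LinearMap.sum_apply]
    rfl
  | add x y hx hy => simp only [map_add, hx, hy]

theorem tensorRight_evenMap (hW : LeftFree W) {X : TensorAlgebra k V ⊗[k] W}
    (hX : freeLift (B := TensorAlgebra k V) W.subtype X ∈ ⨆ N, interT W N) :
    tensorRight 𝒜 W (evenMap π W (freeLift (B := TensorAlgebra k V) W.subtype X)) =
      LinearMap.rTensor W π.toLinearMap X := by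
  let μ := (freeLift (B := TensorAlgebra k V) W.subtype).restrictScalars k
  have hμ (X) : LinearMap.leftInverse μ (μ X) = X :=
    LinearMap.leftInverse_apply_of_inj (f := μ) (LinearMap.ker_eq_bot.2 hW) X
  refine (evenMap_apply_eq hW hX (tensorRight 𝒜 W)
    (LinearMap.rTensor W π.toLinearMap ∘ₗ LinearMap.leftInverse μ) fun M y hy => ?_).trans
      (congrArg (LinearMap.rTensor W π.toLinearMap) (hμ X))
  have hyM : y ∈ gen k V ^ M * W := by
    have := (Submodule.mem_iInf _).1 hy (Fin.last M)
    simpa only [Fin.val_last, Nat.sub_self, pow_zero, mul_one] using this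
  obtain ⟨Y, rfl⟩ : ∃ Y, μ Y = y := by
    rw [mul_eq_mul_range] at hyM
    obtain ⟨Y, -, hY⟩ := exists_mem_tensorRange hyM
    exact ⟨Y, hY⟩
  -- Reduction on the right kills every term whose right factor has positive length, so only `l = M`
  -- remains.
  rw [map_sum, Finset.sum_eq_single (Fin.last M)]
  · rw [LinearMap.comp_apply, hμ, Fin.val_last, Nat.sub_self]
    exact tensorRight_splitMap hπ hW hyM
  · intro l _ hl
    refine tensorRight_splitMap_of_ne hπ (fun h => hl (Fin.ext ?_)) _
    rw [Fin.val_last]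
    omega
  · exact fun h => absurd (Finset.mem_univ _) h

theorem tensorLeft_evenMap (hW : LeftFree W) (hW' : RightFree W) {Y : W ⊗[k] TensorAlgebra k V}
    (hY : mulRight W Y ∈ ⨆ N, interT W N) :
    tensorLeft 𝒜 W (evenMap π W (mulRight W Y)) = LinearMap.lTensor W π.toLinearMap Y := by
  have hinj : Function.Injective (mulRight W) := hW'
  have hμ (X : W ⊗[k] TensorAlgebra k V) :
      LinearMap.leftInverse (mulRight W) (mulRight W X) = X :=
    LinearMap.leftInverse_apply_of_inj (LinearMap.ker_eq_bot.2 hinj) X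
  let g : TensorAlgebra k V →ₗ[k] W ⊗[k] A :=
    LinearMap.lTensor W π.toLinearMap ∘ₗ LinearMap.leftInverse
      (V := W ⊗[k] TensorAlgebra k V) (V' := TensorAlgebra k V) (mulRight W)
  have hg : g (mulRight W Y) = LinearMap.lTensor W π.toLinearMap Y :=
    congrArg (LinearMap.lTensor W π.toLinearMap) (hμ Y)
  rw [← hg]
  refine evenMap_apply_eq hW hY (tensorLeft 𝒜 W) g fun M y hy => ?_
  have hyM : y ∈ W * gen k V ^ M := by
    have := (Submodule.mem_iInf _).1 hy 0
    simpa only [Fin.val_zero, Nat.sub_zero, pow_zero, one_mul] using this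
  obtain ⟨Y, rfl⟩ : ∃ Y, mulRight W Y = y := by
    refine Submodule.mul_induction_on hyM (fun a ha b _ => ⟨⟨a, ha⟩ ⊗ₜ b, rfl⟩) ?_
    rintro _ _ ⟨Z, rfl⟩ ⟨Z', rfl⟩
    exact ⟨Z + Z', map_add _ _ _⟩
  -- Reduction on the left kills every term whose left factor has positive length, so only `l = 0`
  -- remains.
  rw [map_sum, Finset.sum_eq_single 0]
  · rw [LinearMap.comp_apply (LinearMap.lTensor W π.toLinearMap), hμ, Fin.val_zero, Nat.sub_zero]
    exact tensorLeft_splitMap hπ hW' hyM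
  · intro l _ hl
    exact tensorLeft_splitMap_of_ne hπ (fun h => hl (Fin.ext h)) _
  · exact fun h => absurd (Finset.mem_univ _) h

end TensorOneSide

end SplitMap

/-! ### The one-sided multi-Koszul complexes as abstract Koszul complexes -/

section Differentials

variable {k : Type u} [Field k] {V : Type v} [AddCommGroup V] [Module k V]
  {𝒱 : ℕ → Submodule k V} [DirectSum.Decomposition 𝒱]
  {A : Type w} [Ring A] [Algebra k A] {𝒜 : ℕ → Submodule k A} [GradedAlgebra 𝒜]
  {π : TensorAlgebra k V →ₐ[k] A} {R : Submodule k (TensorAlgebra k V)}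

theorem leftD_tmul (i : ℕ) (a : A) (u : J R (i + 1)) :
    leftD π R 𝒜 i (a ⊗ₜ u) = tensorRight 𝒜 (J R i) (actL k A _ a (actR k A _ 1
      ((if Even i then oddMap π (J R i) else evenMap π (J R i)) u))) := by
  rw [leftD, LinearMap.comp_apply, LinearMap.comp_apply, TensorProduct.map_tmul,
    LinearMap.id_apply, LinearMap.flip_apply, TensorProduct.mk_apply, bimoduleD,
    bimoduleExtend_tmul, LinearMap.comp_apply, Submodule.subtype_apply]

theorem rightD_tmul (i : ℕ) (u : J R (i + 1)) (a : A) :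
    rightD π R 𝒜 i (u ⊗ₜ a) = tensorLeft 𝒜 (J R i) (actL k A _ 1 (actR k A _ a
      ((if Even i then oddMap π (J R i) else evenMap π (J R i)) u))) := by
  rw [rightD, LinearMap.comp_apply, LinearMap.comp_apply, TensorProduct.mk_apply, bimoduleD,
    bimoduleExtend_tmul, LinearMap.comp_apply, Submodule.subtype_apply]

/-- The inclusions of the subspaces `J_n`. -/
abbrev leftJ (R : Submodule k (TensorAlgebra k V)) (n : ℕ) : J R n →ₗ[k] TensorAlgebra k V :=
  (J R n).subtype

/-- The inclusions of the subspaces `J_n` into the opposite algebra. -/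
abbrev rightJ (R : Submodule k (TensorAlgebra k V)) (n : ℕ) :
    J R n →ₗ[k] (TensorAlgebra k V)ᵐᵒᵖ :=
  (MulOpposite.opLinearEquiv k).toLinearMap ∘ₗ (J R n).subtype

theorem range_rightJ (n : ℕ) : LinearMap.range (rightJ R n) = opSub (J R n) := by
  rw [rightJ, LinearMap.range_comp, Submodule.range_subtype]
  rfl

theorem rightJ_injective (n : ℕ) : Function.Injective (rightJ R n) :=
  (MulOpposite.opLinearEquiv k).injective.comp (J R n).injective_subtype

theorem RightFree.of_op {S : Type*} [Ring S] [Algebra k S] {P : Submodule k S}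
    (h : LeftFree (opSub P)) : RightFree P := by
  let f : P →ₗ[k] opSub P := (MulOpposite.opLinearEquiv k).toLinearMap.restrict
    fun x hx => mem_opSub.2 hx
  have hf : Function.Injective f := fun x y hxy =>
    Subtype.ext (MulOpposite.op_injective (congrArg Subtype.val hxy))
  let e : P ⊗[k] S →ₗ[k] Sᵐᵒᵖ ⊗[k] opSub P :=
    TensorProduct.map (MulOpposite.opLinearEquiv k).toLinearMap f ∘ₗ
      (TensorProduct.comm k P S).toLinearMap
  have he : Function.Injective e :=
    (map_injective (MulOpposite.opLinearEquiv k).injective hf).comp (LinearEquiv.injective _)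
  have h1 (X : P ⊗[k] S) : (LinearMap.mul' k S ∘ₗ LinearMap.rTensor S P.subtype) X =
      (freeLift (B := Sᵐᵒᵖ) (opSub P).subtype (e X)).unop := by
    induction X with
    | zero => simp
    | tmul p s => rfl
    | add x y hx hy => simp only [map_add, MulOpposite.unop_add, hx, hy]
  intro X Y hXY
  rw [h1, h1] at hXY
  exact he (h (MulOpposite.unop_injective hXY))

namespace IsMinimalPresentation

variable (hp : IsMinimalPresentation 𝒱 𝒜 π R) (hA : IsConnectedGraded 𝒜)
include hp hA

theorem isKoszulSystem_leftJ : IsKoszulSystem π (augHom 𝒜 hA) (gen k V) R (leftJ R) :=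
  (hp.isFreePresentation hA).isKoszulSystem (isKoszulFamily R) _
    (fun _ => Submodule.injective_subtype _) fun _ => Submodule.range_subtype _

theorem isKoszulSystem_rightJ : IsKoszulSystem (AlgHom.op π) (opAug (augHom 𝒜 hA))
    (opSub (gen k V)) (opSub R) (rightJ R) :=
  (hp.isFreePresentation hA).op.isKoszulSystem (isKoszulFamily R).op _
    rightJ_injective range_rightJ

theorem leftFree_J (n : ℕ) : LeftFree (J R n) :=
  (hp.isFreePresentation hA).leftFree_J (isKoszulFamily R) n

theorem rightFree_J (n : ℕ) : RightFree (J R n) :=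
  .of_op ((hp.isFreePresentation hA).op.leftFree_J (isKoszulFamily R).op n)

theorem augmentation_apply (t : TensorAlgebra k V) :
    augmentation 𝒜 (π t) = TensorAlgebra.algebraMapInv t :=
  DFunLike.congr_fun (hp.augHom_comp hA) t

/-- In both parities a single term of the bimodule differential survives the reduction on the right,
the one with the whole left factor as coefficient. -/
theorem leftD_apply (i : ℕ) (x : A ⊗[k] J R (i + 1)) :
    leftD π R 𝒜 i x = koszulD π (leftJ R) i x := by
  have hπ := hp.augmentation_apply hA
  have hsys := hp.isKoszulSystem_leftJ hA
  have key (u : J R (i + 1)) :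
      tensorRight 𝒜 (J R i) ((if Even i then oddMap π (J R i) else evenMap π (J R i)) u) =
        LinearMap.rTensor _ π.toLinearMap (koszulSplit (leftJ R) i u) := by
    have hu : freeLift (B := TensorAlgebra k V) (J R i).subtype (koszulSplit (leftJ R) i u) = u :=
      hsys.freeLift_koszulSplit i u
    generalize koszulSplit (leftJ R) i u = X at hu ⊢
    obtain ⟨u, hu'⟩ := u
    simp only at hu
    subst hu
    rcases Nat.even_or_odd' i with ⟨m, rfl | rfl⟩
    · rw [if_pos (even_two_mul m), oddMap, LinearMap.sub_apply, map_sub,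
        tensorRight_splitMap_of_ne hπ one_ne_zero, sub_zero,
        tensorRight_splitMap hπ (hp.leftFree_J hA _)]
      rw [pow_one]
      exact (isKoszulFamily R).odd_left m hu'
    · rw [if_neg (by simp), tensorRight_evenMap hπ (hp.leftFree_J hA _)]
      have h2 : 2 * m + 1 + 1 = 2 * (m + 1) := by ring
      rw [h2, J_two_mul] at hu'
      exact evenJ_succ_le m hu'
  have hsmul (a : A) (z : A ⊗[k] (J R i ⊗[k] A)) :
      tensorRight 𝒜 (J R i) (actL k A _ a z) = a • tensorRight 𝒜 (J R i) z := by
    induction z with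
    | zero => simp
    | tmul b z => simp [tensorRight, actL, TensorProduct.smul_tmul']
    | add x y hx hy => simp only [map_add, hx, hy, smul_add]
  have hone : actR k A (J R i) 1 = LinearMap.id := by
    have : (LinearMap.mul k A).flip 1 = LinearMap.id := by ext; simp
    simp [actR, this]
  induction x with
  | zero => simp
  | tmul a u =>
    rw [leftD_tmul, hone, LinearMap.id_apply, hsmul, key]
    rw [koszulD, freeLift_tmul, LinearMap.comp_apply]
  | add x y hx hy => rw [map_add, map_add, hx, hy]

omit hp hA in
/-- The isomorphism `W ⊗ B ≃ Bᵒᵖ ⊗ W`. -/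
def _root_.MultiKoszul.opComm (B W : Type*) [Ring B] [Algebra k B] [AddCommGroup W] [Module k W] :
    W ⊗[k] B ≃ₗ[k] Bᵐᵒᵖ ⊗[k] W :=
  (TensorProduct.comm k W B).trans
    (TensorProduct.congr (MulOpposite.opLinearEquiv k) (LinearEquiv.refl k W))

/-- The surviving term is now the one with the coefficient on the right. It carries a minus sign in
the odd bimodule differentials and none in the even ones, which gives `(-1) ^ (i + 1)`. The sign
does not affect images or kernels. -/
theorem opComm_rightD (i : ℕ) (x : J R (i + 1) ⊗[k] A) :
    opComm A (J R i) (rightD π R 𝒜 i x) = (-1 : ℤ) ^ (i + 1) •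
      koszulD (AlgHom.op π) (rightJ R) i (opComm A (J R (i + 1)) x) := by
  have hπ := hp.augmentation_apply hA
  have hsys := hp.isKoszulSystem_rightJ hA
  have hop (Y : J R i ⊗[k] TensorAlgebra k V) :
      freeLift (B := (TensorAlgebra k V)ᵐᵒᵖ) (rightJ R i) (opComm _ _ Y) =
        MulOpposite.op (mulRight (J R i) Y) := by
    induction Y with
    | zero => simp
    | tmul y t => rfl
    | add x y hx hy => simp only [map_add, hx, hy, MulOpposite.op_add]
  have hop2 (Y : J R i ⊗[k] TensorAlgebra k V) :
      opComm A (J R i) (LinearMap.lTensor _ π.toLinearMap Y) =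
        LinearMap.rTensor _ (AlgHom.op π).toLinearMap (opComm _ _ Y) := by
    induction Y with
    | zero => simp
    | tmul y t => rfl
    | add x y hx hy => simp only [map_add, hx, hy]
  have key (u : J R (i + 1)) : opComm A (J R i)
      (tensorLeft 𝒜 (J R i) ((if Even i then oddMap π (J R i) else evenMap π (J R i)) u)) =
        (-1 : ℤ) ^ (i + 1) • LinearMap.rTensor _ (AlgHom.op π).toLinearMap
          (koszulSplit (rightJ R) i u) := by
    obtain ⟨Y, hY⟩ := (opComm (k := k) (TensorAlgebra k V) (J R i)).surjective
      (koszulSplit (rightJ R) i u)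
    have hu : mulRight (J R i) Y = u := by
      apply MulOpposite.op_injective
      rw [← hop, hY]
      exact hsys.freeLift_koszulSplit i u
    rw [← hY, ← hop2]
    obtain ⟨u, hu'⟩ := u
    simp only at hu
    subst hu
    rcases Nat.even_or_odd' i with ⟨m, rfl | rfl⟩
    · have h0 : tensorLeft 𝒜 (J R (2 * m)) (oddMap π (J R (2 * m)) (mulRight (J R (2 * m)) Y)) =
          -tensorLeft 𝒜 (J R (2 * m))
            (splitMap π (J R (2 * m)) 0 1 (mulRight (J R (2 * m)) Y)) := by
        rw [oddMap, LinearMap.sub_apply, map_sub, tensorLeft_splitMap_of_ne hπ one_ne_zero]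
        exact zero_sub (tensorLeft 𝒜 (J R (2 * m)) _)
      rw [if_pos (even_two_mul m), h0, tensorLeft_splitMap hπ (hp.rightFree_J hA _), pow_succ, pow_mul]
      · refine ((opComm A (J R (2 * m))).toLinearMap.map_neg _).trans ?_
        simp
      · rw [pow_one]
        exact (isKoszulFamily R).odd_right m hu'
    · rw [if_neg (by simp), tensorLeft_evenMap hπ (hp.leftFree_J hA _) (hp.rightFree_J hA _)]
      · have h3 : 2 * m + 1 + 1 = 2 * (m + 1) := by ring
        rw [h3, pow_mul]
        simp
      · have h2 : 2 * m + 1 + 1 = 2 * (m + 1) := by ring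
        rw [h2, J_two_mul] at hu'
        exact evenJ_succ_le m hu'
  have hsmul (a : A) (z : A ⊗[k] (J R i ⊗[k] A)) :
      opComm A (J R i) (tensorLeft 𝒜 (J R i) (actR k A _ a z)) =
        MulOpposite.op a • opComm A (J R i) (tensorLeft 𝒜 (J R i) z) := by
    induction z using tensor3_induction with
    | h0 => simp
    | ht b w c => simp [tensorLeft, actR, opComm, TensorProduct.smul_tmul']
    | ha x y hx hy => simp only [map_add, hx, hy, smul_add]
  have hone : actL k A (J R i) 1 = LinearMap.id := by
    have : LinearMap.mul k A 1 = LinearMap.id := by ext; simp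
    simp [actL, this]
  induction x with
  | zero => simp
  | tmul u a =>
    rw [rightD_tmul, hone, LinearMap.id_apply, hsmul, key, smul_comm]
    have h2 : opComm (k := k) A (J R (i + 1)) (u ⊗ₜ a) = MulOpposite.op a ⊗ₜ u := rfl
    rw [h2, koszulD, freeLift_tmul, LinearMap.comp_apply]
  | add x y hx hy => simp only [map_add, hx, hy, smul_add]

omit hp [DirectSum.Decomposition 𝒱] in
theorem _root_.MultiKoszul.leftAug_apply (x : A ⊗[k] J R 0) :
    leftAug π R 𝒜 x = augHom 𝒜 hA (π (red (augHom 𝒜 hA) (J R 0) x)) := by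
  induction x with
  | zero => simp
  | tmul a u =>
    have h1 : leftAug π R 𝒜 (a ⊗ₜ u) = augHom 𝒜 hA (a * (π u * 1)) := rfl
    rw [h1, mul_one, map_mul, red_tmul, Submodule.coe_smul, map_smul, map_smul, smul_eq_mul]
  | add x y hx hy => simp only [map_add, hx, hy, Submodule.coe_add]

omit hp [DirectSum.Decomposition 𝒱] in
theorem _root_.MultiKoszul.rightAug_apply (x : J R 0 ⊗[k] A) :
    rightAug π R 𝒜 x =
      augHom 𝒜 hA (π (red (opAug (augHom 𝒜 hA)) (J R 0) (opComm A (J R 0) x))) := by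
  induction x with
  | zero => simp
  | tmul u a =>
    have h1 : rightAug π R 𝒜 (u ⊗ₜ a) = augHom 𝒜 hA (1 * (π u * a)) := rfl
    have h2 : opComm (k := k) A (J R 0) (u ⊗ₜ a) = MulOpposite.op a ⊗ₜ u := rfl
    rw [h1, h2, one_mul, map_mul, red_tmul, Submodule.coe_smul, map_smul, map_smul, smul_eq_mul,
      mul_comm]
    rfl
  | add x y hx hy => simp only [map_add, hx, hy, Submodule.coe_add]

/-- In position zero the augmentation to `k` is the reduction `A ⊗ J_0 → J_0` followed by the
bijection `J_0 ≃ k`, so it has the same kernel as the reduction and is surjective. -/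
theorem isLeftMultiKoszul_iff : IsLeftMultiKoszul π R 𝒜 ↔
    ∀ n, LinearMap.range (koszulD π (leftJ R) n) =
      freeCycles (augHom 𝒜 hA) (koszulD π (leftJ R)) n := by
  have hb := (hp.isKoszulSystem_leftJ hA).bijective
  have hs : Function.Surjective (leftAug π R 𝒜) := by
    intro c
    obtain ⟨u, hu⟩ := hb.surjective c
    exact ⟨(1 : A) ⊗ₜ[k] u, by rw [leftAug_apply hA]; simpa using hu⟩
  have h0 : Function.Exact (leftD π R 𝒜 0) (leftAug π R 𝒜) ↔
      LinearMap.range (koszulD π (leftJ R) 0) =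
        freeCycles (augHom 𝒜 hA) (koszulD π (leftJ R)) 0 := by
    rw [SetLike.ext_iff]
    refine forall_congr' fun y => ?_
    refine iff_comm.trans (iff_congr ?_ ?_)
    · rw [LinearMap.mem_range, Set.mem_range]
      simp only [hp.leftD_apply hA]
    · rw [leftAug_apply hA]
      refine ⟨fun h => ?_, fun h => ?_⟩
      · refine hb.injective (h.trans ?_)
        simp
      · have h1 : red (augHom 𝒜 hA) (J R 0) y = 0 := h
        rw [h1]
        simp
  have h1 (n : ℕ) : Function.Exact (leftD π R 𝒜 (n + 1)) (leftD π R 𝒜 n) ↔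
      LinearMap.range (koszulD π (leftJ R) (n + 1)) =
        freeCycles (augHom 𝒜 hA) (koszulD π (leftJ R)) (n + 1) := by
    rw [SetLike.ext_iff]
    refine forall_congr' fun y => ?_
    refine iff_comm.trans (iff_congr ?_ ?_)
    · rw [LinearMap.mem_range, Set.mem_range]
      simp only [hp.leftD_apply hA]
    · rw [hp.leftD_apply hA]
      rfl
  rw [IsLeftMultiKoszul, h0]
  simp only [h1, hs, true_and]
  exact ⟨fun h n => n.casesOn h.1 h.2, fun h => ⟨h 0, fun n => h (n + 1)⟩⟩

theorem isRightMultiKoszul_iff : IsRightMultiKoszul π R 𝒜 ↔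
    ∀ n, LinearMap.range (koszulD (AlgHom.op π) (rightJ R) n) =
      freeCycles (opAug (augHom 𝒜 hA)) (koszulD (AlgHom.op π) (rightJ R)) n := by
  have hb := (hp.isKoszulSystem_rightJ hA).bijective
  have hs : Function.Surjective (rightAug π R 𝒜) := by
    intro c
    obtain ⟨u, hu⟩ := hb.surjective c
    refine ⟨(opComm A (J R 0)).symm ((1 : Aᵐᵒᵖ) ⊗ₜ[k] u), ?_⟩
    rw [rightAug_apply hA, LinearEquiv.apply_symm_apply, red_tmul, map_one, one_smul]
    exact hu
  have hrange (n : ℕ) (y : J R n ⊗[k] A) : y ∈ Set.range (rightD π R 𝒜 n) ↔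
      opComm A (J R n) y ∈ LinearMap.range (koszulD (AlgHom.op π) (rightJ R) n) := by
    constructor
    · rintro ⟨x, rfl⟩
      rw [hp.opComm_rightD hA, ← map_zsmul]
      exact ⟨_, rfl⟩
    · rintro ⟨x, hx⟩
      refine ⟨(-1 : ℤ) ^ (n + 1) • (opComm A (J R (n + 1))).symm x, ?_⟩
      apply (opComm A (J R n)).injective
      rw [hp.opComm_rightD hA, map_zsmul, map_zsmul, LinearEquiv.apply_symm_apply, hx, smul_smul,
        ← mul_pow]
      simp
  have h0 : Function.Exact (rightD π R 𝒜 0) (rightAug π R 𝒜) ↔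
      LinearMap.range (koszulD (AlgHom.op π) (rightJ R) 0) =
        freeCycles (opAug (augHom 𝒜 hA)) (koszulD (AlgHom.op π) (rightJ R)) 0 := by
    rw [SetLike.ext_iff, (opComm A (J R 0)).surjective.forall]
    refine forall_congr' fun y => ?_
    refine iff_comm.trans (iff_congr (hrange 0 y) ?_)
    rw [rightAug_apply hA]
    refine ⟨fun h => ?_, fun h => ?_⟩
    · refine hb.injective (Eq.trans h ?_)
      simp
    · have h1 : red (opAug (augHom 𝒜 hA)) (J R 0) (opComm A (J R 0) y) = 0 := h
      rw [h1]
      simp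
  have h1 (n : ℕ) : Function.Exact (rightD π R 𝒜 (n + 1)) (rightD π R 𝒜 n) ↔
      LinearMap.range (koszulD (AlgHom.op π) (rightJ R) (n + 1)) =
        freeCycles (opAug (augHom 𝒜 hA)) (koszulD (AlgHom.op π) (rightJ R)) (n + 1) := by
    rw [SetLike.ext_iff, (opComm A (J R (n + 1))).surjective.forall]
    refine forall_congr' fun y => ?_
    refine iff_comm.trans (iff_congr (hrange (n + 1) y) ?_)
    rw [← (opComm A (J R n)).map_eq_zero_iff, hp.opComm_rightD hA]
    refine ⟨fun h => ?_, fun h => ?_⟩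
    · have h2 := congrArg (fun z => (-1 : ℤ) ^ (n + 1) • z) h
      simp only [smul_smul, ← mul_pow, smul_zero] at h2
      exact LinearMap.mem_ker.2 (by simpa using h2)
    · have h2 : koszulD (AlgHom.op π) (rightJ R) n (opComm A (J R (n + 1)) y) = 0 := h
      rw [h2, smul_zero]
  rw [IsRightMultiKoszul, h0]
  simp only [h1, hs, true_and]
  exact ⟨fun h n => n.casesOn h.1 h.2, fun h => ⟨h 0, fun n => h (n + 1)⟩⟩

end IsMinimalPresentation

end Differentials

/-! ### Gradings given by families of projections -/

section Projections

variable {k : Type u} [Field k] {M N L M' N' : Type*} [AddCommGroup M] [Module k M]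
  [AddCommGroup N] [Module k N] [AddCommGroup L] [Module k L] [AddCommGroup M'] [Module k M']
  [AddCommGroup N'] [Module k N']

/-- The elements that are homogeneous of degree `d` with respect to a family of endomorphisms. -/
def projHomog (p : ℕ → M →ₗ[k] M) (d : ℕ) : Submodule k M where
  carrier := {x | ∀ e, p e x = if e = d then x else 0}
  add_mem' {x y} hx hy e := by
    rw [map_add, hx, hy]
    split_ifs <;> simp
  zero_mem' e := by simp
  smul_mem' c x hx e := by
    rw [map_smul, hx]
    split_ifs <;> simp

theorem mem_projHomog {p : ℕ → M →ₗ[k] M} {d : ℕ} {x : M} :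
    x ∈ projHomog p d ↔ ∀ e, p e x = if e = d then x else 0 := Iff.rfl

theorem proj_apply_self {p : ℕ → M →ₗ[k] M} {d : ℕ} {x : M} (hx : x ∈ projHomog p d) :
    p d x = x := by rw [hx, if_pos rfl]

theorem proj_apply_of_ne {p : ℕ → M →ₗ[k] M} {d e : ℕ} {x : M} (hx : x ∈ projHomog p d)
    (h : e ≠ d) : p e x = 0 := by rw [hx, if_neg h]

/-- A family of endomorphisms consists of the projections onto the components of a grading. -/
def IsGradingProj (p : ℕ → M →ₗ[k] M) : Prop := ⨆ d, projHomog p d = ⊤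

theorem isGradingProj_of_le {p : ℕ → M →ₗ[k] M} {𝒢 : ℕ → Submodule k M}
    (h : ∀ d, 𝒢 d ≤ projHomog p d) (ht : ⨆ d, 𝒢 d = ⊤) : IsGradingProj p :=
  eq_top_iff.2 (ht.ge.trans (iSup_mono h))

/-- Homogeneous pieces that span and on which `p` acts as expected are all of the homogeneous
elements: `p d` then maps the whole space into `𝒢 d`. -/
theorem projHomog_eq {p : ℕ → M →ₗ[k] M} {𝒢 : ℕ → Submodule k M}
    (h : ∀ d, 𝒢 d ≤ projHomog p d) (ht : ⨆ d, 𝒢 d = ⊤) (d : ℕ) : projHomog p d = 𝒢 d := by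
  refine le_antisymm (fun x hx => ?_) (h d)
  have key : ∀ y ∈ ⨆ d, 𝒢 d, p d y ∈ 𝒢 d := by
    intro y hy
    refine Submodule.iSup_induction 𝒢 (motive := fun y => p d y ∈ 𝒢 d) hy ?_ ?_ ?_
    · intro e y hy
      by_cases hed : d = e
      · subst hed
        rwa [proj_apply_self (h d hy)]
      · rw [proj_apply_of_ne (h e hy) hed]
        exact zero_mem _
    · rw [map_zero]
      exact zero_mem _
    · intro x y hx hy
      rw [map_add]
      exact add_mem hx hy
  rw [← proj_apply_self hx]
  exact key x (by rw [ht]; trivial)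

theorem map_mem_projHomog {p : ℕ → M →ₗ[k] M} {p' : ℕ → N →ₗ[k] N} {f : M →ₗ[k] N}
    (hf : ∀ d x, f (p d x) = p' d (f x)) {d : ℕ} {x : M} (hx : x ∈ projHomog p d) :
    f x ∈ projHomog p' d := by
  intro e
  rw [← hf, hx]
  split_ifs <;> simp

/-- The family of endomorphisms of a tensor product induced by two such families. -/
def tensorProj (q : ℕ → M →ₗ[k] M) (r : ℕ → N →ₗ[k] N) (d : ℕ) : M ⊗[k] N →ₗ[k] M ⊗[k] N :=
  ∑ x ∈ Finset.HasAntidiagonal.antidiagonal d, TensorProduct.map (q x.1) (r x.2)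

theorem tensorProj_tmul (q : ℕ → M →ₗ[k] M) (r : ℕ → N →ₗ[k] N) (d : ℕ) (m : M) (n : N) :
    tensorProj q r d (m ⊗ₜ n) = ∑ x ∈ Finset.HasAntidiagonal.antidiagonal d, q x.1 m ⊗ₜ r x.2 n := by
  simp [tensorProj]

theorem tmul_mem_projHomog {q : ℕ → M →ₗ[k] M} {r : ℕ → N →ₗ[k] N} {d e : ℕ} {m : M} {n : N}
    (hm : m ∈ projHomog q d) (hn : n ∈ projHomog r e) :
    m ⊗ₜ n ∈ projHomog (tensorProj q r) (d + e) := by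
  intro f
  rw [tensorProj_tmul]
  split_ifs with h
  · rw [Finset.sum_eq_single (d, e)]
    · rw [proj_apply_self hm, proj_apply_self hn]
    · rintro ⟨a, b⟩ hab hne
      rw [Finset.HasAntidiagonal.mem_antidiagonal] at hab
      by_cases ha : a = d
      · have hb : b ≠ e := fun hb => hne (by rw [ha, hb])
        rw [proj_apply_of_ne hn hb, TensorProduct.tmul_zero]
      · rw [proj_apply_of_ne hm ha, TensorProduct.zero_tmul]
    · intro h'
      exact absurd (Finset.HasAntidiagonal.mem_antidiagonal.2 h.symm) h'
  · refine Finset.sum_eq_zero ?_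
    rintro ⟨a, b⟩ hab
    rw [Finset.HasAntidiagonal.mem_antidiagonal] at hab
    by_cases ha : a = d
    · have hb : b ≠ e := fun hb => h (by rw [← hab, ha, hb])
      rw [proj_apply_of_ne hn hb, TensorProduct.tmul_zero]
    · rw [proj_apply_of_ne hm ha, TensorProduct.zero_tmul]

theorem map_tensorProj {q : ℕ → M →ₗ[k] M} {r : ℕ → N →ₗ[k] N} {q' : ℕ → M' →ₗ[k] M'}
    {r' : ℕ → N' →ₗ[k] N'} {f : M →ₗ[k] M'} {g : N →ₗ[k] N'}
    (hf : ∀ d x, f (q d x) = q' d (f x)) (hg : ∀ d x, g (r d x) = r' d (g x)) (d : ℕ)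
    (x : M ⊗[k] N) : TensorProduct.map f g (tensorProj q r d x) =
      tensorProj q' r' d (TensorProduct.map f g x) := by
  induction x with
  | zero => simp
  | tmul m n => simp only [tensorProj_tmul, map_sum, TensorProduct.map_tmul, hf, hg]
  | add x y hx hy => simp only [map_add, hx, hy]

namespace IsGradingProj

variable {p : ℕ → M →ₗ[k] M} (hp : IsGradingProj p)
include hp

theorem induction {P : M → Prop} (x : M) (hh : ∀ d, ∀ x ∈ projHomog p d, P x) (h0 : P 0)
    (ha : ∀ x y, P x → P y → P (x + y)) : P x :=
  Submodule.iSup_induction (projHomog p) (motive := P)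
    ((hp : _ = _).ge (Submodule.mem_top (x := x))) hh h0 ha

theorem mem (d : ℕ) (x : M) : p d x ∈ projHomog p d := by
  induction x using hp.induction with
  | hh e x hx =>
    by_cases hed : d = e
    · subst hed
      rwa [proj_apply_self hx]
    · rw [proj_apply_of_ne hx hed]
      exact zero_mem _
  | h0 => rw [map_zero]; exact zero_mem _
  | ha x y hx hy => rw [map_add]; exact add_mem hx hy

theorem exists_sum (x : M) : ∃ n, ∀ m ≥ n, ∑ d ∈ Finset.range m, p d x = x := by
  induction x using hp.induction with
  | hh e x hx =>
    refine ⟨e + 1, fun m hm => ?_⟩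
    rw [Finset.sum_eq_single e, proj_apply_self hx]
    · exact fun d _ hd => proj_apply_of_ne hx hd
    · exact fun h => absurd (Finset.mem_range.2 (by omega)) h
  | h0 => exact ⟨0, by simp⟩
  | ha x y hx hy =>
    obtain ⟨a, ha⟩ := hx
    obtain ⟨b, hb⟩ := hy
    refine ⟨a + b, fun m hm => ?_⟩
    simp only [map_add, Finset.sum_add_distrib]
    rw [ha m (by omega), hb m (by omega)]

theorem map_proj {p' : ℕ → N →ₗ[k] N} {f : M →ₗ[k] N}
    (hf : ∀ d, ∀ x ∈ projHomog p d, f x ∈ projHomog p' d) (d : ℕ) (x : M) :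
    f (p d x) = p' d (f x) := by
  induction x using hp.induction with
  | hh e x hx =>
    rw [hf e x hx, hx]
    split_ifs <;> simp
  | h0 => simp
  | ha x y hx hy => simp only [map_add, hx, hy]

/-- The identity `p e ∘ p d = δ p d` and the finiteness of the decomposition are inherited by any
space embedded compatibly with the projections. This supplies the gradings of `J_n` and of the
irrelevant ideal. -/
theorem of_injective {r : ℕ → N →ₗ[k] N} {f : N →ₗ[k] M} (hf : Function.Injective f)
    (hr : ∀ d x, f (r d x) = p d (f x)) : IsGradingProj r := by
  have h1 (d) (x : N) : r d x ∈ projHomog r d := by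
    intro e
    apply hf
    rw [hr, hr, hp.mem d (f x) e]
    split_ifs
    · rw [hr]
    · rw [map_zero]
  refine eq_top_iff.2 fun x _ => ?_
  obtain ⟨n, hn⟩ := hp.exists_sum (f x)
  have h2 : ∑ d ∈ Finset.range n, r d x = x := by
    apply hf
    rw [map_sum]
    simp only [hr]
    exact hn n le_rfl
  rw [← h2]
  exact sum_mem fun d _ => Submodule.mem_iSup_of_mem d (h1 d x)

variable {r : ℕ → N →ₗ[k] N} (hr : IsGradingProj r)
include hr

/-- The tensors of homogeneous elements of total degree `d`. -/
def _root_.MultiKoszul.tensorHomog (p : ℕ → M →ₗ[k] M) (r : ℕ → N →ₗ[k] N) (d : ℕ) :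
    Submodule k (M ⊗[k] N) :=
  Submodule.span k {x | ∃ a b, a + b = d ∧ ∃ m ∈ projHomog p a, ∃ n ∈ projHomog r b, x = m ⊗ₜ n}

omit hp hr in
theorem _root_.MultiKoszul.tensorHomog_le (d : ℕ) :
    tensorHomog p r d ≤ projHomog (tensorProj p r) d := by
  refine Submodule.span_le.2 ?_
  rintro _ ⟨a, b, rfl, m, hm, n, hn, rfl⟩
  exact tmul_mem_projHomog hm hn

theorem iSup_tensorHomog : ⨆ d, tensorHomog p r d = ⊤ := by
  refine eq_top_iff.2 fun x _ => ?_
  induction x with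
  | zero => exact zero_mem _
  | tmul m n =>
    induction m using hp.induction with
    | hh a m hm =>
      induction n using hr.induction with
      | hh b n hn =>
        exact Submodule.mem_iSup_of_mem (a + b)
          (Submodule.subset_span ⟨a, b, rfl, m, hm, n, hn, rfl⟩)
      | h0 => rw [TensorProduct.tmul_zero]; exact zero_mem _
      | ha x y hx hy => rw [TensorProduct.tmul_add]; exact add_mem (hx trivial) (hy trivial)
    | h0 => rw [TensorProduct.zero_tmul]; exact zero_mem _
    | ha x y hx hy => rw [TensorProduct.add_tmul]; exact add_mem (hx trivial) (hy trivial)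
  | add x y hx hy => exact add_mem (hx trivial) (hy trivial)

theorem tensor : IsGradingProj (tensorProj p r) :=
  isGradingProj_of_le tensorHomog_le (iSup_tensorHomog hp hr)

theorem tensor_induction {d : ℕ} {P : M ⊗[k] N → Prop} {x : M ⊗[k] N}
    (hx : x ∈ projHomog (tensorProj p r) d)
    (ht : ∀ a b, a + b = d → ∀ m ∈ projHomog p a, ∀ n ∈ projHomog r b, P (m ⊗ₜ n)) (h0 : P 0)
    (ha : ∀ x y, P x → P y → P (x + y)) (hs : ∀ (c : k) x, P x → P (c • x)) : P x := by
  rw [projHomog_eq tensorHomog_le (iSup_tensorHomog hp hr)] at hx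
  refine Submodule.span_induction (p := fun x _ => P x) ?_ h0 (fun x y _ _ => ha x y)
    (fun c x _ => hs c x) hx
  rintro _ ⟨a, b, h, m, hm, n, hn, rfl⟩
  exact ht a b h m hm n hn

theorem tensor_map_proj {s : ℕ → L →ₗ[k] L} {f : M ⊗[k] N →ₗ[k] L}
    (hf : ∀ a b, ∀ m ∈ projHomog p a, ∀ n ∈ projHomog r b, f (m ⊗ₜ n) ∈ projHomog s (a + b))
    (d : ℕ) (x : M ⊗[k] N) : f (tensorProj p r d x) = s d (f x) := by
  refine (hp.tensor hr).map_proj (fun d x hx => ?_) d x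
  refine hp.tensor_induction hr (P := fun x => f x ∈ projHomog s d) hx ?_ ?_ ?_ ?_
  · rintro a b rfl m hm n hn
    exact hf a b m hm n hn
  · rw [map_zero]; exact zero_mem _
  · intro x y hx hy
    rw [map_add]; exact add_mem hx hy
  · intro c x hx
    rw [map_smul]; exact Submodule.smul_mem _ c hx

end IsGradingProj

end Projections

/-! ### The graded Nakayama lemma for free modules -/

section GradedFreeModules

variable {k : Type u} [Field k] {B : Type w} [Ring B] [Algebra k B] {ε : B →ₐ[k] k}
  {U : Type*} [AddCommGroup U] [Module k U]
  {q : ℕ → B →ₗ[k] B} {r : ℕ → U →ₗ[k] U}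

theorem smul_mem_projHomog (hq : IsGradingProj q) (hr : IsGradingProj r)
    (hm : ∀ a b, ∀ x ∈ projHomog q a, ∀ y ∈ projHomog q b, x * y ∈ projHomog q (a + b))
    {a d : ℕ} {b : B} {x : B ⊗[k] U} (hb : b ∈ projHomog q a)
    (hx : x ∈ projHomog (tensorProj q r) d) : b • x ∈ projHomog (tensorProj q r) (a + d) := by
  refine hq.tensor_induction hr
    (P := fun x => b • x ∈ projHomog (tensorProj q r) (a + d)) hx ?_ ?_ ?_ ?_
  · rintro e f rfl m hmem n hn
    rw [TensorProduct.smul_tmul', smul_eq_mul, ← add_assoc]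
    exact tmul_mem_projHomog (hm _ _ _ hb _ hmem) hn
  · rw [smul_zero]; exact zero_mem _
  · intro x y hx hy
    rw [smul_add]; exact add_mem hx hy
  · intro c x hx
    rw [smul_comm]; exact Submodule.smul_mem _ c hx

theorem tensorProj_smul (hq : IsGradingProj q) (hr : IsGradingProj r)
    (hm : ∀ a b, ∀ x ∈ projHomog q a, ∀ y ∈ projHomog q b, x * y ∈ projHomog q (a + b))
    (d : ℕ) (b : B) (x : B ⊗[k] U) : tensorProj q r d (b • x) =
      ∑ y ∈ Finset.HasAntidiagonal.antidiagonal d, q y.1 b • tensorProj q r y.2 x := by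
  have h := hq.tensor_map_proj (hq.tensor hr) (s := tensorProj q r)
    (f := TensorProduct.lift (Algebra.lsmul k k (B ⊗[k] U)).toLinearMap)
    (fun a b m hm' n hn => smul_mem_projHomog hq hr hm hm' hn) d (b ⊗ₜ x)
  rw [tensorProj_tmul, map_sum] at h
  exact h.symm

/-- The graded Nakayama lemma. -/
theorem le_of_le_sup_augIdeal_smul (hq : IsGradingProj q) (hr : IsGradingProj r)
    (hm : ∀ a b, ∀ x ∈ projHomog q a, ∀ y ∈ projHomog q b, x * y ∈ projHomog q (a + b))
    (hε : ∀ b, ε b = 0 → q 0 b = 0) {K N : Submodule B (B ⊗[k] U)}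
    (hN : ∀ d, ∀ x ∈ N, tensorProj q r d x ∈ N) (hK : K ≤ N ⊔ augIdeal ε • K) : K ≤ N := by
  -- Induction on the degree. In the component of degree `d` of `b • x` with `ε b = 0`, only
  -- components of `b` of positive degree contribute, so only components of `x` of degree less than
  -- `d` occur.
  have key : ∀ d, ∀ x ∈ K, tensorProj q r d x ∈ N := by
    intro d
    induction d using Nat.strong_induction_on with
    | _ d ih =>
      intro x hx
      obtain ⟨y, hy, z, hz, rfl⟩ := Submodule.mem_sup.1 (hK hx)
      rw [map_add]
      refine add_mem (hN d y hy) ?_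
      refine Submodule.smul_induction_on hz ?_ ?_
      · intro b hb x hx
        rw [tensorProj_smul hq hr hm]
        refine sum_mem ?_
        rintro ⟨e, f⟩ hef
        rw [Finset.HasAntidiagonal.mem_antidiagonal] at hef
        by_cases he : e = 0
        · subst he
          rw [hε b ((mem_augIdeal ε).1 hb), zero_smul]
          exact zero_mem _
        · exact Submodule.smul_mem _ _ (ih f (by simp only at hef; omega) x hx)
      · intro x y hx hy
        rw [map_add]
        exact add_mem hx hy
  intro x hx
  obtain ⟨n, hn⟩ := (hq.tensor hr).exists_sum x
  rw [← hn n le_rfl]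
  exact sum_mem fun d _ => key d x hx

end GradedFreeModules

/-! ### The internal grading of the bar complex -/

section GradedBar

variable {k : Type u} [Field k] {I : Type*} [NonUnitalRing I] [Module k I]
  (p : ℕ → I →ₗ[k] I)

/-- The projections onto the homogeneous components of the spaces of bar chains. -/
def barProj : ∀ n, ℕ → Bar k I n →ₗ[k] Bar k I n
  | 0, d => if d = 0 then LinearMap.id else 0
  | n + 1, d => barCons k I n ∘ₗ tensorProj p (barProj n) d ∘ₗ barSplit k I n

variable {p}

theorem barProj_barCons (n d : ℕ) (x : I ⊗[k] Bar k I n) :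
    barProj p (n + 1) d (barCons k I n x) = barCons k I n (tensorProj p (barProj p n) d x) := by
  rw [barProj, LinearMap.comp_apply, LinearMap.comp_apply, barSplit_barCons]

theorem barCons_mem_barGrading {n d e : ℕ} {a : I} {x : Bar k I n} (ha : a ∈ projHomog p d)
    (hx : x ∈ barGrading (projHomog p) n e) :
    barCons k I n (a ⊗ₜ x) ∈ barGrading (projHomog p) (n + 1) (d + e) := by
  refine Submodule.span_induction
    (p := fun x _ => barCons k I n (a ⊗ₜ x) ∈ barGrading (projHomog p) (n + 1) (d + e))
    ?_ ?_ ?_ ?_ hx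
  · rintro _ ⟨f, b, hb, rfl, rfl⟩
    rw [barCons_tprod]
    refine Submodule.subset_span ⟨Fin.cons d f, _, fun j => ?_, ?_, rfl⟩
    · refine Fin.cases ?_ (fun j => ?_) j
      · simpa using ha
      · simpa using hb j
    · rw [Fin.sum_univ_succ]
      simp
  · rw [TensorProduct.tmul_zero, map_zero]; exact zero_mem _
  · intro x y _ _ hx hy
    rw [TensorProduct.tmul_add, map_add]; exact add_mem hx hy
  · intro c x _ hx
    rw [TensorProduct.tmul_smul, map_smul]; exact Submodule.smul_mem _ c hx

theorem barGrading_le (n d : ℕ) : barGrading (projHomog p) n d ≤ projHomog (barProj p n) d := by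
  refine Submodule.span_le.2 ?_
  rintro _ ⟨e, a, ha, rfl, rfl⟩
  induction n with
  | zero =>
    intro f
    rw [barProj]
    simp only [Finset.univ_eq_empty, Finset.sum_empty]
    split_ifs <;> rfl
  | succ n ih =>
    have h1 := ih (Fin.tail e) (Fin.tail a) fun j => ha j.succ
    have h2 := map_mem_projHomog (fun d x => (barProj_barCons (p := p) n d x).symm)
      (tmul_mem_projHomog (ha 0) h1)
    rw [barCons_tprod, Fin.cons_self_tail] at h2
    rw [Fin.sum_univ_succ]
    exact h2

variable (hp : IsGradingProj p)
include hp

theorem iSup_barGrading (n : ℕ) : ⨆ d, barGrading (projHomog p) n d = ⊤ := by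
  refine eq_top_iff.2 fun x _ => ?_
  induction n with
  | zero =>
    refine Submodule.mem_iSup_of_mem 0 ?_
    induction x using PiTensorProduct.induction_on with
    | smul_tprod c a =>
      exact Submodule.smul_mem _ c (Submodule.subset_span ⟨fun _ => 0, a, fun j => j.elim0, by simp,
        rfl⟩)
    | add x y hx hy => exact add_mem (hx trivial) (hy trivial)
  | succ n ih =>
    induction x using bar_induction with
    | hc a y =>
      induction a using hp.induction with
      | hh d a ha =>
        refine Submodule.iSup_induction (barGrading (projHomog p) n) (ih y trivial)
          (motive := fun y => barCons k I n (a ⊗ₜ y) ∈ ⨆ d, barGrading (projHomog p) (n + 1) d)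
          ?_ ?_ ?_
        · intro e y hy
          exact Submodule.mem_iSup_of_mem (d + e) (barCons_mem_barGrading ha hy)
        · rw [TensorProduct.tmul_zero, map_zero]; exact zero_mem _
        · intro x y hx hy
          rw [TensorProduct.tmul_add, map_add]; exact add_mem hx hy
      | h0 => rw [TensorProduct.zero_tmul, map_zero]; exact zero_mem _
      | ha x y hx hy =>
        rw [TensorProduct.add_tmul, map_add]; exact add_mem (hx trivial) (hy trivial)
    | h0 => exact zero_mem _
    | ha x y hx hy => exact add_mem (hx trivial) (hy trivial)

theorem isGradingProj_barProj (n : ℕ) : IsGradingProj (barProj p n) :=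
  isGradingProj_of_le (barGrading_le n) (iSup_barGrading hp n)

theorem projHomog_barProj (n d : ℕ) :
    projHomog (barProj p n) d = barGrading (projHomog p) n d :=
  projHomog_eq (barGrading_le n) (iSup_barGrading hp n) d

variable [IsScalarTower k I I] [SMulCommClass k I I]
  (hm : ∀ a b, ∀ x ∈ projHomog p a, ∀ y ∈ projHomog p b, x * y ∈ projHomog p (a + b))
include hm

omit hp in
theorem barD_mem_barGrading {n d : ℕ} {x : Bar k I (n + 1)}
    (hx : x ∈ barGrading (projHomog p) (n + 1) d) : barD k I n x ∈ barGrading (projHomog p) n d := by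
  refine Submodule.span_induction (p := fun x _ => barD k I n x ∈ barGrading (projHomog p) n d)
    ?_ ?_ ?_ ?_ hx
  · rintro _ ⟨e, a, ha, rfl, rfl⟩
    clear hx x
    induction n with
    | zero => rw [barD_zero]; exact zero_mem _
    | succ n ih =>
      rw [← Fin.cons_self_tail a, ← barCons_tprod, barD_barCons]
      refine sub_mem ?_ ?_
      · rw [← Fin.cons_self_tail (Fin.tail a), ← barCons_tprod, barMerge_barCons]
        have h1 : ∑ j, e j = e 0 + e 1 + ∑ j : Fin n, e j.succ.succ := by
          simp only [Fin.sum_univ_succ, add_assoc, Fin.succ_zero_eq_one]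
        rw [h1]
        exact barCons_mem_barGrading (hm _ _ _ (ha 0) _ (ha 1))
          (Submodule.subset_span ⟨_, _, fun j => ha j.succ.succ, rfl, rfl⟩)
      · rw [Fin.sum_univ_succ]
        exact barCons_mem_barGrading (ha 0) (ih _ _ fun j => ha j.succ)
  · rw [map_zero]; exact zero_mem _
  · intro x y _ _ hx hy
    rw [map_add]; exact add_mem hx hy
  · intro c x _ hx
    rw [map_smul]; exact Submodule.smul_mem _ c hx

theorem barD_barProj (n d : ℕ) (x : Bar k I (n + 1)) :
    barD k I n (barProj p (n + 1) d x) = barProj p n d (barD k I n x) :=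
  (isGradingProj_barProj hp (n + 1)).map_proj (fun d x hx => by
    rw [projHomog_barProj hp] at hx ⊢
    exact barD_mem_barGrading hm hx) d x

end GradedBar

/-! ### Exactness in terms of the graded homology of the bar complex -/

section GradedKoszulSystem

variable {k : Type u} [Field k] {S : Type*} [Ring S] [Algebra k S]
  {B : Type w} [Ring B] [Algebra k B] (π : S →ₐ[k] B) (ε : B →ₐ[k] k)
  {U : ℕ → Type*} [∀ n, AddCommGroup (U n)] [∀ n, Module k (U n)] (j : ∀ n, U n →ₗ[k] S)
  {I : Type*} [NonUnitalRing I] [Module k I] [IsScalarTower k I I] [SMulCommClass k I I]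
  (κ : B →ₗ[k] I) (t : ℕ → S →ₗ[k] S) (q : ℕ → B →ₗ[k] B) (r : ∀ n, ℕ → U n →ₗ[k] U n) (p : ℕ → I →ₗ[k] I)

/-- Gradings of the spaces that are involved in a one-sided multi-Koszul complex. -/
structure IsGradedSystem : Prop where
  proj_S : IsGradingProj t
  proj_B : IsGradingProj q
  proj_U : ∀ n, IsGradingProj (r n)
  proj_I : IsGradingProj p
  mul_S : ∀ a b, ∀ x ∈ projHomog t a, ∀ y ∈ projHomog t b, x * y ∈ projHomog t (a + b)
  mul_B : ∀ a b, ∀ x ∈ projHomog q a, ∀ y ∈ projHomog q b, x * y ∈ projHomog q (a + b)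
  mul_I : ∀ a b, ∀ x ∈ projHomog p a, ∀ y ∈ projHomog p b, x * y ∈ projHomog p (a + b)
  map_π : ∀ d s, π (t d s) = q d (π s)
  map_j : ∀ n d u, j n (r n d u) = t d (j n u)
  map_κ : ∀ d b, κ (q d b) = p d (κ b)
  map_ε : ∀ d b, ε (q d b) = if d = 0 then ε b else 0
  proj_zero : ∀ b, ε b = 0 → q 0 b = 0
  finite : ∀ n d, FiniteDimensional k (projHomog (r n) d)

variable {π ε j κ t q r p}

namespace IsGradedSystem

variable (hg : IsGradedSystem π ε j κ t q r p) {G R : Submodule k S}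
  (h : IsKoszulSystem π ε G R j)
include hg h

/-- Multiplication respects degrees and the splitting is unique, so the homogeneous parts of the
splitting are the splittings of the homogeneous parts. -/
theorem koszulSplit_proj (n d : ℕ) (u : U (n + 1)) :
    koszulSplit j n (r (n + 1) d u) = tensorProj t (r n) d (koszulSplit j n u) := by
  apply h.eq_koszulSplit
  have h1 := hg.proj_S.tensor_map_proj (hg.proj_U n) (s := t)
    (f := (freeLift (B := S) (j n)).restrictScalars k) (fun a b s hs u hu =>
      hg.mul_S _ _ _ hs _ (map_mem_projHomog (hg.map_j n) hu)) d (koszulSplit j n u)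
  refine h1.trans ?_
  rw [LinearMap.restrictScalars_apply, h.freeLift_koszulSplit, hg.map_j]

theorem rTensor_koszulSplit_proj (n d : ℕ) (u : U (n + 1)) :
    LinearMap.rTensor (U n) π.toLinearMap (koszulSplit j n (r (n + 1) d u)) =
      tensorProj q (r n) d (LinearMap.rTensor (U n) π.toLinearMap (koszulSplit j n u)) := by
  rw [hg.koszulSplit_proj h]
  have h1 (d s) : π.toLinearMap (t d s) = q d (π.toLinearMap s) := hg.map_π d s
  have h2 (d : ℕ) (u : U n) : (LinearMap.id : U n →ₗ[k] U n) (r n d u) =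
      r n d ((LinearMap.id : U n →ₗ[k] U n) u) := rfl
  exact map_tensorProj h1 h2 d (koszulSplit j n u)

theorem koszulD_proj (n d : ℕ) (x : B ⊗[k] U (n + 1)) :
    koszulD π j n (tensorProj q (r (n + 1)) d x) = tensorProj q (r n) d (koszulD π j n x) := by
  refine hg.proj_B.tensor_map_proj (hg.proj_U (n + 1)) (s := tensorProj q (r n))
    (f := (koszulD π j n).restrictScalars k) (fun a b s hs u hu => ?_) d x
  exact smul_mem_projHomog hg.proj_B (hg.proj_U n) hg.mul_B hs
    (map_mem_projHomog (f := LinearMap.rTensor (U n) π.toLinearMap ∘ₗ koszulSplit j n)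
      (hg.rTensor_koszulSplit_proj h n) hu)

theorem koszulToBar_proj (n d : ℕ) (u : U n) :
    koszulToBar π ε j κ n (r n d u) = barProj p n d (koszulToBar π ε j κ n u) := by
  induction n generalizing d with
  | zero =>
    have h1 : ε (π (j 0 (r 0 d u))) = if d = 0 then ε (π (j 0 u)) else 0 := by
      rw [hg.map_j, hg.map_π, hg.map_ε]
    simp only [koszulToBar, LinearMap.comp_apply, AlgHom.toLinearMap_apply, AlgHom.comp_apply,
      h1, barProj]
    split_ifs
    · rfl
    · exact map_zero _
  | succ n ih =>
    rw [koszulToBar_succ, koszulToBar_succ, koszulD_one_tmul, koszulD_one_tmul,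
      hg.rTensor_koszulSplit_proj h, barProj_barCons, map_tensorProj hg.map_κ fun d u => ih d u]

variable {i : I →ₙₐ[k] B}
  (hi : IsAugmentationKernel ε i κ)
include hi

omit hg in
theorem koszulToBar_mem (n : ℕ) (u : U n) : koszulToBar π ε j κ n u ∈ barCycles k I n := by
  cases n with
  | zero => trivial
  | succ n => exact h.barD_koszulToBar hi n u

omit hg in
theorem exists_homology_map (n : ℕ) : ∃ f : U n →ₗ[k] BarHomology k I n,
    ∀ u, f u = Submodule.mkQ _ ⟨koszulToBar π ε j κ n u, koszulToBar_mem h hi n u⟩ :=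
  ⟨Submodule.mkQ _ ∘ₗ (koszulToBar π ε j κ n).codRestrict _ (koszulToBar_mem h hi n), fun _ => rfl⟩

omit hg h hi in
theorem _root_.MultiKoszul.mkQ_barCycles_eq {n : ℕ} {x y : barCycles k I n} :
    Submodule.mkQ ((LinearMap.range (barD k I n)).submoduleOf (barCycles k I n)) x =
      Submodule.mkQ _ y ↔ ∃ w, (x : Bar k I n) = y + barD k I n w := by
  rw [Submodule.mkQ_apply, Submodule.mkQ_apply, Submodule.Quotient.eq, Submodule.submoduleOf,
    Submodule.mem_comap, Submodule.subtype_apply, LinearMap.mem_range]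
  refine exists_congr fun w => ?_
  rw [AddSubgroupClass.coe_sub, eq_comm, sub_eq_iff_eq_add']

/-- Exactness makes the comparison map bijective onto the bar homology. What is left is that the
inverse also respects degrees. -/
theorem gradedIso_of_exact
    (hex : ∀ n, LinearMap.range (koszulD π j n) = freeCycles ε (koszulD π j) n) (n : ℕ) :
    GradedIso (gradingBarHomology (projHomog p) n) (projHomog (r n)) := by
  obtain ⟨f, hf⟩ := exists_homology_map h hi n
  have hc := h.isComparison hi
  have hinj : Function.Injective f := by
    rw [injective_iff_map_eq_zero]
    intro u hu
    rw [hf, ← map_zero (Submodule.mkQ _), mkQ_barCycles_eq] at hu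
    obtain ⟨w, hw⟩ := hu
    refine hc.injective_homology (fun m _ => hex m) (w := -w) ?_
    rw [hi.redD_barResD, LinearMap.neg_apply, map_neg, neg_neg]
    simpa using hw
  have hsurj : Function.Surjective f := by
    intro y
    obtain ⟨⟨z, hz⟩, rfl⟩ := Submodule.mkQ_surjective _ y
    cases n with
    | zero =>
      obtain ⟨u, rfl⟩ := hc.bijective.surjective z
      exact ⟨u, hf u⟩
    | succ n =>
      have hz' : IsComparison.redD ε (barResD (k := k) i) n z = 0 := by
        rw [hi.redD_barResD, LinearMap.neg_apply, neg_eq_zero]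
        exact hz
      obtain ⟨u, w, huw⟩ := hc.surjective_homology (fun m _ => hex m) hz'
      refine ⟨u, ?_⟩
      rw [hf, mkQ_barCycles_eq]
      refine ⟨w, ?_⟩
      rw [hi.redD_barResD, LinearMap.neg_apply] at huw
      simp only [huw, neg_add_cancel_right]
  -- If the class of `u` contains a cycle of degree `d`, projecting to degree `d` shows that `u` and
  -- its component of degree `d` have the same class. They are then equal by injectivity.
  have key (d : ℕ) (u : U n) :
      f u ∈ gradingBarHomology (projHomog p) n d ↔ u ∈ projHomog (r n) d := by
    constructor
    · rintro ⟨z, hz, hzu⟩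
      rw [hf, mkQ_barCycles_eq] at hzu
      obtain ⟨w, hw⟩ := hzu
      have hz' : (z : Bar k I n) ∈ projHomog (barProj p n) d := barGrading_le n d hz
      have h1 := congrArg (barProj p n d) hw
      rw [map_add, proj_apply_self hz', ← hg.koszulToBar_proj h,
        ← barD_barProj hg.proj_I hg.mul_I] at h1
      have h2 : f u = f (r n d u) := by
        rw [hf, hf, mkQ_barCycles_eq]
        refine ⟨barProj p (n + 1) d w - w, ?_⟩
        rw [map_sub]
        simp only at hw h1 ⊢
        rw [← add_sub_assoc]
        exact eq_sub_of_add_eq (hw.symm.trans h1)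
      rw [hinj h2]
      exact (hg.proj_U n).mem d u
    · intro hu
      refine ⟨⟨_, koszulToBar_mem h hi n u⟩, ?_, (hf u).symm⟩
      have h1 := map_mem_projHomog (hg.koszulToBar_proj h n) hu
      rw [projHomog_barProj hg.proj_I] at h1
      exact h1
  let e := LinearEquiv.ofBijective f ⟨hinj, hsurj⟩
  refine ⟨e.symm, fun d => ?_⟩
  ext u
  rw [← key]
  constructor
  · rintro ⟨y, hy, rfl⟩
    change e (e.symm y) ∈ _
    rwa [LinearEquiv.apply_symm_apply]
  · intro hu
    exact ⟨e u, hu, e.symm_apply_apply u⟩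

/-- Exactness below `n` and primitivity make the comparison map in degree `n + 1` injective. A
dimension count in each internal degree makes it surjective, and Nakayama turns this into exactness
in position `n`. -/
theorem exact_of_gradedIso
    (hiso : ∀ n, GradedIso (gradingBarHomology (projHomog p) n) (projHomog (r n))) (n : ℕ) :
    LinearMap.range (koszulD π j n) = freeCycles ε (koszulD π j) n := by
  induction n using Nat.strong_induction_on with
  | _ n ih =>
    have hc := h.isComparison hi
    obtain ⟨f, hf⟩ := exists_homology_map h hi (n + 1)
    have hinj : Function.Injective f := by
      rw [injective_iff_map_eq_zero]
      intro u hu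
      rw [hf, ← map_zero (Submodule.mkQ _), mkQ_barCycles_eq] at hu
      obtain ⟨w, hw⟩ := hu
      refine hc.injective_homology_of_primitive ih (h.primitive hi n) (w := -w) ?_
      rw [hi.redD_barResD, LinearMap.neg_apply, map_neg, neg_neg]
      simpa using hw
    obtain ⟨e, he⟩ := hiso (n + 1)
    let ψ : U (n + 1) →ₗ[k] U (n + 1) := e.toLinearMap ∘ₗ f
    have hψ : Function.Injective ψ := e.injective.comp hinj
    have hψd (d : ℕ) : ∀ u ∈ projHomog (r (n + 1)) d, ψ u ∈ projHomog (r (n + 1)) d := by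
      intro u hu
      rw [← he d]
      refine ⟨f u, ?_, rfl⟩
      refine ⟨⟨_, koszulToBar_mem h hi (n + 1) u⟩, ?_, (hf u).symm⟩
      have h1 := map_mem_projHomog (hg.koszulToBar_proj h (n + 1)) hu
      rw [projHomog_barProj hg.proj_I] at h1
      exact h1
    -- Composing with the given isomorphism produces an injective graded endomorphism of `U (n +
    -- 1)`, which is bijective on each finite-dimensional component. The given isomorphism may have
    -- nothing to do with `f`.
    have hsurj : Function.Surjective ψ := by
      rw [← LinearMap.range_eq_top, eq_top_iff, ← hg.proj_U (n + 1)]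
      refine iSup_le fun d u hu => ?_
      have := hg.finite (n + 1) d
      have h2 : Function.Injective (ψ.restrict (hψd d)) := fun x y hxy =>
        Subtype.ext (hψ (congrArg Subtype.val hxy))
      obtain ⟨v, hv⟩ := LinearMap.injective_iff_surjective.1 h2 ⟨u, hu⟩
      exact ⟨v, congrArg Subtype.val hv⟩
    refine le_antisymm (hc.range_le n) ?_
    refine le_of_le_sup_augIdeal_smul hg.proj_B (hg.proj_U n) hg.mul_B hg.proj_zero ?_
      (hc.cycles_le_of_surjective ih (h.red_eq_zero hi n) fun w hw => ?_)
    · rintro d _ ⟨x, rfl⟩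
      exact ⟨_, hg.koszulD_proj h n d x⟩
    · rw [hi.redD_barResD, LinearMap.neg_apply, neg_eq_zero] at hw
      obtain ⟨u, hu⟩ := hsurj (e (Submodule.mkQ _ ⟨w, hw⟩))
      have h3 : f u = Submodule.mkQ _ ⟨w, hw⟩ := e.injective hu
      rw [hf, eq_comm, mkQ_barCycles_eq] at h3
      obtain ⟨w', hw'⟩ := h3
      refine ⟨u, -w', ?_⟩
      rw [hi.redD_barResD, LinearMap.neg_apply, map_neg, neg_neg]
      exact hw'

theorem exact_iff_gradedIso :
    (∀ n, LinearMap.range (koszulD π j n) = freeCycles ε (koszulD π j) n) ↔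
      ∀ n, GradedIso (gradingBarHomology (projHomog p) n) (projHomog (r n)) :=
  ⟨hg.gradedIso_of_exact h hi, hg.exact_of_gradedIso h hi⟩

end IsGradedSystem

end GradedKoszulSystem

/-! ### The usual grading of the tensor algebra and its stable subspaces -/

section UsualGrading

variable {k : Type u} [Field k] {V : Type v} [AddCommGroup V] [Module k V]
  (𝒱 : ℕ → Submodule k V) [DirectSum.Decomposition 𝒱]

/-- The homomorphism `T(V) → T(V)[X]` that sends `v ∈ V` of degree `d` to `v X ^ d`. -/
def coaction : TensorAlgebra k V →ₐ[k] Polynomial (TensorAlgebra k V) :=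
  TensorAlgebra.lift k (DirectSum.toModule k ℕ _ (fun d =>
    (Polynomial.monomial d).restrictScalars k ∘ₗ TensorAlgebra.ι k ∘ₗ (𝒱 d).subtype) ∘ₗ
      (DirectSum.decomposeLinearEquiv 𝒱).toLinearMap)

/-- The projections onto the components of the usual grading of `T(V)`. -/
def usualProj (d : ℕ) : TensorAlgebra k V →ₗ[k] TensorAlgebra k V :=
  (Polynomial.lcoeff (TensorAlgebra k V) d).restrictScalars k ∘ₗ (coaction 𝒱).toLinearMap

variable {𝒱}

theorem usualProj_apply (d : ℕ) (x : TensorAlgebra k V) :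
    usualProj 𝒱 d x = (coaction 𝒱 x).coeff d := rfl

theorem usualProj_mul (d : ℕ) (x y : TensorAlgebra k V) :
    usualProj 𝒱 d (x * y) = ∑ a ∈ Finset.HasAntidiagonal.antidiagonal d,
      usualProj 𝒱 a.1 x * usualProj 𝒱 a.2 y := by
  simp only [usualProj_apply, map_mul, Polynomial.coeff_mul]

/-- Homogeneity is an equation for the algebra homomorphism `coaction`, so the multiplicativity of
the grading comes for free. -/
theorem mem_projHomog_usualProj {d : ℕ} {x : TensorAlgebra k V} :
    x ∈ projHomog (usualProj 𝒱) d ↔ coaction 𝒱 x = Polynomial.monomial d x := by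
  rw [Polynomial.ext_iff, mem_projHomog]
  refine forall_congr' fun e => ?_
  rw [Polynomial.coeff_monomial, usualProj_apply]
  simp only [eq_comm (a := e) (b := d)]

theorem mul_mem_projHomog_usualProj (a b : ℕ) (x) (hx : x ∈ projHomog (usualProj 𝒱) a) (y)
    (hy : y ∈ projHomog (usualProj 𝒱) b) : x * y ∈ projHomog (usualProj 𝒱) (a + b) := by
  rw [mem_projHomog_usualProj] at hx hy ⊢
  rw [map_mul, hx, hy, Polynomial.monomial_mul_monomial]

theorem one_mem_projHomog_usualProj : 1 ∈ projHomog (usualProj 𝒱) 0 := by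
  rw [mem_projHomog_usualProj, map_one]
  rfl

theorem ι_mem_projHomog_usualProj {d : ℕ} {v : V} (hv : v ∈ 𝒱 d) :
    TensorAlgebra.ι k v ∈ projHomog (usualProj 𝒱) d := by
  rw [mem_projHomog_usualProj, coaction, TensorAlgebra.lift_ι_apply]
  have h : DirectSum.decomposeLinearEquiv 𝒱 v = DirectSum.lof k ℕ (fun d => 𝒱 d) d ⟨v, hv⟩ :=
    DirectSum.decompose_of_mem 𝒱 hv
  rw [LinearMap.comp_apply, LinearEquiv.coe_coe, h, DirectSum.toModule_lof]
  rfl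

theorem usualGrading_le (d : ℕ) : usualGrading 𝒱 d ≤ projHomog (usualProj 𝒱) d := by
  refine Submodule.span_le.2 ?_
  rintro _ ⟨r, e, v, hv, rfl, rfl⟩
  induction r with
  | zero => simpa using one_mem_projHomog_usualProj
  | succ r ih =>
    rw [Fin.sum_univ_succ, List.ofFn_succ, List.prod_cons]
    exact mul_mem_projHomog_usualProj _ _ _ (ι_mem_projHomog_usualProj (hv 0)) _
      (ih (fun j => e j.succ) (fun j => v j.succ) fun j => hv j.succ)

omit [DirectSum.Decomposition 𝒱] in
theorem ι_mul_mem_usualGrading {d e : ℕ} {v : V} (hv : v ∈ 𝒱 d) {x : TensorAlgebra k V}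
    (hx : x ∈ usualGrading 𝒱 e) : TensorAlgebra.ι k v * x ∈ usualGrading 𝒱 (d + e) := by
  refine Submodule.span_induction
    (p := fun x _ => TensorAlgebra.ι k v * x ∈ usualGrading 𝒱 (d + e)) ?_ ?_ ?_ ?_ hx
  · rintro _ ⟨r, f, w, hw, rfl, rfl⟩
    refine Submodule.subset_span ⟨r + 1, Fin.cons d f, Fin.cons v w, fun j => ?_, ?_, ?_⟩
    · refine Fin.cases ?_ (fun j => ?_) j
      · simpa using hv
      · simpa using hw j
    · simp [Fin.sum_univ_succ]
    · simp [List.ofFn_succ]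
  · rw [mul_zero]; exact zero_mem _
  · intro x y _ _ hx hy
    rw [mul_add]; exact add_mem hx hy
  · intro c x _ hx
    rw [mul_smul_comm]; exact Submodule.smul_mem _ c hx

theorem iSup_usualGrading : ⨆ d, usualGrading 𝒱 d = ⊤ := by
  rw [← top_le_iff, ← iSup_gen_pow]
  refine iSup_le fun n => ?_
  induction n with
  | zero =>
    rw [pow_zero, Submodule.one_le]
    exact Submodule.mem_iSup_of_mem 0 (Submodule.subset_span
      ⟨0, fun j => j.elim0, fun j => j.elim0, fun j => j.elim0, by simp, by simp⟩)
  | succ n ih =>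
    rw [pow_succ', Submodule.mul_le]
    rintro _ ⟨v, rfl⟩ x hx
    induction v using DirectSum.Decomposition.inductionOn 𝒱 with
    | zero => rw [map_zero, zero_mul]; exact zero_mem _
    | @homogeneous d v =>
      refine Submodule.iSup_induction (usualGrading 𝒱) (ih hx)
        (motive := fun x => TensorAlgebra.ι k (v : V) * x ∈ ⨆ d, usualGrading 𝒱 d) ?_ ?_ ?_
      · intro e y hy
        exact Submodule.mem_iSup_of_mem (d + e) (ι_mul_mem_usualGrading v.2 hy)
      · rw [mul_zero]; exact zero_mem _
      · intro x y hx hy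
        rw [mul_add]; exact add_mem hx hy
    | add v w hv hw => rw [map_add, add_mul]; exact add_mem hv hw

variable (𝒱) in
theorem isGradingProj_usualProj : IsGradingProj (usualProj 𝒱) :=
  isGradingProj_of_le usualGrading_le iSup_usualGrading

theorem projHomog_usualProj (d : ℕ) : projHomog (usualProj 𝒱) d = usualGrading 𝒱 d :=
  projHomog_eq usualGrading_le iSup_usualGrading d

/-- A subspace is stable under a family of endomorphisms. -/
def IsProjStable {M : Type*} [AddCommGroup M] [Module k M] (p : ℕ → M →ₗ[k] M)
    (P : Submodule k M) : Prop := ∀ d, ∀ x ∈ P, p d x ∈ P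

section Stable

variable {M : Type*} [AddCommGroup M] [Module k M] {p : ℕ → M →ₗ[k] M}

theorem IsProjStable.inf {P Q : Submodule k M} (hP : IsProjStable p P) (hQ : IsProjStable p Q) :
    IsProjStable p (P ⊓ Q) := fun d x hx => ⟨hP d x hx.1, hQ d x hx.2⟩

theorem IsProjStable.iInf {ι : Sort*} {P : ι → Submodule k M} (h : ∀ i, IsProjStable p (P i)) :
    IsProjStable p (⨅ i, P i) := fun d x hx => by
  rw [Submodule.mem_iInf] at hx ⊢
  exact fun i => h i d x (hx i)

theorem IsProjStable.iSup {ι : Sort*} {P : ι → Submodule k M} (h : ∀ i, IsProjStable p (P i)) :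
    IsProjStable p (⨆ i, P i) := fun d => by
  change (⨆ i, P i) ≤ (⨆ i, P i).comap (p d)
  exact iSup_le fun i x hx => Submodule.mem_iSup_of_mem i (h i d x hx)

end Stable

theorem IsProjStable.mul {P Q : Submodule k (TensorAlgebra k V)}
    (hP : IsProjStable (usualProj 𝒱) P) (hQ : IsProjStable (usualProj 𝒱) Q) :
    IsProjStable (usualProj 𝒱) (P * Q) := fun d => by
  change P * Q ≤ (P * Q).comap (usualProj 𝒱 d)
  rw [Submodule.mul_le]
  intro a ha b hb
  rw [Submodule.mem_comap, usualProj_mul]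
  exact sum_mem fun x _ => Submodule.mul_mem_mul (hP _ _ ha) (hQ _ _ hb)

theorem isProjStable_one : IsProjStable (usualProj 𝒱) 1 := by
  intro d x hx
  obtain ⟨c, rfl⟩ := Submodule.mem_one.1 hx
  rw [Algebra.algebraMap_eq_smul_one, map_smul, one_mem_projHomog_usualProj]
  split_ifs
  · exact Submodule.smul_mem _ c (Submodule.one_le.1 le_rfl)
  · rw [smul_zero]; exact zero_mem _

theorem IsProjStable.pow {P : Submodule k (TensorAlgebra k V)}
    (hP : IsProjStable (usualProj 𝒱) P) (n : ℕ) : IsProjStable (usualProj 𝒱) (P ^ n) := by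
  induction n with
  | zero => rw [pow_zero]; exact isProjStable_one
  | succ n ih => rw [pow_succ]; exact ih.mul hP

theorem isProjStable_prod {l : List (Submodule k (TensorAlgebra k V))}
    (h : ∀ P ∈ l, IsProjStable (usualProj 𝒱) P) : IsProjStable (usualProj 𝒱) l.prod := by
  induction l with
  | nil => exact isProjStable_one
  | cons P l ih =>
    rw [List.prod_cons]
    exact (h P (by simp)).mul (ih fun Q hQ => h Q (by simp [hQ]))

theorem isProjStable_gen : IsProjStable (usualProj 𝒱) (gen k V) := by
  rintro d _ ⟨v, rfl⟩
  induction v using DirectSum.Decomposition.inductionOn 𝒱 with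
  | zero => rw [map_zero, map_zero]; exact zero_mem _
  | @homogeneous e v =>
    rw [ι_mem_projHomog_usualProj v.2]
    split_ifs
    · exact ⟨v, rfl⟩
    · exact zero_mem _
  | add v w hv hw => rw [map_add, map_add]; exact add_mem hv hw

variable {R : Submodule k (TensorAlgebra k V)} (hR : IsProjStable (usualProj 𝒱) R)
include hR

theorem isProjStable_evenJ (i : ℕ) : IsProjStable (usualProj 𝒱) (evenJ R i) := by
  induction i using Nat.strong_induction_on with
  | _ i ih =>
    cases i with
    | zero => rw [evenJ_zero]; exact isProjStable_one
    | succ i =>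
      rw [evenJ]
      refine IsProjStable.inf (.iSup fun N => .iInf fun n => .iInf fun m =>
        IsProjStable.mul (isProjStable_prod ?_) (isProjStable_gen.pow _)) (hR.pow _)
      intro P hP
      obtain ⟨j, rfl⟩ := (List.mem_ofFn' _ _).1 hP
      exact (isProjStable_gen.pow _).mul (ih _ (n.1 j).isLt)

theorem isProjStable_J (n : ℕ) : IsProjStable (usualProj 𝒱) (J R n) := by
  have h := isProjStable_evenJ hR (n / 2)
  rw [J]
  split_ifs
  · exact h
  · exact (isProjStable_gen.mul h).inf (h.mul isProjStable_gen)

/-- The projections onto the homogeneous components of `J_n`. -/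
def projJ (n d : ℕ) : J R n →ₗ[k] J R n := (usualProj 𝒱 d).restrict (isProjStable_J hR n d)

theorem isGradingProj_projJ (n : ℕ) : IsGradingProj (projJ hR n) :=
  (isGradingProj_usualProj 𝒱).of_injective (f := (J R n).subtype) (J R n).injective_subtype
    fun _ _ => rfl

theorem projHomog_projJ (n d : ℕ) : projHomog (projJ hR n) d = gradingJ 𝒱 R n d := by
  ext x
  rw [gradingJ, ← projHomog_usualProj, Submodule.submoduleOf, Submodule.mem_comap,
    mem_projHomog, mem_projHomog]
  refine forall_congr' fun e => ?_
  rw [Subtype.ext_iff]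
  change usualProj 𝒱 e x = _ ↔ usualProj 𝒱 e x = _
  split_ifs <;> rfl

end UsualGrading

/-! ### Projections of a graded algebra and of its irrelevant ideal -/

section GradedAlgebras

variable {k : Type u} [Field k] {A : Type w} [Ring A] [Algebra k A]
  (𝒜 : ℕ → Submodule k A) [GradedAlgebra 𝒜]

theorem gradedPiece_le (d : ℕ) : 𝒜 d ≤ projHomog (GradedAlgebra.proj 𝒜) d := by
  intro x hx e
  split_ifs with h
  · subst h
    exact DirectSum.decompose_of_mem_same 𝒜 hx
  · exact DirectSum.decompose_of_mem_ne 𝒜 hx (Ne.symm h)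

theorem iSup_gradedPiece : ⨆ d, 𝒜 d = ⊤ :=
  (DirectSum.Decomposition.isInternal 𝒜).submodule_iSup_eq_top

theorem isGradingProj_proj : IsGradingProj (GradedAlgebra.proj 𝒜) :=
  isGradingProj_of_le (gradedPiece_le 𝒜) (iSup_gradedPiece 𝒜)

theorem projHomog_proj (d : ℕ) : projHomog (GradedAlgebra.proj 𝒜) d = 𝒜 d :=
  projHomog_eq (gradedPiece_le 𝒜) (iSup_gradedPiece 𝒜) d

theorem proj_zero_proj (d : ℕ) (a : A) : GradedAlgebra.proj 𝒜 0 (GradedAlgebra.proj 𝒜 d a) =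
    if d = 0 then GradedAlgebra.proj 𝒜 0 a else 0 := by
  rw [(isGradingProj_proj 𝒜).mem d a 0]
  simp only [eq_comm (a := 0) (b := d)]
  split_ifs with h
  · rw [h]
  · rfl

theorem mem_irrelevant {a : A} : a ∈ irrelevant 𝒜 ↔ GradedAlgebra.proj 𝒜 0 a = 0 := Iff.rfl

/-- The inclusion of the irrelevant ideal. -/
abbrev irrelevantInc : irrelevant 𝒜 →ₙₐ[k] A := NonUnitalSubalgebraClass.subtype (irrelevant 𝒜)

/-- The projections onto the homogeneous components of the irrelevant ideal. -/
def irrelevantProj (d : ℕ) : irrelevant 𝒜 →ₗ[k] irrelevant 𝒜 where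
  toFun a := ⟨GradedAlgebra.proj 𝒜 d a, by
    rw [mem_irrelevant, proj_zero_proj, (mem_irrelevant 𝒜).1 a.2, ite_self]⟩
  map_add' a b := Subtype.ext (map_add (GradedAlgebra.proj 𝒜 d) (a : A) b)
  map_smul' c a := Subtype.ext (map_smul (GradedAlgebra.proj 𝒜 d) c (a : A))

/-- The projection `a ↦ a - a_0` onto the irrelevant ideal. -/
def toIrrelevant : A →ₗ[k] irrelevant 𝒜 where
  toFun a := ⟨a - GradedAlgebra.proj 𝒜 0 a, by
    rw [mem_irrelevant, map_sub, proj_zero_proj, if_pos rfl, sub_self]⟩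
  map_add' a b := Subtype.ext (by
    change a + b - GradedAlgebra.proj 𝒜 0 (a + b) = (a - _) + (b - _)
    rw [map_add]
    abel)
  map_smul' c a := Subtype.ext (by
    change c • a - GradedAlgebra.proj 𝒜 0 (c • a) = c • (a - _)
    rw [map_smul, smul_sub])

theorem isAugmentationKernel (hA : IsConnectedGraded 𝒜) :
    IsAugmentationKernel (augHom 𝒜 hA) (irrelevantInc 𝒜) (toIrrelevant 𝒜) where
  injective := Subtype.val_injective
  apply_eq_zero a := (augHom_eq_zero_iff hA _).2 a.2
  apply_proj b := by
    rw [augHom_apply, algebraMap_augmentation hA]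
    rfl

theorem isGradingProj_irrelevantProj : IsGradingProj (irrelevantProj 𝒜) :=
  (isGradingProj_proj 𝒜).of_injective (f := (irrelevantInc 𝒜 : irrelevant 𝒜 →ₗ[k] A))
    Subtype.val_injective fun _ _ => rfl

theorem mem_projHomog_irrelevantProj {d : ℕ} {a : irrelevant 𝒜} :
    a ∈ projHomog (irrelevantProj 𝒜) d ↔ (a : A) ∈ 𝒜 d := by
  rw [← projHomog_proj 𝒜 d, mem_projHomog, mem_projHomog]
  refine forall_congr' fun e => ?_
  rw [Subtype.ext_iff]
  change GradedAlgebra.proj 𝒜 e a = _ ↔ GradedAlgebra.proj 𝒜 e a = _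
  split_ifs <;> rfl

theorem projHomog_irrelevantProj (d : ℕ) : projHomog (irrelevantProj 𝒜) d =
    (𝒜 d).comap (NonUnitalSubalgebra.toSubmodule (irrelevant 𝒜)).subtype :=
  Submodule.ext fun _ => mem_projHomog_irrelevantProj 𝒜

end GradedAlgebras

/-! ### Compatibility of the gradings and finiteness -/

section Presentation

variable {k : Type u} [Field k] {V : Type v} [AddCommGroup V] [Module k V]
  {𝒱 : ℕ → Submodule k V} [DirectSum.Decomposition 𝒱]
  {A : Type w} [Ring A] [Algebra k A] {𝒜 : ℕ → Submodule k A} [GradedAlgebra 𝒜]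
  {π : TensorAlgebra k V →ₐ[k] A} {R : Submodule k (TensorAlgebra k V)}

namespace IsMinimalPresentation

variable (hp : IsMinimalPresentation 𝒱 𝒜 π R)
include hp

theorem isProjStable : IsProjStable (usualProj 𝒱) R := by
  rw [hp.graded]
  refine .iSup fun d => ?_
  intro e x hx
  have h1 : x ∈ projHomog (usualProj 𝒱) d := usualGrading_le d hx.2
  rw [h1]
  split_ifs
  · exact hx
  · exact zero_mem _

theorem map_usualProj (d : ℕ) (s : TensorAlgebra k V) :
    π (usualProj 𝒱 d s) = GradedAlgebra.proj 𝒜 d (π s) := by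
  refine (isGradingProj_usualProj 𝒱).map_proj (f := π.toLinearMap) (fun d x hx => ?_) d s
  rw [projHomog_usualProj] at hx
  apply gradedPiece_le
  refine Submodule.span_induction (p := fun x _ => π x ∈ 𝒜 d) ?_ ?_ ?_ ?_ hx
  · rintro _ ⟨r, e, v, hv, rfl, rfl⟩
    rw [map_list_prod, List.map_ofFn, ← List.sum_ofFn]
    exact SetLike.list_prod_ofFn_mem_graded _ _ fun j => hp.map_mem _ _ (hv j)
  · rw [map_zero]; exact zero_mem _
  · intro x y _ _ hx hy
    rw [map_add]; exact add_mem hx hy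
  · intro c x _ hx
    rw [map_smul]; exact Submodule.smul_mem _ c hx

/-- The kernel of `π` has tensor length at least two, so `𝒱 d` embeds in the finite-dimensional `𝒜
d`. -/
theorem finiteDimensional_generators (hfin : ∀ n, FiniteDimensional k (𝒜 n)) (d : ℕ) :
    FiniteDimensional k (𝒱 d) := by
  have := hfin d
  let f : 𝒱 d →ₗ[k] 𝒜 d := (π.toLinearMap ∘ₗ TensorAlgebra.ι k).restrict
    fun v hv => hp.map_mem d v hv
  refine FiniteDimensional.of_injective f ?_
  rw [injective_iff_map_eq_zero]
  intro v hv
  have h1 : π (TensorAlgebra.ι k (v : V)) = 0 := congrArg Subtype.val hv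
  have h2 := hp.ker_le_tensorGE (LinearMap.mem_ker.2 h1)
  let p := GradedAlgebra.proj (fun n : ℕ => gen k V ^ n) 1
  have h3 : tensorGE k V 2 ≤ LinearMap.ker p := tensorGE_le fun n hn s hs =>
    DirectSum.decompose_of_mem_ne (fun n : ℕ => gen k V ^ n) hs (by omega)
  have h4 : p (TensorAlgebra.ι k (v : V)) = TensorAlgebra.ι k (v : V) :=
    DirectSum.decompose_of_mem_same (fun n : ℕ => gen k V ^ n)
      (by rw [pow_one]; exact ⟨(v : V), rfl⟩)
  have h5 : TensorAlgebra.ι k (v : V) = 0 := by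
    rw [← h4]
    exact h3 h2
  exact Subtype.ext ((TensorAlgebra.ι_eq_zero_iff (R := k) (v : V)).1 h5)

/-- A nonempty word of degree `d` begins with a generator of positive degree followed by a word of
smaller degree. Only finitely many first degrees occur, and the empty word contributes at most `k ·
1`. -/
theorem finiteDimensional_usualGrading (hfin : ∀ n, FiniteDimensional k (𝒜 n)) (d : ℕ) :
    FiniteDimensional k (usualGrading 𝒱 d) := by
  induction d using Nat.strong_induction_on with
  | _ d ih =>
    have h1 : usualGrading 𝒱 d ≤ 1 ⊔ ⨆ e : Fin d,
        (𝒱 (e + 1)).map (TensorAlgebra.ι k) * usualGrading 𝒱 (d - (e + 1)) := by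
      refine Submodule.span_le.2 ?_
      rintro _ ⟨r, e, v, hv, rfl, rfl⟩
      cases r with
      | zero =>
        refine Submodule.mem_sup_left ?_
        rw [List.ofFn_zero, List.prod_nil]
        exact Submodule.one_le.1 le_rfl
      | succ r =>
        refine Submodule.mem_sup_right ?_
        rw [List.ofFn_succ, List.prod_cons]
        by_cases h0 : e 0 = 0
        · have h2 : v 0 = 0 := by
            have h3 := hv 0
            rw [h0] at h3
            exact (Submodule.mem_bot k).1 (hp.positive.le h3)
          rw [h2, map_zero, zero_mul]
          exact zero_mem _
        · have hs : ∑ j, e j = e 0 + ∑ j : Fin r, e j.succ := Fin.sum_univ_succ e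
          -- The supremum is indexed by the degree of the first letter minus one, so that only the
          -- positive degrees up to `d` occur.
          refine Submodule.mem_iSup_of_mem ⟨e 0 - 1, by omega⟩ ?_
          have h4 : e 0 - 1 + 1 = e 0 := by omega
          have h5 : ∑ j, e j - e 0 = ∑ j : Fin r, e j.succ := by omega
          simp only [h4, h5]
          exact Submodule.mul_mem_mul (Submodule.mem_map_of_mem (hv 0))
            (Submodule.subset_span ⟨_, _, _, fun j => hv j.succ, rfl, rfl⟩)
    have h2 : (1 ⊔ ⨆ e : Fin d, (𝒱 (e + 1)).map (TensorAlgebra.ι k) *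
        usualGrading 𝒱 (d - (e + 1)) : Submodule k (TensorAlgebra k V)).FG := by
      refine Submodule.FG.sup (Submodule.one_eq_span (R := k) (A := TensorAlgebra k V) ▸
        Submodule.fg_span_singleton 1) (Submodule.fg_iSup _ fun e => ?_)
      have h3 := hp.finiteDimensional_generators hfin (e + 1)
      have h4 := ih (d - (e + 1)) (by omega)
      exact Submodule.FG.mul (((𝒱 (e + 1)).fg_iff_finiteDimensional.2 h3).map _)
        ((Submodule.fg_iff_finiteDimensional _).2 h4)
    have h3 := (Submodule.fg_iff_finiteDimensional _).1 h2
    exact Submodule.finiteDimensional_of_le h1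

theorem isGradedSystem (hA : IsConnectedGraded 𝒜) (hfin : ∀ n, FiniteDimensional k (𝒜 n)) :
    IsGradedSystem π (augHom 𝒜 hA) (leftJ R) (toIrrelevant 𝒜) (usualProj 𝒱)
      (GradedAlgebra.proj 𝒜) (projJ hp.isProjStable) (irrelevantProj 𝒜) where
  proj_S := isGradingProj_usualProj 𝒱
  proj_B := isGradingProj_proj 𝒜
  proj_U := isGradingProj_projJ hp.isProjStable
  proj_I := isGradingProj_irrelevantProj 𝒜
  mul_S := mul_mem_projHomog_usualProj
  mul_B a b x hx y hy := by
    rw [projHomog_proj] at hx hy ⊢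
    exact SetLike.mul_mem_graded hx hy
  mul_I a b x hx y hy := by
    rw [mem_projHomog_irrelevantProj] at hx hy ⊢
    exact SetLike.mul_mem_graded hx hy
  map_π := hp.map_usualProj
  map_j _ _ _ := rfl
  map_κ d b := Subtype.ext (by
    change GradedAlgebra.proj 𝒜 d b - GradedAlgebra.proj 𝒜 0 (GradedAlgebra.proj 𝒜 d b) =
      GradedAlgebra.proj 𝒜 d (b - GradedAlgebra.proj 𝒜 0 b)
    rw [map_sub, proj_zero_proj, (isGradingProj_proj 𝒜).mem 0 b d])
  map_ε d b := by
    have := hA.1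
    apply (algebraMap k A).injective
    rw [augHom_apply, augHom_apply, algebraMap_augmentation hA, proj_zero_proj]
    split_ifs
    · rw [algebraMap_augmentation hA]
    · rw [map_zero]
  proj_zero b hb := (augHom_eq_zero_iff hA b).1 hb
  finite n d := by
    have := hp.finiteDimensional_usualGrading hfin d
    rw [projHomog_projJ]
    refine FiniteDimensional.of_injective (V₂ := usualGrading 𝒱 d)
      ((J R n).subtype.restrict fun x hx => hx) ?_
    intro x y hxy
    have h1 := congrArg Subtype.val hxy
    exact Subtype.ext (Subtype.ext h1)

end IsMinimalPresentation
end Presentation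

/-! ### Passage to the opposite algebra -/

section Opposite

variable {k : Type u} [Field k]

/-- The endomorphisms of the opposite of a space that are induced by a family of endomorphisms. -/
def opProj {M : Type*} [AddCommGroup M] [Module k M] (p : ℕ → M →ₗ[k] M) (d : ℕ) :
    Mᵐᵒᵖ →ₗ[k] Mᵐᵒᵖ :=
  (MulOpposite.opLinearEquiv k).toLinearMap ∘ₗ p d ∘ₗ
    (MulOpposite.opLinearEquiv k).symm.toLinearMap

theorem mem_projHomog_opProj {M : Type*} [AddCommGroup M] [Module k M] {p : ℕ → M →ₗ[k] M} {d : ℕ}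
    {x : Mᵐᵒᵖ} : x ∈ projHomog (opProj p) d ↔ x.unop ∈ projHomog p d := by
  rw [mem_projHomog, mem_projHomog]
  refine forall_congr' fun e => ?_
  rw [← MulOpposite.unop_inj]
  change p e x.unop = _ ↔ _
  split_ifs <;> rfl

theorem IsGradingProj.op {M : Type*} [AddCommGroup M] [Module k M] {p : ℕ → M →ₗ[k] M}
    (hp : IsGradingProj p) : IsGradingProj (opProj p) :=
  hp.of_injective (f := (MulOpposite.opLinearEquiv k).symm.toLinearMap)
    (MulOpposite.opLinearEquiv k).symm.injective fun _ _ => rfl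

variable {S : Type*} [Ring S] [Algebra k S]
  {B : Type w} [Ring B] [Algebra k B] {π : S →ₐ[k] B} {ε : B →ₐ[k] k}
  {U : ℕ → Type*} [∀ n, AddCommGroup (U n)] [∀ n, Module k (U n)] {j : ∀ n, U n →ₗ[k] S}
  {I : Type*} [NonUnitalRing I] [Module k I] [IsScalarTower k I I] [SMulCommClass k I I]
  {κ : B →ₗ[k] I} {t : ℕ → S →ₗ[k] S} {q : ℕ → B →ₗ[k] B} {r : ∀ n, ℕ → U n →ₗ[k] U n}
  {p : ℕ → I →ₗ[k] I}

/-- The map of opposite spaces induced by a linear map. -/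
def opMap {M N : Type*} [AddCommGroup M] [Module k M] [AddCommGroup N] [Module k N]
    (f : M →ₗ[k] N) : Mᵐᵒᵖ →ₗ[k] Nᵐᵒᵖ :=
  (MulOpposite.opLinearEquiv k).toLinearMap ∘ₗ f ∘ₗ (MulOpposite.opLinearEquiv k).symm.toLinearMap

theorem IsGradedSystem.op (hg : IsGradedSystem π ε j κ t q r p) :
    IsGradedSystem (AlgHom.op π) (opAug ε)
      (fun n => (MulOpposite.opLinearEquiv k).toLinearMap ∘ₗ j n) (opMap κ)
      (opProj t) (opProj q) r (opProj p) where
  proj_S := hg.proj_S.op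
  proj_B := hg.proj_B.op
  proj_U := hg.proj_U
  proj_I := hg.proj_I.op
  mul_S a b x hx y hy := by
    rw [mem_projHomog_opProj] at hx hy ⊢
    rw [add_comm, MulOpposite.unop_mul]
    exact hg.mul_S _ _ _ hy _ hx
  mul_B a b x hx y hy := by
    rw [mem_projHomog_opProj] at hx hy ⊢
    rw [add_comm, MulOpposite.unop_mul]
    exact hg.mul_B _ _ _ hy _ hx
  mul_I a b x hx y hy := by
    rw [mem_projHomog_opProj] at hx hy ⊢
    rw [add_comm, MulOpposite.unop_mul]
    exact hg.mul_I _ _ _ hy _ hx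
  map_π d s := congrArg MulOpposite.op (hg.map_π d s.unop)
  map_j n d u := congrArg MulOpposite.op (hg.map_j n d u)
  map_κ d b := congrArg MulOpposite.op (hg.map_κ d b.unop)
  map_ε d b := hg.map_ε d b.unop
  proj_zero b hb := congrArg MulOpposite.op (hg.proj_zero b.unop hb)
  finite := hg.finite

/-- The homomorphism of opposite algebras induced by a homomorphism of nonunital algebras. -/
def nonUnitalOp (i : I →ₙₐ[k] B) : Iᵐᵒᵖ →ₙₐ[k] Bᵐᵒᵖ where
  toFun a := MulOpposite.op (i a.unop)
  map_smul' c a := congrArg MulOpposite.op (map_smul i c a.unop)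
  map_zero' := congrArg MulOpposite.op (map_zero i)
  map_add' a b := congrArg MulOpposite.op (map_add i a.unop b.unop)
  map_mul' a b := congrArg MulOpposite.op (map_mul i b.unop a.unop)

theorem IsAugmentationKernel.op {i : I →ₙₐ[k] B} (hi : IsAugmentationKernel ε i κ) :
    IsAugmentationKernel (opAug ε) (nonUnitalOp i) (opMap κ) where
  injective a b hab :=
    MulOpposite.unop_injective (hi.injective (MulOpposite.op_injective hab))
  apply_eq_zero a := hi.apply_eq_zero a.unop
  apply_proj b := congrArg MulOpposite.op (hi.apply_proj b.unop)

theorem GradedIso.symm {E F : Type*} [AddCommGroup E] [Module k E] [AddCommGroup F] [Module k F]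
    {ℰ : ℕ → Submodule k E} {ℱ : ℕ → Submodule k F} (h : GradedIso ℰ ℱ) : GradedIso ℱ ℰ := by
  obtain ⟨e, he⟩ := h
  refine ⟨e.symm, fun d => ?_⟩
  rw [← he]
  ext x
  constructor
  · rintro ⟨_, ⟨y, hy, rfl⟩, rfl⟩
    simpa using hy
  · intro hx
    exact ⟨e x, ⟨x, hx, rfl⟩, e.symm_apply_apply x⟩

theorem GradedIso.trans {E F G : Type*} [AddCommGroup E] [Module k E] [AddCommGroup F] [Module k F]
    [AddCommGroup G] [Module k G] {ℰ : ℕ → Submodule k E} {ℱ : ℕ → Submodule k F}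
    {𝒢 : ℕ → Submodule k G} (h : GradedIso ℰ ℱ) (h' : GradedIso ℱ 𝒢) : GradedIso ℰ 𝒢 := by
  obtain ⟨e, he⟩ := h
  obtain ⟨f, hf⟩ := h'
  refine ⟨e.trans f, fun d => ?_⟩
  rw [← hf, ← he, ← Submodule.map_comp]
  rfl

theorem barRev_mem_barCycles {n : ℕ} {x : Bar k Iᵐᵒᵖ n} :
    barRev k I n x ∈ barCycles k I n ↔ x ∈ barCycles k Iᵐᵒᵖ n := by
  cases n with
  | zero => exact Iff.rfl
  | succ n =>
    change barD k I n _ = 0 ↔ barD k Iᵐᵒᵖ n x = 0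
    rw [barD_barRev, smul_eq_zero_iff_right (pow_ne_zero _ (neg_ne_zero.2 one_ne_zero)),
      LinearEquiv.map_eq_zero_iff]

theorem barRev_mem_range {n : ℕ} {x : Bar k Iᵐᵒᵖ n} :
    barRev k I n x ∈ LinearMap.range (barD k I n) ↔ x ∈ LinearMap.range (barD k Iᵐᵒᵖ n) := by
  have h1 : ((-1 : k) ^ (n + 1)) * (-1) ^ (n + 1) = 1 := by
    rw [← mul_pow]
    simp
  constructor
  · rintro ⟨y, hy⟩
    refine ⟨(-1 : k) ^ (n + 1) • (barRev k I (n + 1)).symm y, ?_⟩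
    apply (barRev k I n).injective
    rw [map_smul, map_smul, ← barD_barRev, LinearEquiv.apply_symm_apply, hy]
  · rintro ⟨y, rfl⟩
    refine ⟨(-1 : k) ^ (n + 1) • barRev k I (n + 1) y, ?_⟩
    rw [map_smul, barD_barRev, smul_smul, h1, one_smul]

theorem barRev_mem_barGrading {n d : ℕ} {x : Bar k Iᵐᵒᵖ n} :
    barRev k I n x ∈ barGrading (projHomog p) n d ↔
      x ∈ barGrading (projHomog (opProj p)) n d := by
  have h1 : (barGrading (projHomog (opProj p)) n d).map (barRev k I n).toLinearMap =
      barGrading (projHomog p) n d := by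
    rw [barGrading, barGrading, Submodule.map_span]
    congr 1
    ext y
    constructor
    · rintro ⟨_, ⟨e, a, ha, hd, rfl⟩, rfl⟩
      refine ⟨fun i => e i.rev, fun i => (a i.rev).unop, fun i => mem_projHomog_opProj.1 (ha _), ?_,
        barRev_tprod a⟩
      rw [← hd]
      exact Equiv.sum_comp Fin.revPerm e
    · rintro ⟨e, a, ha, hd, rfl⟩
      refine ⟨_, ⟨fun i => e i.rev, fun i => MulOpposite.op (a i.rev),
        fun i => mem_projHomog_opProj.2 (ha _), ?_, rfl⟩, ?_⟩
      · rw [← hd]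
        exact Equiv.sum_comp Fin.revPerm e
      · refine (barRev_tprod _).trans ?_
        simp
  rw [← h1]
  refine ⟨?_, fun hx => ⟨x, hx, rfl⟩⟩
  rintro ⟨y, hy, hyx⟩
  rwa [← (barRev k I n).injective hyx]

theorem map_equiv_eq {M N : Type*} [AddCommMonoid M] [Module k M] [AddCommMonoid N] [Module k N]
    {e : M ≃ₗ[k] N} {P : Submodule k M} {Q : Submodule k N} (h : ∀ x, e x ∈ Q ↔ x ∈ P) :
    P.map (e : M →ₗ[k] N) = Q := by
  ext y
  constructor
  · rintro ⟨x, hx, rfl⟩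
    exact (h x).2 hx
  · intro hy
    exact ⟨e.symm y, (h _).1 (by rwa [e.apply_symm_apply]), e.apply_symm_apply y⟩

/-- Reversal of tensors commutes with the differentials up to sign and preserves internal degrees,
so it identifies cycles, boundaries and homogeneous parts. -/
theorem gradedIso_barHomology_op (n : ℕ) :
    GradedIso (gradingBarHomology (projHomog (opProj p)) n) (gradingBarHomology (projHomog p) n) := by
  let E : barCycles k Iᵐᵒᵖ n ≃ₗ[k] barCycles k I n :=
    (barRev k I n).ofSubmodules _ _ (map_equiv_eq fun _ => barRev_mem_barCycles)
  have hEx (x : barCycles k Iᵐᵒᵖ n) : (E x : Bar k I n) = barRev k I n x := rfl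
  have hE : ((LinearMap.range (barD k Iᵐᵒᵖ n)).submoduleOf (barCycles k Iᵐᵒᵖ n)).map
      (E : barCycles k Iᵐᵒᵖ n →ₗ[k] barCycles k I n) =
        (LinearMap.range (barD k I n)).submoduleOf (barCycles k I n) := by
    refine map_equiv_eq ?_
    intro x
    rw [Submodule.submoduleOf, Submodule.submoduleOf, Submodule.mem_comap, Submodule.mem_comap,
      Submodule.subtype_apply, Submodule.subtype_apply, hEx]
    exact barRev_mem_range
  refine ⟨Submodule.Quotient.equiv _ _ E hE, fun d => ?_⟩
  have hd : ((barGrading (projHomog (opProj p)) n d).submoduleOf (barCycles k Iᵐᵒᵖ n)).map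
      (E : barCycles k Iᵐᵒᵖ n →ₗ[k] barCycles k I n) =
        (barGrading (projHomog p) n d).submoduleOf (barCycles k I n) :=
    map_equiv_eq (e := E) fun x => by
      rw [Submodule.submoduleOf, Submodule.submoduleOf, Submodule.mem_comap, Submodule.mem_comap,
        Submodule.subtype_apply, Submodule.subtype_apply, hEx]
      exact barRev_mem_barGrading
  rw [gradingBarHomology, gradingBarHomology, ← hd, ← Submodule.map_comp, ← Submodule.map_comp]
  rfl

end Opposite

/-! ### The criterion for both sides -/

section MultiKoszulAlgebras

variable {k : Type u} [Field k] {V : Type v} [AddCommGroup V] [Module k V]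
  {𝒱 : ℕ → Submodule k V} [DirectSum.Decomposition 𝒱]
  {A : Type w} [Ring A] [Algebra k A] {𝒜 : ℕ → Submodule k A} [GradedAlgebra 𝒜]
  {π : TensorAlgebra k V →ₐ[k] A} {R : Submodule k (TensorAlgebra k V)}

theorem gradingTor_eq (i : ℕ) :
    gradingTor 𝒜 i = gradingBarHomology (projHomog (irrelevantProj 𝒜)) i := by
  rw [show projHomog (irrelevantProj 𝒜) = _ from funext (projHomog_irrelevantProj 𝒜)]
  rfl

namespace IsMinimalPresentation

variable (hp : IsMinimalPresentation 𝒱 𝒜 π R) (hA : IsConnectedGraded 𝒜)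
  (hfin : ∀ n, FiniteDimensional k (𝒜 n))
include hp hA hfin

theorem isLeftMultiKoszul_iff_gradedIso : IsLeftMultiKoszul π R 𝒜 ↔
    ∀ i, GradedIso (gradingTor 𝒜 i) (gradingJ 𝒱 R i) := by
  have hJ (i : ℕ) : projHomog (projJ hp.isProjStable i) = gradingJ 𝒱 R i :=
    funext (projHomog_projJ hp.isProjStable i)
  rw [hp.isLeftMultiKoszul_iff hA, (hp.isGradedSystem hA hfin).exact_iff_gradedIso
    (hp.isKoszulSystem_leftJ hA) (isAugmentationKernel 𝒜 hA)]
  simp only [hJ, gradingTor_eq]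

/-- The abstract criterion is applied to the opposite algebra. It yields the bar homology of the
opposite irrelevant ideal, which reversal identifies with `Tor`. -/
theorem isRightMultiKoszul_iff_gradedIso : IsRightMultiKoszul π R 𝒜 ↔
    ∀ i, GradedIso (gradingTor 𝒜 i) (gradingJ 𝒱 R i) := by
  have hJ (i : ℕ) : projHomog (projJ hp.isProjStable i) = gradingJ 𝒱 R i :=
    funext (projHomog_projJ hp.isProjStable i)
  have h1 := (hp.isGradedSystem hA hfin).op
  have h2 := (isAugmentationKernel 𝒜 hA).op
  have h3 := h1.exact_iff_gradedIso (hp.isKoszulSystem_rightJ hA) h2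
  rw [hp.isRightMultiKoszul_iff hA, h3]
  refine forall_congr' fun i => ?_
  rw [hJ, gradingTor_eq]
  have h4 := gradedIso_barHomology_op (p := irrelevantProj 𝒜) i
  exact ⟨fun h => h4.symm.trans h, fun h => h4.trans h⟩

end IsMinimalPresentation

end MultiKoszulAlgebras

end MultiKoszul

end

theorem proposition3p12 {k : Type*} [Field k]
    {V : Type*} [AddCommGroup V] [Module k V]
    (𝒱 : ℕ → Submodule k V) [DirectSum.Decomposition 𝒱]
    {A : Type*} [Ring A] [Algebra k A] (𝒜 : ℕ → Submodule k A) [GradedAlgebra 𝒜]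
    (hconn : MultiKoszul.IsConnectedGraded 𝒜) (hfin : ∀ n, FiniteDimensional k (𝒜 n))
    (π : TensorAlgebra k V →ₐ[k] A) (R : Submodule k (TensorAlgebra k V))
    (hpres : MultiKoszul.IsMinimalPresentation 𝒱 𝒜 π R) :
    (MultiKoszul.IsLeftMultiKoszul π R 𝒜 ↔
      ∀ i : ℕ, MultiKoszul.GradedIso (MultiKoszul.gradingTor 𝒜 i) (MultiKoszul.gradingJ 𝒱 R i)) ∧
    (MultiKoszul.IsRightMultiKoszul π R 𝒜 ↔
      ∀ i : ℕ, MultiKoszul.GradedIso (MultiKoszul.gradingTor 𝒜 i)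
        (MultiKoszul.gradingJ 𝒱 R i)) :=
  ⟨hpres.isLeftMultiKoszul_iff_gradedIso hconn hfin,
    hpres.isRightMultiKoszul_iff_gradedIso hconn hfin⟩
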